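/- Let $k$ be a field, $L$ a Lie $k$-algebra and $U(L)$ its universal enveloping algebra. Write $U_n$ for the $k$-subspace of $U(L)$ spanned by the products of at most $n$ elements of $L$ (so $U_0=k$), and let $T=\bigoplus_{n\ge 0}U_nt^n\subseteq U(L)[t]$ be the Rees ring of this filtration, where $t$ is a central variable; $T/tT$ is the associated graded ring of $U(L)$, a commutative domain. For every $n$ the image of $T\setminus tT$ in $T/t^nT$ is an Ore set; let $T_n$ be the corresponding Ore localization of $T/t^nT$. Cohn's division ring $\mathfrak{D}_L$ (in Lichtman's construction) is the localization of the inverse limit $\varprojlim_n T_n$ at the powers of the central element $t$. It contains $U(L)$ through $x\mapsto t^{-1}(xt)$ for $x\in L$, and $\mathfrak{D}(L)$ denotes the division subring of $\mathfrak{D}_L$ generated by $U(L)$. **Theorem.** Let $k$ be a field of characteristic zero and let $L$ be a nonabelian Lie $k$-algebra (of arbitrary dimension). Suppose that at least one of the following conditions is satisfied: 1. $L$ is residually nilpotent, that is, the intersection of the terms of the lower central series of $L$ is zero; 2. $U(L)$ is an Ore domain, that is, a domain in which any two nonzero elements have a nonzero common left multiple and a nonzero common right multiple. Then $\mathfrak{D}(L)$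 contains a noncommutative free group $k$-algebra: there is an injective homomorphism of $k$-algebras $k[F_2]\to\mathfrak{D}(L)$, where $F_2$ is the free group of rank two. -/

import Mathlib

/-- An Ore domain: a domain in which any two nonzero elements have a
nonzero common left multiple and a nonzero common right multiple. -/
def IsOreDomain (R : Type*) [Ring R] : Prop :=
  IsDomain R ∧
    (∀ a b : R, a ≠ 0 → b ≠ 0 → ∃ c d : R, c * a = d * b ∧ c * a ≠ 0) ∧
    (∀ a b : R, a ≠ 0 → b ≠ 0 → ∃ c d : R, a * c = b * d ∧ a * c ≠ 0)

/-- A Lie algebra is residually nilpotent if the intersection of the terms of its lower central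
series is zero. -/
def IsResiduallyNilpotent (k L : Type*) [CommRing k] [LieRing L] [LieAlgebra k L] : Prop :=
  (⨅ n : ℕ, LieModule.lowerCentralSeries k L L n) = ⊥

/-- The smallest `k`-subalgebra of `D` that contains `X` and contains the inverse of each of its
elements that is invertible in `D`. If `D` is a division ring and `k` a field, this is the division
subring of `D` generated by `k` and `X`. -/
def divisionClosure (k : Type*) {D : Type*} [CommRing k] [Ring D] [Algebra k D] (X : Set D) :
    Subalgebra k D :=
  sInf {S : Subalgebra k D | X ⊆ S ∧ ∀ x ∈ S, ∀ y : D, x * y = 1 → y * x = 1 → y ∈ S}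

/-! Cohn's division ring of a Lie algebra `L` over a field `k`, in Lichtman's construction. The Rees
ring `T` of the standard filtration of the enveloping algebra has a central element `t` such that
`T / (t)` is the associated graded ring, a commutative domain by the theorem of Poincaré, Birkhoff
and Witt. The image in `T / (tⁿ)` of the multiplicative set of the elements outside `(t)` is an Ore
set; the localizations at these sets form an inverse system, whose limit is a local ring with
maximal ideal generated by `t` and residue field the field of fractions of `T / (t)`. Inverting `t`
in the limit gives the division ring `𝔇_L`, which contains the enveloping algebra, and `𝔇(L)` is the
division subring that the enveloping algebra generates. -/

namespace Cohn

open scoped OreLocalization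

noncomputable section

/-! ### Ore sets of central elements, and Ore sets modulo a central nilpotent element -/

section OreSets

variable {A : Type*} [Ring A]

theorem nonempty_oreSet_of_central (S : Submonoid A) (hS : ∀ s ∈ S, ∀ a : A, s * a = a * s) :
    Nonempty (OreLocalization.OreSet S) := by
  rw [OreLocalization.nonempty_oreSet_iff]
  refine ⟨fun r₁ r₂ s h => ⟨s, ?_⟩, fun r s => ⟨r, s, hS s s.2 r⟩⟩
  rw [hS s s.2, hS s s.2, h]

theorem nonempty_oreSet_of_nilpotent (S : Submonoid A) (t : A) (N : ℕ)
    (htc : ∀ a : A, t * a = a * t) (htN : t ^ N = 0)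
    (hcomm : ∀ a b : A, ∃ c : A, a * b - b * a = t * c) :
    Nonempty (OreLocalization.OreSet S) := by
  have htc' : ∀ (i : ℕ) (a : A), t ^ i * a = a * t ^ i := fun i a =>
    ((show Commute t a from htc a).pow_left i).eq
  have key : ∀ (s c : A) (i : ℕ), ∃ c' : A, s * (t ^ i * c) = t ^ (i + 1) * c' + t ^ i * c * s := by
    intro s c i
    obtain ⟨c', hc'⟩ := hcomm s c
    refine ⟨c', ?_⟩
    rw [pow_succ, mul_assoc (t ^ i) t c', ← hc', mul_sub, ← mul_assoc s, ← htc' i s]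
    noncomm_ring
  have ore : ∀ (s : A) (j i : ℕ), i + j = N → ∀ c : A, ∃ r' : A,
      s ^ j * (t ^ i * c) = r' * s := by
    intro s j
    induction j with
    | zero =>
      intro i hi c
      obtain rfl : i = N := by omega
      exact ⟨0, by simp [htN]⟩
    | succ j ih =>
      intro i hi c
      obtain ⟨c', hc'⟩ := key s c i
      obtain ⟨r', hr'⟩ := ih (i + 1) (by omega) c'
      refine ⟨r' + s ^ j * (t ^ i * c), ?_⟩
      rw [pow_succ, mul_assoc, hc', mul_add, hr', add_mul, mul_assoc (s ^ j)]
  have canc : ∀ (s : A) (j i : ℕ), i + j = N → ∀ c : A,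
      (t ^ i * c) * s = 0 → s ^ j * (t ^ i * c) = 0 := by
    intro s j
    induction j with
    | zero =>
      intro i hi c _
      obtain rfl : i = N := by omega
      simp [htN]
    | succ j ih =>
      intro i hi c h0
      obtain ⟨c', hc'⟩ := key s c i
      rw [h0, add_zero] at hc'
      have h1 : t ^ (i + 1) * c' * s = 0 := by rw [← hc', mul_assoc, h0, mul_zero]
      rw [pow_succ, mul_assoc, hc']
      exact ih (i + 1) (by omega) c' h1
  rw [OreLocalization.nonempty_oreSet_iff]
  refine ⟨fun r₁ r₂ s h => ⟨s ^ N, ?_⟩, fun r s => ?_⟩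
  · have h0 : (t ^ 0 * (r₁ - r₂)) * (s : A) = 0 := by simp [sub_mul, h]
    have := canc s N 0 (by omega) (r₁ - r₂) h0
    simpa [mul_sub, sub_eq_zero] using this
  · obtain ⟨r', hr'⟩ := ore s N 0 (by omega) r
    exact ⟨r', s ^ N, by simpa using hr'⟩

end OreSets

attribute [local instance] LieRing.ofAssociativeRing LieAlgebra.ofAssociativeAlgebra

variable (k : Type*) (L : Type*) [Field k] [LieRing L] [LieAlgebra k L]

local notation "U" => UniversalEnvelopingAlgebra k L

/-! ### The standard filtration of the enveloping algebra and its Rees ring -/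

/-- The subspace `k + L` of the enveloping algebra. -/
def filtrationOne : Submodule k (U) :=
  1 ⊔ LinearMap.range (UniversalEnvelopingAlgebra.ι k : L →ₗ⁅k⁆ U).toLinearMap

theorem ι_mem_filtrationOne (x : L) : UniversalEnvelopingAlgebra.ι k x ∈ filtrationOne k L :=
  Submodule.mem_sup_right ⟨x, rfl⟩

/-- The standard (ascending) filtration of the enveloping algebra: the `n`-th term is spanned by
the products of at most `n` elements of `L`. -/
def filtration (n : ℕ) : Submodule k (U) := filtrationOne k L ^ n

theorem filtration_mono : Monotone (filtration k L) :=
  pow_right_mono₀ (show 1 ≤ filtrationOne k L from le_sup_left : (1 : Submodule k (U)) ≤ filtrationOne k L)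

theorem mul_mem_filtration {m n : ℕ} {a b : U} (ha : a ∈ filtration k L m)
    (hb : b ∈ filtration k L n) : a * b ∈ filtration k L (m + n) := by
  rw [filtration, pow_add]; exact Submodule.mul_mem_mul ha hb

theorem one_mem_filtration (n : ℕ) : (1 : U) ∈ filtration k L n :=
  filtration_mono k L (Nat.zero_le n) (by simp [filtration, Submodule.one_le.symm])

/-- The Rees ring of the standard filtration: the polynomials `∑ aₙ tⁿ` in a central variable `t`
over the enveloping algebra for which `aₙ` lies in the `n`-th term of the filtration. -/
def rees : Subalgebra k (Polynomial (U)) where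
  carrier := {p | ∀ n, p.coeff n ∈ filtration k L n}
  mul_mem' := by
    intro p q hp hq n
    rw [Polynomial.coeff_mul]
    refine Submodule.sum_mem _ fun x hx => ?_
    rw [← Finset.HasAntidiagonal.mem_antidiagonal.1 hx]
    exact mul_mem_filtration k L (hp _) (hq _)
  add_mem' := by
    intro p q hp hq n
    rw [Polynomial.coeff_add]
    exact Submodule.add_mem _ (hp n) (hq n)
  algebraMap_mem' := by
    intro r n
    rw [Polynomial.algebraMap_apply, Polynomial.coeff_C]
    split_ifs
    · rw [Algebra.algebraMap_eq_smul_one]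
      exact Submodule.smul_mem _ _ (one_mem_filtration k L n)
    · exact Submodule.zero_mem _

/-- The central element `t` of the Rees ring. -/
def t : rees k L :=
  ⟨Polynomial.X, fun n => by
    rw [Polynomial.coeff_X]
    split_ifs
    · exact one_mem_filtration k L n
    · exact Submodule.zero_mem _⟩

theorem t_central (p : rees k L) : t k L * p = p * t k L :=
  Subtype.ext Polynomial.X_mul

theorem commute_of_mem_filtration_zero {a : U} (ha : a ∈ filtration k L 0) (b : U) :
    a * b = b * a := by
  rw [filtration, pow_zero, Submodule.mem_one] at ha
  obtain ⟨r, rfl⟩ := ha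
  exact Algebra.commutes r b

theorem commutator_mem_filtration_one {a b : U} (ha : a ∈ filtrationOne k L)
    (hb : b ∈ filtrationOne k L) : a * b - b * a ∈ filtrationOne k L := by
  obtain ⟨c, hc, _, ⟨x, rfl⟩, rfl⟩ := Submodule.mem_sup.1 ha
  obtain ⟨d, hd, _, ⟨y, rfl⟩, rfl⟩ := Submodule.mem_sup.1 hb
  obtain ⟨c, rfl⟩ := Submodule.mem_one.1 hc
  obtain ⟨d, rfl⟩ := Submodule.mem_one.1 hd
  have h := ι_mem_filtrationOne k L ⁅x, y⁆
  rw [LieHom.map_lie, LieRing.of_associative_ring_bracket] at h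
  have e : ∀ X Y : U, (algebraMap k (U) c + X) * (algebraMap k (U) d + Y) -
      (algebraMap k (U) d + Y) * (algebraMap k (U) c + X) = X * Y - Y * X := by
    intro X Y
    rw [add_mul, Algebra.commutes c, mul_add X, ← Algebra.commutes d X, mul_add _ _ X, add_mul _ Y X]
    abel
  rw [← e] at h
  exact h

theorem commutator_mem_filtration_aux {a : U} (ha : a ∈ filtrationOne k L) (n : ℕ) :
    ∀ b ∈ filtration k L n, a * b - b * a ∈ filtration k L n := by
  induction n with
  | zero =>
    intro b hb
    rw [commute_of_mem_filtration_zero k L hb, sub_self]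
    exact Submodule.zero_mem _
  | succ n ih =>
    intro b hb
    rw [filtration, pow_succ] at hb ⊢
    induction hb using Submodule.mul_induction_on' with
    | mem_mul_mem b₁ h₁ b₂ h₂ =>
      have e : a * (b₁ * b₂) - b₁ * b₂ * a = (a * b₁ - b₁ * a) * b₂ + b₁ * (a * b₂ - b₂ * a) := by
        noncomm_ring
      rw [e]
      exact Submodule.add_mem _ (Submodule.mul_mem_mul (ih _ h₁) h₂)
        (Submodule.mul_mem_mul h₁ (commutator_mem_filtration_one k L ha h₂))
    | add b₁ _ b₂ _ h₁ h₂ =>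
      have e : a * (b₁ + b₂) - (b₁ + b₂) * a = (a * b₁ - b₁ * a) + (a * b₂ - b₂ * a) := by
        noncomm_ring
      rw [e]
      exact Submodule.add_mem _ h₁ h₂

theorem commutator_mem_filtration (m n : ℕ) {b : U} (hb : b ∈ filtration k L (n + 1)) :
    ∀ a ∈ filtration k L m, a * b - b * a ∈ filtration k L (m + n) := by
  induction m with
  | zero =>
    intro a ha
    rw [commute_of_mem_filtration_zero k L ha, sub_self]
    exact Submodule.zero_mem _
  | succ m ih =>
    intro a ha
    rw [filtration, pow_succ] at ha
    induction ha using Submodule.mul_induction_on' with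
    | mem_mul_mem a₁ h₁ a₂ h₂ =>
      have e : a₁ * a₂ * b - b * (a₁ * a₂) = a₁ * (a₂ * b - b * a₂) + (a₁ * b - b * a₁) * a₂ := by
        noncomm_ring
      rw [e]
      refine Submodule.add_mem _ ?_ ?_
      · have := mul_mem_filtration k L h₁ (commutator_mem_filtration_aux k L h₂ (n + 1) b hb)
        rwa [show m + (n + 1) = m + 1 + n by omega] at this
      · have h₂' : a₂ ∈ filtration k L 1 := by rwa [filtration, pow_one]
        have := mul_mem_filtration k L (ih _ h₁) h₂'
        rwa [show m + n + 1 = m + 1 + n by omega] at this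
    | add a₁ _ a₂ _ h₁ h₂ =>
      have e : (a₁ + a₂) * b - b * (a₁ + a₂) = (a₁ * b - b * a₁) + (a₂ * b - b * a₂) := by
        noncomm_ring
      rw [e]
      exact Submodule.add_mem _ h₁ h₂

theorem rees_commutator (p q : rees k L) : ∃ r : rees k L, p * q - q * p = t k L * r := by
  obtain ⟨p, hp⟩ := p
  obtain ⟨q, hq⟩ := q
  refine ⟨⟨(p * q - q * p).divX, fun n => ?_⟩, Subtype.ext ?_⟩
  · rw [Polynomial.coeff_divX, Polynomial.coeff_sub, Polynomial.coeff_mul, Polynomial.coeff_mul,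
      ← Finset.Nat.sum_antidiagonal_swap (f := fun x => q.coeff x.1 * p.coeff x.2),
      ← Finset.sum_sub_distrib]
    refine Submodule.sum_mem _ fun x hx => ?_
    have hx' := Finset.HasAntidiagonal.mem_antidiagonal.1 hx
    obtain ⟨i, j⟩ := x
    dsimp only [Prod.swap] at hx' ⊢
    cases j with
    | zero =>
      rw [commute_of_mem_filtration_zero k L (hq 0), sub_self]
      exact Submodule.zero_mem _
    | succ j =>
      have := commutator_mem_filtration k L i j (hq (j + 1)) _ (hp i)
      rwa [show i + j = n by omega] at this
  · change p * q - q * p = Polynomial.X * (p * q - q * p).divX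
    have h := Polynomial.divX_mul_X_add (p * q - q * p)
    rw [Polynomial.coeff_sub, Polynomial.mul_coeff_zero, Polynomial.mul_coeff_zero,
      commute_of_mem_filtration_zero k L (hp 0), sub_self, Polynomial.C_0, add_zero] at h
    rw [Polynomial.X_mul, h]

/-! ### The inverse limit of the localizations of the truncated Rees rings -/

/-- The ideal of the Rees ring generated by `tⁿ`. -/
def tIdeal (n : ℕ) : Ideal (rees k L) := Ideal.span {t k L ^ n}

instance (n : ℕ) : (tIdeal k L n).IsTwoSided where
  mul_mem_of_left := by
    intro a b ha
    rw [tIdeal, Ideal.mem_span_singleton'] at ha ⊢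
    obtain ⟨c, rfl⟩ := ha
    refine ⟨c * b, ?_⟩
    rw [mul_assoc, mul_assoc, ((show Commute (t k L) b from t_central k L b).pow_left n).eq]

/-- The quotient of the Rees ring by `tⁿ`. For `n = 1` this is the associated graded ring. -/
def Trunc (n : ℕ) : Type _ := rees k L ⧸ tIdeal k L n

instance (n : ℕ) : Ring (Trunc k L n) := inferInstanceAs (Ring (rees k L ⧸ tIdeal k L n))

instance (n : ℕ) : Algebra k (Trunc k L n) :=
  inferInstanceAs (Algebra k (rees k L ⧸ tIdeal k L n))

/-- The quotient map. -/
def toTrunc (n : ℕ) : rees k L →ₐ[k] Trunc k L n := Ideal.Quotient.mkₐ k (tIdeal k L n)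

theorem toTrunc_surjective (n : ℕ) : Function.Surjective (toTrunc k L n) :=
  Ideal.Quotient.mk_surjective

theorem toTrunc_t_pow (n : ℕ) : toTrunc k L n (t k L) ^ n = 0 := by
  rw [← map_pow]
  exact Ideal.Quotient.eq_zero_iff_mem.2 (Ideal.mem_span_singleton_self _)

/-- The multiplicative set of the elements of the Rees ring outside of the ideal `(t)`, that is,
of those with nonzero image in the associated graded ring. (The associated graded ring is a
polynomial ring over `k`, hence a domain, so that the elements outside `(t)` are multiplicatively
closed already.) -/
def denominators : Submonoid (rees k L) :=
  Submonoid.closure {p | p ∉ tIdeal k L 1}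

/-- The image of the multiplicative set in the quotient by `tⁿ`. -/
def truncDenominators (n : ℕ) : Submonoid (Trunc k L n) :=
  (denominators k L).map (toTrunc k L n)

theorem nonempty_oreSet_truncDenominators (n : ℕ) :
    Nonempty (OreLocalization.OreSet (truncDenominators k L n)) := by
  refine nonempty_oreSet_of_nilpotent _ (toTrunc k L n (t k L)) n ?_ (toTrunc_t_pow k L n) ?_
  · intro a
    obtain ⟨a, rfl⟩ := toTrunc_surjective k L n a
    rw [← map_mul, ← map_mul, t_central]
  · intro a b
    obtain ⟨a, rfl⟩ := toTrunc_surjective k L n a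
    obtain ⟨b, rfl⟩ := toTrunc_surjective k L n b
    obtain ⟨r, hr⟩ := rees_commutator k L a b
    exact ⟨toTrunc k L n r, by rw [← map_mul, ← map_mul, ← map_mul, ← map_sub, hr]⟩

instance (n : ℕ) : OreLocalization.OreSet (truncDenominators k L n) :=
  (nonempty_oreSet_truncDenominators k L n).some

/-- The Ore localization of the quotient of the Rees ring by `tⁿ`. -/
def LocTrunc (n : ℕ) : Type _ := OreLocalization (truncDenominators k L n) (Trunc k L n)

instance (n : ℕ) : Ring (LocTrunc k L n) :=
  inferInstanceAs (Ring (OreLocalization (truncDenominators k L n) (Trunc k L n)))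

instance (n : ℕ) : Algebra k (LocTrunc k L n) :=
  inferInstanceAs (Algebra k (OreLocalization (truncDenominators k L n) (Trunc k L n)))

/-- The canonical map to the localization. -/
def toLoc (n : ℕ) : Trunc k L n →ₐ[k] LocTrunc k L n where
  __ := (OreLocalization.numeratorRingHom :
    Trunc k L n →+* OreLocalization (truncDenominators k L n) (Trunc k L n))
  commutes' _ := rfl

theorem tIdeal_succ_le (n : ℕ) : tIdeal k L (n + 1) ≤ tIdeal k L n := by
  rw [tIdeal, Ideal.span_singleton_le_iff_mem, pow_succ']
  exact Ideal.mul_mem_left _ _ (Ideal.mem_span_singleton_self _)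

/-- The canonical map from the quotient by `tⁿ⁺¹` to the quotient by `tⁿ`. -/
def truncMap (n : ℕ) : Trunc k L (n + 1) →ₐ[k] Trunc k L n :=
  Ideal.Quotient.factorₐ k (tIdeal_succ_le k L n)

theorem truncMap_toTrunc (n : ℕ) (p : rees k L) :
    truncMap k L n (toTrunc k L (n + 1) p) = toTrunc k L n p := rfl

theorem isUnit_toLoc (n : ℕ) (s : truncDenominators k L n) : IsUnit (toLoc k L n s) :=
  OreLocalization.numerator_isUnit s

theorem isUnit_toLoc_truncMap (n : ℕ) (s : truncDenominators k L (n + 1)) :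
    IsUnit (((toLoc k L n).comp (truncMap k L n) : Trunc k L (n + 1) →* LocTrunc k L n) s) := by
  obtain ⟨_, p, hp, rfl⟩ := s
  exact isUnit_toLoc k L n ⟨toTrunc k L n p, p, hp, rfl⟩

/-- The transition map between the localized quotients. -/
def transition (n : ℕ) : LocTrunc k L (n + 1) →+* LocTrunc k L n :=
  OreLocalization.universalHom ((toLoc k L n).comp (truncMap k L n)).toRingHom
    (IsUnit.liftRight (((toLoc k L n).comp (truncMap k L n) :
        Trunc k L (n + 1) →* LocTrunc k L n).comp (truncDenominators k L (n + 1)).subtype)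
      (isUnit_toLoc_truncMap k L n))
    (fun _ => rfl)

theorem transition_toLoc (n : ℕ) (a : Trunc k L (n + 1)) :
    transition k L n (toLoc k L (n + 1) a) = toLoc k L n (truncMap k L n a) :=
  OreLocalization.universalHom_commutes _ _ _

/-- The inverse limit of the localized quotients of the Rees ring, as a subalgebra of their
product. -/
def completion : Subalgebra k (∀ n, LocTrunc k L n) where
  carrier := {x | ∀ n, transition k L n (x (n + 1)) = x n}
  mul_mem' := by
    intro x y hx hy n
    rw [Pi.mul_apply, map_mul, hx n, hy n, Pi.mul_apply]
  add_mem' := by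
    intro x y hx hy n
    rw [Pi.add_apply, map_add, hx n, hy n, Pi.add_apply]
  algebraMap_mem' := by
    intro r n
    have h := transition_toLoc k L n (algebraMap k _ r)
    rw [AlgHom.commutes, AlgHom.commutes, AlgHom.commutes] at h
    exact h

/-- The canonical map from the Rees ring to the inverse limit. -/
def toCompletion : rees k L →ₐ[k] completion k L :=
  AlgHom.codRestrict (AlgHom.pi fun n => (toLoc k L n).comp (toTrunc k L n)) (completion k L)
    (fun p n => transition_toLoc k L n (toTrunc k L (n + 1) p))

theorem toLoc_t_central (n : ℕ) (x : LocTrunc k L n) :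
    toLoc k L n (toTrunc k L n (t k L)) * x = x * toLoc k L n (toTrunc k L n (t k L)) := by
  have hc : ∀ a : Trunc k L n, Commute (toLoc k L n (toTrunc k L n (t k L))) (toLoc k L n a) := by
    intro a
    obtain ⟨a, rfl⟩ := toTrunc_surjective k L n a
    change _ * _ = _ * _
    rw [← map_mul, ← map_mul, ← map_mul, ← map_mul, t_central]
  obtain ⟨r, s, hx⟩ : ∃ (r : Trunc k L n) (s : truncDenominators k L n),
      toLoc k L n s * x = toLoc k L n r := by
    induction x using OreLocalization.ind with
    | _ r s => exact ⟨r, s, OreLocalization.mul_cancel⟩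
  obtain ⟨u, hu⟩ := isUnit_toLoc k L n s
  rw [← hu] at hx
  have hx' : x = ↑u⁻¹ * toLoc k L n r := by rw [← hx, Units.inv_mul_cancel_left]
  have h1 : Commute (toLoc k L n (toTrunc k L n (t k L))) (↑u⁻¹ : LocTrunc k L n) :=
    Commute.units_inv_right (by rw [hu]; exact hc _)
  rw [hx']
  exact (h1.mul_right (hc r)).eq

theorem toCompletion_t_central (x : completion k L) :
    toCompletion k L (t k L) * x = x * toCompletion k L (t k L) :=
  Subtype.ext (funext fun n => toLoc_t_central k L n (x.1 n))

/-! ### Cohn's division ring and the division subring generated by the enveloping algebra -/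

/-- The powers of `t` in the inverse limit. -/
def tPowers : Submonoid (completion k L) := Submonoid.powers (toCompletion k L (t k L))

theorem nonempty_oreSet_tPowers : Nonempty (OreLocalization.OreSet (tPowers k L)) := by
  refine nonempty_oreSet_of_central _ ?_
  rintro _ ⟨n, rfl⟩ a
  exact ((show Commute _ a from toCompletion_t_central k L a).pow_left n).eq

instance : OreLocalization.OreSet (tPowers k L) := (nonempty_oreSet_tPowers k L).some

/-- Cohn's division ring `𝔇_L`: the localization at `t` of the inverse limit over `n` of the Ore
localizations of the quotients of the Rees ring by `tⁿ`, at the elements outside `(t)`. -/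
def DivRing : Type _ := OreLocalization (tPowers k L) (completion k L)

instance : Ring (DivRing k L) :=
  inferInstanceAs (Ring (OreLocalization (tPowers k L) (completion k L)))

instance : Algebra k (DivRing k L) :=
  inferInstanceAs (Algebra k (OreLocalization (tPowers k L) (completion k L)))

/-- The canonical map from the inverse limit to `DivRing`. -/
def completionToDivRing : completion k L →ₐ[k] DivRing k L where
  __ := (OreLocalization.numeratorRingHom :
    completion k L →+* OreLocalization (tPowers k L) (completion k L))
  commutes' _ := rfl

/-- The canonical map from the Rees ring to `DivRing`. -/
def reesToDivRing : rees k L →ₐ[k] DivRing k L :=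
  (completionToDivRing k L).comp (toCompletion k L)

/-- The inverse of `t` in `DivRing`. -/
def tInv : DivRing k L :=
  ((OreLocalization.numeratorUnit
    (⟨toCompletion k L (t k L), Submonoid.mem_powers _⟩ : tPowers k L))⁻¹ :
      (OreLocalization (tPowers k L) (completion k L))ˣ).val

theorem tInv_mul : tInv k L * reesToDivRing k L (t k L) = 1 :=
  Units.inv_mul (OreLocalization.numeratorUnit
    (⟨toCompletion k L (t k L), Submonoid.mem_powers _⟩ : tPowers k L))

theorem mul_tInv : reesToDivRing k L (t k L) * tInv k L = 1 :=
  Units.mul_inv (OreLocalization.numeratorUnit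
    (⟨toCompletion k L (t k L), Submonoid.mem_powers _⟩ : tPowers k L))

/-- The element `x t` of the Rees ring, for `x` in the Lie algebra. -/
def symbol : L →ₗ[k] rees k L where
  toFun x := ⟨Polynomial.monomial 1 (UniversalEnvelopingAlgebra.ι k x), fun n => by
    rw [Polynomial.coeff_monomial]
    split_ifs with h
    · subst h
      rw [filtration, pow_one]
      exact ι_mem_filtrationOne k L x
    · exact Submodule.zero_mem _⟩
  map_add' x y := Subtype.ext (by
    change Polynomial.monomial 1 _ = Polynomial.monomial 1 _ + Polynomial.monomial 1 _
    rw [map_add, map_add])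
  map_smul' r x := Subtype.ext (by
    change Polynomial.monomial 1 _ = r • Polynomial.monomial 1 _
    rw [map_smul, Polynomial.smul_monomial])

theorem symbol_lie (x y : L) :
    symbol k L x * symbol k L y - symbol k L y * symbol k L x = t k L * symbol k L ⁅x, y⁆ := by
  refine Subtype.ext ?_
  change Polynomial.monomial 1 _ * Polynomial.monomial 1 _ -
    Polynomial.monomial 1 _ * Polynomial.monomial 1 _ = Polynomial.X * Polynomial.monomial 1 _
  rw [Polynomial.X_mul, Polynomial.monomial_mul_X, Polynomial.monomial_mul_monomial,
    Polynomial.monomial_mul_monomial, ← map_sub, LieHom.map_lie,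
    LieRing.of_associative_ring_bracket]

/-- The map from the Lie algebra to `DivRing` that sends `x` to the fraction `t⁻¹ (x t)`. -/
def lieMap : L →ₗ⁅k⁆ DivRing k L where
  toLinearMap := (LinearMap.mulLeft k (tInv k L)).comp
    ((reesToDivRing k L).toLinearMap.comp (symbol k L))
  map_lie' := by
    intro x y
    change tInv k L * reesToDivRing k L (symbol k L ⁅x, y⁆) =
      tInv k L * reesToDivRing k L (symbol k L x) * (tInv k L * reesToDivRing k L (symbol k L y)) -
      tInv k L * reesToDivRing k L (symbol k L y) * (tInv k L * reesToDivRing k L (symbol k L x))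
    have h := congrArg (reesToDivRing k L) (symbol_lie k L x y)
    rw [map_sub, map_mul, map_mul, map_mul] at h
    have hc : ∀ p : rees k L,
        reesToDivRing k L p * tInv k L = tInv k L * reesToDivRing k L p := by
      intro p
      have hp := congrArg (reesToDivRing k L) (t_central k L p)
      rw [map_mul, map_mul] at hp
      calc reesToDivRing k L p * tInv k L
          = tInv k L * (reesToDivRing k L (t k L) * reesToDivRing k L p) * tInv k L := by
            rw [← mul_assoc, tInv_mul, one_mul]
        _ = tInv k L * reesToDivRing k L p * (reesToDivRing k L (t k L) * tInv k L) := by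
            rw [hp]; simp only [mul_assoc]
        _ = _ := by rw [mul_tInv, mul_one]
    have e : ∀ p q : rees k L,
        tInv k L * reesToDivRing k L p * (tInv k L * reesToDivRing k L q) =
          tInv k L * (tInv k L * (reesToDivRing k L p * reesToDivRing k L q)) := by
      intro p q
      rw [mul_assoc (tInv k L), ← mul_assoc (reesToDivRing k L p), hc, mul_assoc (tInv k L)]
    rw [e, e, ← mul_sub, ← mul_sub, h, ← mul_assoc (tInv k L) (reesToDivRing k L (t k L)),
      tInv_mul, one_mul]

/-- The embedding of the enveloping algebra in Cohn's division ring. It extends the map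
`x ↦ t⁻¹ (x t)` on the Lie algebra. -/
def embedding : UniversalEnvelopingAlgebra k L →ₐ[k] DivRing k L :=
  UniversalEnvelopingAlgebra.lift k (lieMap k L)

/-- The division ring `𝔇(L)`: the division subring of Cohn's division ring `𝔇_L` that is generated
by the enveloping algebra. -/
def divSubring : Subalgebra k (DivRing k L) :=
  divisionClosure k (Set.range (embedding k L))

end

end Cohn

/-! The free group algebra comes from a pair `s`, `P` with `s P - P s = P`, where `P` and all
nonzero polynomials in `s` are units. Such a pair makes the ring a left vector space over `K =
k(s)`, and `P` passes scalars by the shift `σ : s ↦ s - 1`. With `u = s / (s - 1/2)` and the Cayley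
transform `η = (1 + P)⁻¹ (1 - P)`, the elements `u` and `η u η⁻¹` generate a copy of `k[F₂]`
(`Shift.lift_evalHom_injective_of_commutator`).

The reason is as follows. Words in these elements reduce to powers of `u` times alternating products
`η u^n₁ η⁻¹ u^n₂ ⋯`. By `(1 + P) η = 1 - P`, left multiplication by `P` maps such a product to `±`
itself modulo shorter products. So a shortest relation over `K` has constant coefficients and a
fixed first letter, because `σ f = f` forces `f` to be constant and `σ f = -f` forces `f = 0`.
Clearing the first Cayley factor then writes a Laurent polynomial in `X / (X - 1/2)` without
constant term as `g + σ g`. A function `g + σ g` never has exactly one pole in a `σ`-orbit, while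
here the only possible poles, `0` and `1/2`, lie in different orbits. Hence there are no poles and
all coefficients vanish.

It is enough to have the pair in a quotient of a subring (`Cohn.exists_injective_of_commutator`).
Let `z = ⁅y, x⁆ ≠ 0`. If `x, y, z` are dependent, then `L` contains elements with `⁅s, P⁆ = P`. If
they are independent, give `x, y` weight 1 and the other elements of a basis weight 2. Then `a = y x
/ 2`, `p = x²` and `z` all have weight 2, and up to smaller weight `z` commutes with `a` and `p`,
and `a p - p a = p z`. So `s = a z⁻¹` and `P = p z⁻¹` form a pair among the elements of weight at
most 0 modulo those of negative weight.

For weights to make sense in Cohn's division ring, the Poincaré–Birkhoff–Witt theorem is proved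
through an action of `L` on a polynomial ring that respects both degree and weight. Fractions are
weighted through denominators whose symbol has the full weight of the denominator. The quotient is
nonzero because `1` does not get negative weight (`Cohn.not_wtDiv_one`). -/

noncomputable section

open MvPolynomial

namespace PBW

/-! ### Polynomials filtered by degree and by weight. -/

section Filtrations

variable {ι k : Type*} [CommRing k]

/-- Polynomials of degree at most `d`. -/
def degLE (ι k : Type*) [CommRing k] (d : ℕ) : Submodule k (MvPolynomial ι k) :=
  restrictSupport k {m | m.degree ≤ d}

/-- Polynomials of weight at most `p`, for integral weights of the variables. -/
def wtLE (k : Type*) [CommRing k] (w : ι → ℤ) (p : ℤ) : Submodule k (MvPolynomial ι k) :=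
  restrictSupport k {m | Finsupp.weight w m ≤ p}

theorem mem_degLE {d : ℕ} {f : MvPolynomial ι k} :
    f ∈ degLE ι k d ↔ ∀ m, coeff m f ≠ 0 → m.degree ≤ d := by
  rw [degLE, mem_restrictSupport_iff]
  constructor
  · intro h m hm
    exact h (by simpa [MvPolynomial.mem_support_iff] using hm)
  · intro h m hm
    exact h m (by simpa [MvPolynomial.mem_support_iff] using hm)

theorem mem_wtLE {w : ι → ℤ} {p : ℤ} {f : MvPolynomial ι k} :
    f ∈ wtLE k w p ↔ ∀ m, coeff m f ≠ 0 → Finsupp.weight w m ≤ p := by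
  rw [wtLE, mem_restrictSupport_iff]
  constructor
  · intro h m hm
    exact h (by simpa [MvPolynomial.mem_support_iff] using hm)
  · intro h m hm
    exact h m (by simpa [MvPolynomial.mem_support_iff] using hm)

theorem monomial_mem_degLE (m : ι →₀ ℕ) (r : k) : monomial m r ∈ degLE ι k m.degree :=
  (monomial_mem_restrictSupport k).2 (Or.inl (by simp))

theorem monomial_mem_wtLE (w : ι → ℤ) (m : ι →₀ ℕ) (r : k) :
    monomial m r ∈ wtLE k w (Finsupp.weight w m) :=
  (monomial_mem_restrictSupport k).2 (Or.inl (by simp))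

theorem degLE_mono {d e : ℕ} (h : d ≤ e) : degLE ι k d ≤ degLE ι k e :=
  restrictSupport_mono k fun _ hm => le_trans hm h

theorem wtLE_mono (w : ι → ℤ) {d e : ℤ} (h : d ≤ e) : wtLE k w d ≤ wtLE k w e :=
  restrictSupport_mono k fun _ hm => le_trans hm h

theorem degLE_le_of_monomial {d : ℕ} {N : Submodule k (MvPolynomial ι k)}
    (h : ∀ m : ι →₀ ℕ, m.degree ≤ d → monomial m 1 ∈ N) : degLE ι k d ≤ N := by
  rw [degLE, restrictSupport_eq_span, Submodule.span_le]
  rintro _ ⟨m, hm, rfl⟩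
  exact h m hm

theorem wtLE_le_of_monomial {w : ι → ℤ} {d : ℤ} {N : Submodule k (MvPolynomial ι k)}
    (h : ∀ m : ι →₀ ℕ, Finsupp.weight w m ≤ d → monomial m 1 ∈ N) : wtLE k w d ≤ N := by
  rw [wtLE, restrictSupport_eq_span, Submodule.span_le]
  rintro _ ⟨m, hm, rfl⟩
  exact h m hm

theorem mul_mem_wtLE {w : ι → ℤ} {p q : ℤ} {f g : MvPolynomial ι k} (hf : f ∈ wtLE k w p)
    (hg : g ∈ wtLE k w q) : f * g ∈ wtLE k w (p + q) := by
  have h := Submodule.mul_mem_mul hf hg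
  rw [wtLE, wtLE, ← restrictSupport_add] at h
  refine restrictSupport_mono k ?_ h
  rintro _ ⟨a, ha, b, hb, rfl⟩
  simp only [Set.mem_ofPred_eq, map_add] at *
  omega

theorem mul_mem_degLE {p q : ℕ} {f g : MvPolynomial ι k} (hf : f ∈ degLE ι k p)
    (hg : g ∈ degLE ι k q) : f * g ∈ degLE ι k (p + q) := by
  have h := Submodule.mul_mem_mul hf hg
  rw [degLE, degLE, ← restrictSupport_add] at h
  refine restrictSupport_mono k ?_ h
  rintro _ ⟨a, ha, b, hb, rfl⟩
  simp only [Set.mem_ofPred_eq, map_add] at *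
  omega

theorem X_mem_degLE (i : ι) : (X i : MvPolynomial ι k) ∈ degLE ι k 1 := by
  have h := monomial_mem_degLE (k := k) (Finsupp.single i 1) 1
  rwa [Finsupp.degree_single] at h

theorem X_mem_wtLE (w : ι → ℤ) (i : ι) : (X i : MvPolynomial ι k) ∈ wtLE k w (w i) := by
  have h := monomial_mem_wtLE (k := k) w (Finsupp.single i 1) 1
  rwa [Finsupp.weight_single, one_smul] at h

theorem X_mul_mem_degLE (i : ι) {d : ℕ} {f : MvPolynomial ι k} (hf : f ∈ degLE ι k d) :
    X i * f ∈ degLE ι k (d + 1) := by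
  rw [add_comm]; exact mul_mem_degLE (X_mem_degLE i) hf

end Filtrations

/-! ### Construction of the action of a Lie algebra on polynomials in a basis. -/

section Extension

variable {ι k L : Type*} [CommRing k] [LieRing L] [LieAlgebra k L] (b : Module.Basis ι k L)

theorem degree_add_single (m : ι →₀ ℕ) (j : ι) :
    (m + Finsupp.single j 1).degree = m.degree + 1 := by simp

theorem sub_X_mul_mem {A : L →ₗ[k] MvPolynomial ι k →ₗ[k] MvPolynomial ι k} {d : ℕ}
    (h : ∀ (m : ι →₀ ℕ) (i : ι), m.degree ≤ d →
      A (b i) (monomial m 1) - X i * monomial m 1 ∈ degLE ι k m.degree)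
    (i : ι) {f : MvPolynomial ι k} (hf : f ∈ degLE ι k d) :
    A (b i) f - X i * f ∈ degLE ι k d := by
  have : degLE ι k d ≤ (degLE ι k d).comap (A (b i) - LinearMap.mulLeft k (X i)) := by
    refine degLE_le_of_monomial fun m hm => ?_
    exact degLE_mono hm (h m i hm)
  exact this hf

theorem apply_mem {A : L →ₗ[k] MvPolynomial ι k →ₗ[k] MvPolynomial ι k} {d : ℕ}
    (h : ∀ (m : ι →₀ ℕ) (i : ι), m.degree ≤ d →
      A (b i) (monomial m 1) - X i * monomial m 1 ∈ degLE ι k m.degree)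
    (l : L) {f : MvPolynomial ι k} (hf : f ∈ degLE ι k d) : A l f ∈ degLE ι k (d + 1) := by
  induction b.mem_span l using Submodule.span_induction with
  | zero => rw [map_zero]; exact Submodule.zero_mem _
  | add x y _ _ hx hy => rw [map_add]; exact Submodule.add_mem _ hx hy
  | smul c x _ hx => rw [map_smul]; exact Submodule.smul_mem _ _ hx
  | mem x hx =>
    obtain ⟨i, rfl⟩ := hx
    have h1 := degLE_mono (Nat.le_succ d) (sub_X_mul_mem b h i hf)
    have h2 := Submodule.add_mem _ h1 (X_mul_mem_degLE i hf)
    rwa [sub_add_cancel] at h2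

theorem eq_of_eq_monomial {A A' : L →ₗ[k] MvPolynomial ι k →ₗ[k] MvPolynomial ι k} {d : ℕ}
    (h : ∀ (m : ι →₀ ℕ) (i : ι), m.degree ≤ d → A (b i) (monomial m 1) = A' (b i) (monomial m 1))
    (l : L) {f : MvPolynomial ι k} (hf : f ∈ degLE ι k d) : A l f = A' l f := by
  induction b.mem_span l using Submodule.span_induction with
  | zero => simp
  | add x y _ _ hx hy => simp [hx, hy]
  | smul c x _ hx => simp [hx]
  | mem x hx =>
    obtain ⟨i, rfl⟩ := hx
    have : degLE ι k d ≤ LinearMap.eqLocus (A (b i)) (A' (b i)) :=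
      degLE_le_of_monomial fun m hm => h m i hm
    exact this hf

end Extension

variable {ι k L : Type*} [LinearOrder ι] [CommRing k] [LieRing L] [LieAlgebra k L]
  (b : Module.Basis ι k L)

/-- The value of the action of a basis element on a monomial, in terms of the action on monomials
of smaller degree. -/
def value (A : L →ₗ[k] MvPolynomial ι k →ₗ[k] MvPolynomial ι k) (i : ι) (m : ι →₀ ℕ) :
    MvPolynomial ι k :=
  if h : ∃ j ∈ m.support, j < i ∧ ∀ l ∈ m.support, j ≤ l then
    let j := h.choose
    let T := monomial (m - Finsupp.single j 1) (1 : k)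
    -- With `m = X_j T` and `j` minimal, this is the forced value of `b_i b_j T = b_j b_i T + ⁅b_i,
    -- b_j⁆ T`: the leading part `X_i T` of `b_i T` is sent by `b_j` to `X_j X_i T = X_i m`, and
    -- only the remainder needs `A`.
    X i * monomial m 1 + A (b j) (A (b i) T - X i * T) + A ⁅b i, b j⁆ T
  else X i * monomial m 1

theorem value_of_le (A : L →ₗ[k] MvPolynomial ι k →ₗ[k] MvPolynomial ι k) (i : ι) (m : ι →₀ ℕ)
    (h : ∀ j ∈ m.support, i ≤ j) : value b A i m = X i * monomial m 1 := by
  rw [value, dif_neg]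
  rintro ⟨j, hj, hji, -⟩
  exact absurd (h j hj) (not_le.2 hji)

theorem value_of_lt (A : L →ₗ[k] MvPolynomial ι k →ₗ[k] MvPolynomial ι k) (i j : ι) (m : ι →₀ ℕ)
    (hji : j < i) (h : ∀ l ∈ m.support, j ≤ l) :
    value b A i (m + Finsupp.single j 1) = X i * monomial (m + Finsupp.single j 1) 1 +
      A (b j) (A (b i) (monomial m 1) - X i * monomial m 1) + A ⁅b i, b j⁆ (monomial m 1) := by
  have hj : j ∈ (m + Finsupp.single j 1).support := by simp
  have hmin : ∀ l ∈ (m + Finsupp.single j 1).support, j ≤ l := by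
    intro l hl
    by_cases hlj : l = j
    · exact hlj.ge
    · apply h
      rw [Finsupp.mem_support_iff] at hl ⊢
      simpa [Finsupp.single_apply, Ne.symm hlj] using hl
  have h' : ∃ j' ∈ (m + Finsupp.single j 1).support, j' < i ∧
      ∀ l ∈ (m + Finsupp.single j 1).support, j' ≤ l := ⟨j, hj, hji, hmin⟩
  have e : h'.choose = j :=
    le_antisymm (h'.choose_spec.2.2 j hj) (hmin _ h'.choose_spec.1)
  rw [value, dif_pos h']
  simp only [e, add_tsub_cancel_right]

theorem exists_eq_add_single {m : ι →₀ ℕ} {i : ι} (h : ¬ ∀ j ∈ m.support, i ≤ j) :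
    ∃ (j : ι) (T : ι →₀ ℕ), m = T + Finsupp.single j 1 ∧ j < i ∧ ∀ l ∈ T.support, j ≤ l := by
  push Not at h
  obtain ⟨j, hj, hji⟩ := h
  have hm := m.support.min'_mem ⟨j, hj⟩
  refine ⟨m.support.min' ⟨j, hj⟩, m - Finsupp.single (m.support.min' ⟨j, hj⟩) 1, ?_,
    (Finset.min'_le _ _ hj).trans_lt hji, fun l hl => Finset.min'_le _ _ ?_⟩
  · rw [tsub_add_cancel_of_le]
    rw [Finsupp.single_le_iff]
    exact Nat.one_le_iff_ne_zero.2 (Finsupp.mem_support_iff.1 hm)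
  · rw [Finsupp.mem_support_iff] at hl ⊢
    intro h0
    simp [h0] at hl

/-- The linear extension of `value`. -/
def step (A : L →ₗ[k] MvPolynomial ι k →ₗ[k] MvPolynomial ι k) :
    L →ₗ[k] MvPolynomial ι k →ₗ[k] MvPolynomial ι k :=
  b.constr k fun i => (basisMonomials ι k).constr k fun m => value b A i m

theorem step_apply (A : L →ₗ[k] MvPolynomial ι k →ₗ[k] MvPolynomial ι k) (i : ι) (m : ι →₀ ℕ) :
    step b A (b i) (monomial m 1) = value b A i m := by
  rw [step, Module.Basis.constr_basis]
  have := (basisMonomials ι k).constr_basis k (fun m => value b A i m) m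
  rwa [coe_basisMonomials] at this

/-- The iterates of `step`; the `n`-th one is correct in degrees less than `n`. -/
def iter (n : ℕ) : L →ₗ[k] MvPolynomial ι k →ₗ[k] MvPolynomial ι k := (step b)^[n] 0

theorem iter_succ_apply (n : ℕ) (i : ι) (m : ι →₀ ℕ) :
    iter b (n + 1) (b i) (monomial m 1) = value b (iter b n) i m := by
  rw [iter, Function.iterate_succ_apply', step_apply]; rfl

/-- The action of the Lie algebra on the polynomial ring. -/
def act : L →ₗ[k] MvPolynomial ι k →ₗ[k] MvPolynomial ι k :=
  b.constr k fun i => (basisMonomials ι k).constr k fun m =>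
    iter b (m.degree + 1) (b i) (monomial m 1)

theorem act_apply (i : ι) (m : ι →₀ ℕ) :
    act b (b i) (monomial m 1) = iter b (m.degree + 1) (b i) (monomial m 1) := by
  rw [act, Module.Basis.constr_basis]
  have := (basisMonomials ι k).constr_basis k
    (fun m => iter b (m.degree + 1) (b i) (monomial m 1)) m
  rwa [coe_basisMonomials] at this

/-- The degree bound and stability are proved together: the bound guarantees that `value` consults
the previous stage only in degrees where that stage has already stabilized. -/
theorem iter_spec (n : ℕ) : ∀ (m : ι →₀ ℕ) (i : ι), m.degree < n →
    iter b n (b i) (monomial m 1) - X i * monomial m 1 ∈ degLE ι k m.degree ∧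
      iter b (n + 1) (b i) (monomial m 1) = iter b n (b i) (monomial m 1) := by
  induction n with
  | zero => intro m i h; omega
  | succ n ih =>
    intro m i hm
    rw [iter_succ_apply, iter_succ_apply]
    by_cases h : ∀ j ∈ m.support, i ≤ j
    · rw [value_of_le b _ i m h, value_of_le b _ i m h, sub_self]
      exact ⟨Submodule.zero_mem _, rfl⟩
    · obtain ⟨j, T, rfl, hji, hT⟩ := exists_eq_add_single h
      rw [degree_add_single] at hm
      have ih1 : ∀ (m : ι →₀ ℕ) (i : ι), m.degree ≤ T.degree →
          iter b n (b i) (monomial m 1) - X i * monomial m 1 ∈ degLE ι k m.degree :=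
        fun m i h => (ih m i (by omega)).1
      have ih2 : ∀ (m : ι →₀ ℕ) (i : ι), m.degree ≤ T.degree →
          iter b (n + 1) (b i) (monomial m 1) = iter b n (b i) (monomial m 1) :=
        fun m i h => (ih m i (by omega)).2
      have hT' := monomial_mem_degLE (k := k) T 1
      rw [value_of_lt b _ i j T hji hT, value_of_lt b _ i j T hji hT, degree_add_single]
      constructor
      · rw [add_assoc, add_sub_cancel_left]
        exact Submodule.add_mem _ (apply_mem b ih1 _ (sub_X_mul_mem b ih1 i hT'))
          (apply_mem b ih1 _ hT')
      · rw [eq_of_eq_monomial b ih2 (b i) hT', eq_of_eq_monomial b ih2 ⁅b i, b j⁆ hT',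
          eq_of_eq_monomial b ih2 (b j) (sub_X_mul_mem b ih1 i hT')]

theorem iter_stable {n n' : ℕ} (h : n ≤ n') (m : ι →₀ ℕ) (i : ι) (hm : m.degree < n) :
    iter b n' (b i) (monomial m 1) = iter b n (b i) (monomial m 1) := by
  induction n', h using Nat.le_induction with
  | base => rfl
  | succ n' h ih => rw [(iter_spec b n' m i (by omega)).2, ih]

theorem act_sub_X_mul_mem_monomial (m : ι →₀ ℕ) (i : ι) :
    act b (b i) (monomial m 1) - X i * monomial m 1 ∈ degLE ι k m.degree := by
  rw [act_apply]
  exact (iter_spec b _ m i (Nat.lt_succ_self _)).1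

theorem act_sub_X_mul_mem (i : ι) {d : ℕ} {f : MvPolynomial ι k} (hf : f ∈ degLE ι k d) :
    act b (b i) f - X i * f ∈ degLE ι k d :=
  sub_X_mul_mem b (fun m i _ => act_sub_X_mul_mem_monomial b m i) i hf

theorem act_mem (l : L) {d : ℕ} {f : MvPolynomial ι k} (hf : f ∈ degLE ι k d) :
    act b l f ∈ degLE ι k (d + 1) :=
  apply_mem b (fun m i _ => act_sub_X_mul_mem_monomial b m i) l hf

theorem act_of_le (i : ι) (m : ι →₀ ℕ) (h : ∀ j ∈ m.support, i ≤ j) :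
    act b (b i) (monomial m 1) = X i * monomial m 1 := by
  rw [act_apply, iter_succ_apply, value_of_le b _ i m h]

/-- The recursion passes to the limit because `act` is applied only to polynomials of degree at most
that of `m`, where the finite stage already agrees with it. -/
theorem act_of_lt (i j : ι) (m : ι →₀ ℕ) (hji : j < i) (h : ∀ l ∈ m.support, j ≤ l) :
    act b (b i) (monomial (m + Finsupp.single j 1) 1) =
      X i * monomial (m + Finsupp.single j 1) 1 +
      act b (b j) (act b (b i) (monomial m 1) - X i * monomial m 1) +
      act b ⁅b i, b j⁆ (monomial m 1) := by
  have e : ∀ (l : L) (f : MvPolynomial ι k), f ∈ degLE ι k m.degree →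
      iter b (m.degree + 1) l f = act b l f := fun l f hf =>
    eq_of_eq_monomial b (fun m' i' h' => by
      rw [act_apply, iter_stable b (by omega) m' i' (Nat.lt_succ_self _)]) l hf
  have hm := monomial_mem_degLE (k := k) m 1
  rw [act_apply, iter_succ_apply, value_of_lt b _ i j m hji h, degree_add_single,
    e _ _ hm, e _ _ hm, e _ _ (act_sub_X_mul_mem b i hm)]

end PBW

end

noncomputable section

open MvPolynomial

/-! ### The action respects brackets and weights. -/

namespace PBW

variable {ι k L : Type*} [LinearOrder ι] [CommRing k] [LieRing L] [LieAlgebra k L]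
  (b : Module.Basis ι k L)

/-- The failure of `act` to respect the bracket of `x` and `y`. -/
def defect (x y : L) : MvPolynomial ι k →ₗ[k] MvPolynomial ι k :=
  act b x ∘ₗ act b y - act b y ∘ₗ act b x - act b ⁅x, y⁆

theorem defect_apply (x y : L) (f : MvPolynomial ι k) :
    defect b x y f = act b x (act b y f) - act b y (act b x f) - act b ⁅x, y⁆ f := rfl

theorem defect_swap (x y : L) (f : MvPolynomial ι k) : defect b x y f = -defect b y x f := by
  rw [defect_apply, defect_apply, ← lie_skew x y, map_neg, LinearMap.neg_apply]
  abel

theorem defect_self (x : L) (f : MvPolynomial ι k) : defect b x x f = 0 := by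
  rw [defect_apply, lie_self, map_zero, LinearMap.zero_apply]; abel

/-- `defect` as a bilinear map to endomorphisms. -/
def defectₗ (f : MvPolynomial ι k) : L →ₗ[k] L →ₗ[k] MvPolynomial ι k :=
  LinearMap.mk₂ k (fun x y => defect b x y f)
    (fun x x' y => by simp only [defect_apply, map_add, LinearMap.add_apply, add_lie]; abel)
    (fun c x y => by
      simp only [defect_apply, map_smul, LinearMap.smul_apply, smul_lie, smul_sub])
    (fun x y y' => by simp only [defect_apply, map_add, LinearMap.add_apply, lie_add]; abel)
    (fun c x y => by
      simp only [defect_apply, map_smul, LinearMap.smul_apply, lie_smul, smul_sub])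

theorem defect_eq_zero_of_basis (f : MvPolynomial ι k) (h : ∀ i j, defect b (b i) (b j) f = 0)
    (x y : L) : defect b x y f = 0 := by
  have : defectₗ b f = 0 := b.ext fun i => b.ext fun j => h i j
  exact LinearMap.congr_fun₂ this x y

/-- This case is built into the definition: `b_j` multiplies both `m` and `X_i m` by `X_j`, and
`act_of_lt` then reads as the bracket relation. -/
theorem defect_of_lt (i j : ι) (m : ι →₀ ℕ) (hji : j < i) (h : ∀ l ∈ m.support, j ≤ l) :
    defect b (b i) (b j) (monomial m 1) = 0 := by
  have hX : ∀ l, X l * monomial m (1 : k) = monomial (m + Finsupp.single l 1) 1 := by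
    intro l
    rw [MvPolynomial.X, monomial_mul, one_mul, add_comm]
  have hXj : act b (b j) (X i * monomial m 1) = X j * (X i * monomial m 1) := by
    rw [hX, act_of_le b]
    intro l hl
    by_cases hli : l = i
    · exact hli ▸ hji.le
    · apply h
      rw [Finsupp.mem_support_iff] at hl ⊢
      simpa [Finsupp.single_apply, Ne.symm hli] using hl
  rw [defect_apply, act_of_le b j m h, hX j, act_of_lt b i j m hji h, map_sub, hXj, ← hX j]
  ring

theorem defect_of_le (i j : ι) (m : ι →₀ ℕ) (hji : j ≤ i) (h : ∀ l ∈ m.support, j ≤ l) :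
    defect b (b i) (b j) (monomial m 1) = 0 := by
  rcases hji.eq_or_lt with rfl | hji
  · exact defect_self b _ _
  · exact defect_of_lt b i j m hji h

/-- The inductive step for monomials that start with a variable smaller than both indices. -/
theorem defect_of_min (x y z : L) (f : MvPolynomial ι k)
    (h : ∀ x y, defect b x y f = 0) (hx : defect b x z (act b y f) = 0)
    (hy : defect b y z (act b x f) = 0) (hz : defect b x y f = 0) :
    defect b x y (act b z f) = act b z (defect b x y f) := by
  have e : ∀ x y, act b x (act b y f) = act b y (act b x f) + act b ⁅x, y⁆ f := by
    intro x y
    have := h x y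
    rw [defect_apply, sub_sub, sub_eq_zero] at this
    exact this
  rw [defect_apply, sub_sub, sub_eq_zero] at hx hy
  -- The Jacobi identity of `L` enters here.
  have jac : ⁅x, ⁅y, z⁆⁆ - ⁅y, ⁅x, z⁆⁆ = ⁅⁅x, y⁆, z⁆ := by
    rw [lie_lie]
  rw [hz, map_zero, defect_apply, e y z, e x z, map_add, map_add, hx, hy, e x ⁅y, z⁆, e y ⁅x, z⁆,
    e ⁅x, y⁆ z, e x y, ← jac, map_add]
  simp only [map_sub, LinearMap.sub_apply]
  abel

/-- Induction on the degree. If one of the two indices is at most every variable of the monomial,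
the definition of the action gives the claim. Otherwise the monomial is `b_p T` with `p` below both
indices, and `defect_of_min` moves `b_p` outside, down to the defect at `T`. -/
theorem defect_eq_zero_of_degLE (d : ℕ) :
    ∀ f ∈ degLE ι k d, ∀ x y, defect b x y f = 0 := by
  induction d using Nat.strong_induction_on with
  | _ d ih =>
    intro f hf x y
    have key : degLE ι k d ≤ LinearMap.ker (defect b x y) := by
      refine degLE_le_of_monomial fun m hm => ?_
      rw [LinearMap.mem_ker]
      refine defect_eq_zero_of_basis b _ (fun i j => ?_) x y
      by_cases hi : ∀ l ∈ m.support, i ≤ l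
      · by_cases hj : ∀ l ∈ m.support, j ≤ l
        · rcases le_total i j with hij | hij
          · rw [defect_swap, defect_of_le b j i m hij hi, neg_zero]
          · exact defect_of_le b i j m hij hj
        · rw [defect_swap, defect_of_le b j i m ?_ hi, neg_zero]
          push Not at hj
          obtain ⟨l, hl, hlj⟩ := hj
          exact (hi l hl).trans hlj.le
      by_cases hj : ∀ l ∈ m.support, j ≤ l
      · apply defect_of_le b i j m ?_ hj
        push Not at hi
        obtain ⟨l, hl, hli⟩ := hi
        exact (hj l hl).trans hli.le
      obtain ⟨p, T, rfl, hpi, hT⟩ := exists_eq_add_single hi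
      have hpj : p < j := by
        push Not at hj
        obtain ⟨l, hl, hlj⟩ := hj
        refine lt_of_le_of_lt ?_ hlj
        by_cases hlp : l = p
        · exact hlp.ge
        · apply hT
          rw [Finsupp.mem_support_iff] at hl ⊢
          simpa [Finsupp.single_apply, Ne.symm hlp] using hl
      rw [degree_add_single] at hm
      have ihT := ih T.degree (by omega)
      have hTm := monomial_mem_degLE (k := k) T 1
      have hp : monomial (T + Finsupp.single p 1) 1 = act b (b p) (monomial T 1) := by
        rw [act_of_le b p T hT, MvPolynomial.X, monomial_mul, one_mul, add_comm]
      -- `b_j T` is `X_j T` plus terms of degree at most that of `T`. The latter fall under the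
      -- induction hypothesis, and `p` is still minimal for `X_j T`.
      have aux : ∀ i j, p < i → p < j →
          defect b (b i) (b p) (act b (b j) (monomial T 1)) = 0 := by
        intro i j hpi hpj
        have e : act b (b j) (monomial T 1) =
            monomial (T + Finsupp.single j 1) 1 +
              (act b (b j) (monomial T 1) - X j * monomial T 1) := by
          rw [MvPolynomial.X, monomial_mul, one_mul, add_comm _ T]; ring
        rw [e, map_add, ihT _ (act_sub_X_mul_mem b j hTm), add_zero]
        refine defect_of_lt b i p _ hpi fun l hl => ?_
        by_cases hlj : l = j
        · exact hlj ▸ hpj.le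
        · apply hT
          rw [Finsupp.mem_support_iff] at hl ⊢
          simpa [Finsupp.single_apply, Ne.symm hlj] using hl
      rw [hp, defect_of_min b _ _ _ _ (ihT _ hTm) (aux i j hpi hpj) (aux j i hpj hpi)
        (ihT _ hTm _ _), ihT _ hTm, map_zero]
    exact key hf

theorem defect_eq_zero (x y : L) : defect b x y = 0 := by
  refine (basisMonomials ι k).ext fun m => ?_
  rw [coe_basisMonomials]
  exact defect_eq_zero_of_degLE b _ _ (monomial_mem_degLE m 1) x y

attribute [local instance] LieRing.ofAssociativeRing LieAlgebra.ofAssociativeAlgebra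

/-- The representation of the Lie algebra on the polynomial ring, as a homomorphism. -/
def actLie : L →ₗ⁅k⁆ Module.End k (MvPolynomial ι k) where
  toLinearMap := act b
  map_lie' := by
    intro x y
    have h := defect_eq_zero b x y
    rw [defect, sub_eq_zero] at h
    exact h.symm

/-- The representation of the enveloping algebra on the polynomial ring. -/
def rep : UniversalEnvelopingAlgebra k L →ₐ[k] Module.End k (MvPolynomial ι k) :=
  UniversalEnvelopingAlgebra.lift k (actLie b)

theorem rep_ι (x : L) : rep b (UniversalEnvelopingAlgebra.ι k x) = act b x :=
  UniversalEnvelopingAlgebra.lift_ι_apply k (actLie b) x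

theorem act_mem_wtLE_of_monomial {w : ι → ℤ} {d : ℕ}
    (h : ∀ (m : ι →₀ ℕ) (i : ι), m.degree < d →
      act b (b i) (monomial m 1) ∈ wtLE k w (Finsupp.weight w m + w i))
    (i : ι) {p : ℤ} {f : MvPolynomial ι k} (hf : f ∈ wtLE k w p)
        (hf' : ∃ e, e < d ∧ f ∈ degLE ι k e) :
    act b (b i) f ∈ wtLE k w (p + w i) := by
  obtain ⟨e, he, hfe⟩ := hf'
  rw [mem_wtLE] at hf
  rw [mem_degLE] at hfe
  rw [f.as_sum, map_sum]
  refine Submodule.sum_mem _ fun m hm => ?_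
  rw [MvPolynomial.mem_support_iff] at hm
  have hc : monomial m (coeff m f) = coeff m f • monomial m (1 : k) := by
    rw [smul_monomial, smul_eq_mul, mul_one]
  rw [hc, map_smul]
  exact Submodule.smul_mem _ _ (wtLE_mono w (by have := hf m hm; omega)
    (h m i (lt_of_le_of_lt (hfe m hm) he)))

/-- Every term of the recursion has the expected weight as soon as brackets do not raise weight. The
degree is carried along because the induction runs on it, and the remainder `b_i T - X_i T` is
bounded in both filtrations. -/
theorem act_mem_wtLE_monomial (w : ι → ℤ)
    (hw : ∀ i j l, b.repr ⁅b i, b j⁆ l ≠ 0 → w l ≤ w i + w j) (d : ℕ) :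
    ∀ (m : ι →₀ ℕ) (i : ι), m.degree < d →
      act b (b i) (monomial m 1) ∈ wtLE k w (Finsupp.weight w m + w i) := by
  induction d with
  | zero => intro m i h; omega
  | succ d ih =>
    intro m i hm
    have hX : ∀ (m : ι →₀ ℕ) (i : ι), X i * monomial m (1 : k) ∈
        wtLE k w (Finsupp.weight w m + w i) := fun m i => by
      rw [add_comm]
      exact mul_mem_wtLE (X_mem_wtLE w i) (monomial_mem_wtLE w m 1)
    by_cases h : ∀ j ∈ m.support, i ≤ j
    · rw [act_of_le b i m h]
      exact hX m i
    · obtain ⟨j, T, rfl, hji, hT⟩ := exists_eq_add_single h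
      rw [degree_add_single] at hm
      have hTm := monomial_mem_degLE (k := k) T 1
      have hwt : Finsupp.weight w (T + Finsupp.single j 1) = Finsupp.weight w T + w j := by
        rw [map_add, Finsupp.weight_single, one_smul]
      rw [act_of_lt b i j T hji hT]
      refine Submodule.add_mem _ (Submodule.add_mem _ (hX _ _) ?_) ?_
      · rw [hwt, add_right_comm]
        refine act_mem_wtLE_of_monomial b ih j (Submodule.sub_mem _ (ih T i (by omega)) (hX T i))
          ⟨T.degree, by omega, act_sub_X_mul_mem b i hTm⟩
      · rw [← b.linearCombination_repr ⁅b i, b j⁆, Finsupp.linearCombination_apply, Finsupp.sum,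
          map_sum, LinearMap.sum_apply]
        refine Submodule.sum_mem _ fun l hl => ?_
        rw [map_smul, LinearMap.smul_apply]
        refine Submodule.smul_mem _ _ (wtLE_mono w ?_ (ih T l (by omega)))
        have := hw i j l (Finsupp.mem_support_iff.1 hl)
        omega

theorem act_mem_wtLE (w : ι → ℤ) (hw : ∀ i j l, b.repr ⁅b i, b j⁆ l ≠ 0 → w l ≤ w i + w j)
    (i : ι) {p : ℤ} {f : MvPolynomial ι k} (hf : f ∈ wtLE k w p) :
    act b (b i) f ∈ wtLE k w (p + w i) := by
  have : wtLE k w p ≤ (wtLE k w (p + w i)).comap (act b (b i)) :=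
    wtLE_le_of_monomial fun m hm =>
      wtLE_mono w (by omega) (act_mem_wtLE_monomial b w hw _ m i (Nat.lt_succ_self _))
  exact this hf

end PBW

end

noncomputable section

open MvPolynomial

/-! ### Principal symbols and the associated graded ring. -/

namespace PBW

variable {ι k : Type*} [CommRing k]

theorem homogeneousComponent_succ_X_mul (i : ι) (n : ℕ) (f : MvPolynomial ι k) :
    homogeneousComponent (n + 1) (X i * f) = X i * homogeneousComponent n f := by
  classical
  ext m
  rw [coeff_homogeneousComponent, coeff_X_mul', coeff_X_mul', coeff_homogeneousComponent]
  by_cases hi : i ∈ m.support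
  · have h1 : m - Finsupp.single i 1 + Finsupp.single i 1 = m := by
      rw [tsub_add_cancel_of_le]
      rw [Finsupp.single_le_iff]
      exact Nat.one_le_iff_ne_zero.2 (Finsupp.mem_support_iff.1 hi)
    have h2 : m.degree = (m - Finsupp.single i 1).degree + 1 := by
      conv_lhs => rw [← h1, degree_add_single]
    simp only [hi, if_true, h2, Nat.add_right_cancel_iff]
  · simp [hi]

theorem homogeneousComponent_eq_zero_of_mem_degLE {d n : ℕ} {f : MvPolynomial ι k}
    (hf : f ∈ degLE ι k d) (h : d < n) : homogeneousComponent n f = 0 := by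
  rw [mem_degLE] at hf
  ext m
  rw [coeff_homogeneousComponent, coeff_zero]
  split_ifs with hm
  · by_contra h0
    have := hf m h0
    omega
  · rfl

theorem one_mem_degLE (d : ℕ) : (1 : MvPolynomial ι k) ∈ degLE ι k d :=
  degLE_mono (Nat.zero_le d) (by simpa using monomial_mem_degLE (k := k) (0 : ι →₀ ℕ) 1)

theorem homogeneousComponent_zero_one :
    homogeneousComponent 0 (1 : MvPolynomial ι k) = 1 := by
  rw [homogeneousComponent_zero]; simp

theorem homogeneousComponent_mem_wtLE {w : ι → ℤ} {p : ℤ} {f : MvPolynomial ι k}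
    (hf : f ∈ wtLE k w p) (n : ℕ) : homogeneousComponent n f ∈ wtLE k w p := by
  rw [mem_wtLE] at hf ⊢
  intro m hm
  rw [coeff_homogeneousComponent] at hm
  split_ifs at hm
  · exact hf m hm
  · exact absurd rfl hm

end PBW

namespace Cohn

open PBW

attribute [local instance] LieRing.ofAssociativeRing LieAlgebra.ofAssociativeAlgebra

variable {ι k L : Type*} [LinearOrder ι] [Field k] [LieRing L] [LieAlgebra k L]
  (b : Module.Basis ι k L)

/-- The principal symbol of an element of the `n`-th term of the standard filtration. -/
def sym (n : ℕ) : UniversalEnvelopingAlgebra k L →ₗ[k] MvPolynomial ι k :=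
  (homogeneousComponent n).comp ((LinearMap.applyₗ 1).comp (rep b).toLinearMap)

theorem sym_apply (n : ℕ) (a : UniversalEnvelopingAlgebra k L) :
    sym b n a = homogeneousComponent n (rep b a 1) := rfl

theorem sym_one_of_pos {n : ℕ} (hn : 0 < n) : sym b n 1 = 0 := by
  have h : rep b 1 = 1 := map_one _
  rw [sym_apply, h]
  exact homogeneousComponent_eq_zero_of_mem_degLE (one_mem_degLE 0) hn

theorem sym_zero_one : sym b 0 1 = 1 := by
  have h : rep b 1 = 1 := map_one _
  rw [sym_apply, h]
  exact homogeneousComponent_zero_one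

theorem sym_ι_basis (i : ι) : sym b 1 (UniversalEnvelopingAlgebra.ι k (b i)) = X i := by
  have h := act_of_le b i 0 (by simp)
  have h1 : (monomial (0 : ι →₀ ℕ)) (1 : k) = 1 := rfl
  rw [h1, mul_one] at h
  rw [sym_apply, rep_ι, h, homogeneousComponent_of_mem (isHomogeneous_X k i), if_pos rfl]

theorem sym_ι (x : L) : sym b 1 (UniversalEnvelopingAlgebra.ι k x) =
    (b.repr x).sum fun i c => c • (X i : MvPolynomial ι k) := by
  conv_lhs => rw [← b.linearCombination_repr x, Finsupp.linearCombination_apply, Finsupp.sum,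
    map_sum, map_sum]
  refine Finset.sum_congr rfl fun i _ => ?_
  rw [map_smul, map_smul, sym_ι_basis]

theorem sym_ι_ne_zero {x : L} (hx : x ≠ 0) : sym b 1 (UniversalEnvelopingAlgebra.ι k x) ≠ 0 := by
  intro h
  rw [sym_ι] at h
  apply hx
  have hli : LinearIndependent k (X : ι → MvPolynomial ι k) := linearIndependent_X ι k
  have := (linearIndependent_iff.1 hli) (b.repr x) (by
    rw [Finsupp.linearCombination_apply]; exact h)
  simpa using this

/-- A basis element acts as its variable up to terms that do not raise the degree, and scalars do
not reach the top degree. -/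
theorem rep_filtrationOne {a : UniversalEnvelopingAlgebra k L} (ha : a ∈ filtrationOne k L)
    {d : ℕ} {f : MvPolynomial ι k} (hf : f ∈ degLE ι k d) :
    rep b a f ∈ degLE ι k (d + 1) ∧
      homogeneousComponent (d + 1) (rep b a f) = sym b 1 a * homogeneousComponent d f := by
  obtain ⟨c, hc, _, ⟨x, rfl⟩, rfl⟩ := Submodule.mem_sup.1 ha
  obtain ⟨c, rfl⟩ := Submodule.mem_one.1 hc
  have hx : rep b (UniversalEnvelopingAlgebra.ι k x) f ∈ degLE ι k (d + 1) ∧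
      homogeneousComponent (d + 1) (rep b (UniversalEnvelopingAlgebra.ι k x) f) =
        sym b 1 (UniversalEnvelopingAlgebra.ι k x) * homogeneousComponent d f := by
    refine ⟨by rw [rep_ι]; exact act_mem b x hf, ?_⟩
    clear ha
    induction b.mem_span x using Submodule.span_induction with
    | zero => simp
    | add x y _ _ hx hy =>
      simp only [map_add, LinearMap.add_apply, add_mul] at hx hy ⊢
      rw [hx, hy]
    | smul c x _ hx =>
      rw [map_smul, map_smul, LinearMap.smul_apply, map_smul, hx, map_smul, smul_mul_assoc]
    | mem x hx =>
      obtain ⟨i, rfl⟩ := hx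
      have e : act b (b i) f = X i * f + (act b (b i) f - X i * f) := by ring
      rw [rep_ι, sym_ι_basis, e, map_add, homogeneousComponent_succ_X_mul,
        homogeneousComponent_eq_zero_of_mem_degLE (act_sub_X_mul_mem b i hf) (Nat.lt_succ_self d),
        add_zero]
  have hc1 : rep b (algebraMap k _ c) f = c • f := by rw [AlgHom.commutes]; rfl
  have hc2 : sym b 1 (algebraMap k _ c) = 0 := by
    rw [Algebra.algebraMap_eq_smul_one, map_smul, sym_one_of_pos b Nat.one_pos, smul_zero]
  rw [map_add, LinearMap.add_apply, hc1, map_add, map_add, hc2, zero_add, map_smul,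
    homogeneousComponent_eq_zero_of_mem_degLE hf (Nat.lt_succ_self d), smul_zero, zero_add]
  exact ⟨Submodule.add_mem _ (Submodule.smul_mem _ _ (degLE_mono (Nat.le_succ d) hf)) hx.1, hx.2⟩

/-- Reading off the top component for every argument `f`, not only for `f = 1`, is what makes
symbols multiplicative in `sym_mul`. -/
theorem rep_filtration (n : ℕ) : ∀ a ∈ filtration k L n, ∀ (d : ℕ), ∀ f ∈ degLE ι k d,
    rep b a f ∈ degLE ι k (d + n) ∧
      homogeneousComponent (d + n) (rep b a f) = sym b n a * homogeneousComponent d f := by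
  induction n with
  | zero =>
    intro a ha d f hf
    rw [filtration, pow_zero] at ha
    obtain ⟨c, rfl⟩ := Submodule.mem_one.1 ha
    have hc1 : rep b (algebraMap k _ c) f = c • f := by rw [AlgHom.commutes]; rfl
    rw [hc1, Algebra.algebraMap_eq_smul_one, map_smul, map_smul, sym_zero_one, smul_mul_assoc,
      one_mul]
    exact ⟨Submodule.smul_mem _ _ hf, rfl⟩
  | succ n ih =>
    intro a ha
    rw [filtration, pow_succ] at ha
    induction ha using Submodule.mul_induction_on' with
    | mem_mul_mem a₁ h₁ a₂ h₂ =>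
      have key : ∀ (d : ℕ), ∀ f ∈ degLE ι k d, rep b (a₁ * a₂) f ∈ degLE ι k (d + (n + 1)) ∧
          homogeneousComponent (d + (n + 1)) (rep b (a₁ * a₂) f) =
            sym b n a₁ * sym b 1 a₂ * homogeneousComponent d f := by
        intro d f hf
        obtain ⟨h3, h4⟩ := rep_filtrationOne b h₂ hf
        obtain ⟨h5, h6⟩ := ih a₁ h₁ _ _ h3
        rw [map_mul, Module.End.mul_apply]
        rw [show d + (n + 1) = d + 1 + n by omega]
        exact ⟨h5, by rw [h6, h4, mul_assoc]⟩
      intro d f hf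
      refine ⟨(key d f hf).1, ?_⟩
      -- The argument `1` in degree `0` identifies the factor `sym a₁ * sym a₂` with the symbol of
      -- the product.
      have h1 := (key 0 1 (one_mem_degLE 0)).2
      rw [homogeneousComponent_zero_one, mul_one, zero_add, ← sym_apply] at h1
      rw [(key d f hf).2, h1]
    | add a₁ _ a₂ _ h₁ h₂ =>
      intro d f hf
      rw [map_add, LinearMap.add_apply, map_add, map_add, add_mul, (h₁ d f hf).2, (h₂ d f hf).2]
      exact ⟨Submodule.add_mem _ (h₁ d f hf).1 (h₂ d f hf).1, rfl⟩

theorem sym_mul {m n : ℕ} {a c : UniversalEnvelopingAlgebra k L} (ha : a ∈ filtration k L m)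
    (hc : c ∈ filtration k L n) : sym b (m + n) (a * c) = sym b m a * sym b n c := by
  have h := (rep_filtration b n c hc 0 1 (one_mem_degLE 0)).1
  have h2 := (rep_filtration b m a ha _ _ h).2
  rw [zero_add] at h2
  rw [sym_apply, map_mul, Module.End.mul_apply, add_comm m n, h2, sym_apply b n]

theorem sym_succ_of_mem {n : ℕ} {a : UniversalEnvelopingAlgebra k L}
    (ha : a ∈ filtration k L n) : sym b (n + 1) a = 0 := by
  have h := (rep_filtration b n a ha 0 1 (one_mem_degLE 0)).1
  exact homogeneousComponent_eq_zero_of_mem_degLE h (by omega)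

theorem sym_pow {n : ℕ} {a : UniversalEnvelopingAlgebra k L} (ha : a ∈ filtration k L n) (r : ℕ) :
    a ^ r ∈ filtration k L (r * n) ∧ sym b (r * n) (a ^ r) = sym b n a ^ r := by
  induction r with
  | zero => simp [sym_zero_one, one_mem_filtration]
  | succ r ih =>
    rw [pow_succ, pow_succ, Nat.succ_mul]
    exact ⟨mul_mem_filtration k L ih.1 ha, by rw [sym_mul b ih.1 ha, ih.2]⟩

/-- The symbol of an element of the Rees ring in the symmetric algebra. -/
def symbolₗ : Polynomial (UniversalEnvelopingAlgebra k L) →ₗ[k] MvPolynomial ι k :=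
  Polynomial.lsum fun n => sym b n

theorem symbolₗ_monomial (n : ℕ) (a : UniversalEnvelopingAlgebra k L) :
    symbolₗ b (Polynomial.monomial n a) = sym b n a := by
  rw [symbolₗ, Polynomial.lsum_apply]
  exact Polynomial.sum_monomial_index a _ (map_zero (sym b n))

theorem symbolₗ_mul {p q : Polynomial (UniversalEnvelopingAlgebra k L)} (hp : p ∈ rees k L)
    (hq : q ∈ rees k L) : symbolₗ b (p * q) = symbolₗ b p * symbolₗ b q := by
  rw [p.as_sum_support, q.as_sum_support, Finset.sum_mul_sum]
  simp only [map_sum, Polynomial.monomial_mul_monomial, symbolₗ_monomial, Finset.sum_mul_sum]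
  exact Finset.sum_congr rfl fun i _ => Finset.sum_congr rfl fun j _ => sym_mul b (hp i) (hq j)

/-- The map from the Rees ring to the symmetric algebra, with kernel generated by `t`. -/
def grMap : rees k L →ₐ[k] MvPolynomial ι k :=
  AlgHom.ofLinearMap ((symbolₗ b).comp (rees k L).val.toLinearMap)
    (by
      change symbolₗ b 1 = 1
      rw [← Polynomial.monomial_zero_one, symbolₗ_monomial, sym_zero_one])
    (fun p q => symbolₗ_mul b p.2 q.2)

/-- The homogeneous element `a tⁿ` of the Rees ring. -/
def mono (n : ℕ) (a : UniversalEnvelopingAlgebra k L) (ha : a ∈ filtration k L n) : rees k L :=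
  ⟨Polynomial.monomial n a, fun m => by
    rw [Polynomial.coeff_monomial]
    split_ifs with h
    · exact h ▸ ha
    · exact Submodule.zero_mem _⟩

theorem grMap_mono (n : ℕ) (a : UniversalEnvelopingAlgebra k L) (ha : a ∈ filtration k L n) :
    grMap b (mono n a ha) = sym b n a := symbolₗ_monomial b n a

theorem t_eq_mono : t k L = mono 1 1 (one_mem_filtration k L 1) := rfl

theorem grMap_t : grMap b (t k L) = 0 := by
  rw [t_eq_mono, grMap_mono, sym_one_of_pos b Nat.one_pos]

theorem mono_add {n : ℕ} {a c : UniversalEnvelopingAlgebra k L} (ha : a ∈ filtration k L n)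
    (hc : c ∈ filtration k L n) :
    mono n (a + c) (Submodule.add_mem _ ha hc) = mono n a ha + mono n c hc :=
  Subtype.ext (map_add (Polynomial.monomial n) a c)

theorem mono_mul {m n : ℕ} {a c : UniversalEnvelopingAlgebra k L} (ha : a ∈ filtration k L m)
    (hc : c ∈ filtration k L n) :
    mono (m + n) (a * c) (mul_mem_filtration k L ha hc) = mono m a ha * mono n c hc :=
  Subtype.ext (Polynomial.monomial_mul_monomial m n a c).symm

theorem eq_sum_mono (p : rees k L) :
    p = ∑ n ∈ p.1.support, mono n (p.1.coeff n) (p.2 n) := by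
  refine Subtype.ext ?_
  rw [AddSubmonoidClass.coe_finsetSum]
  exact p.1.as_sum_support

/-- Commutators in the Rees ring are multiples of `t`. Commutativity allows `toGr` to be defined by
evaluating polynomials. -/
instance : CommRing (Trunc k L 1) where
  __ := (inferInstance : Ring (Trunc k L 1))
  mul_comm x y := by
    obtain ⟨p, rfl⟩ := toTrunc_surjective k L 1 x
    obtain ⟨q, rfl⟩ := toTrunc_surjective k L 1 y
    obtain ⟨r, hr⟩ := rees_commutator k L p q
    have h := congrArg (toTrunc k L 1) hr
    have ht := toTrunc_t_pow k L 1
    rw [pow_one] at ht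
    rw [map_sub, map_mul, map_mul, map_mul, ht, zero_mul, sub_eq_zero] at h
    exact h

/-- The map from the symmetric algebra to the associated graded ring. -/
def toGr : MvPolynomial ι k →ₐ[k] Trunc k L 1 := aeval fun i => toTrunc k L 1 (symbol k L (b i))

theorem toTrunc_t : toTrunc k L 1 (t k L) = 0 := by
  simpa using toTrunc_t_pow k L 1

omit [LinearOrder ι] in
theorem symbol_mem_range_toGr (x : L) : toTrunc k L 1 (symbol k L x) ∈ (toGr b).range := by
  induction b.mem_span x using Submodule.span_induction with
  | zero => rw [map_zero, map_zero]; exact Subalgebra.zero_mem _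
  | add x y _ _ hx hy => rw [map_add, map_add]; exact Subalgebra.add_mem _ hx hy
  | smul c x _ hx => rw [map_smul, map_smul]; exact Subalgebra.smul_mem _ hx c
  | mem x hx =>
    obtain ⟨i, rfl⟩ := hx
    exact ⟨X i, by simp [toGr]⟩

omit [LinearOrder ι] in
theorem mono_mem_range_toGr (n : ℕ) : ∀ (a : UniversalEnvelopingAlgebra k L)
    (ha : a ∈ filtration k L n), toTrunc k L 1 (mono n a ha) ∈ (toGr b).range := by
  induction n with
  | zero =>
    intro a ha
    have ha' := ha
    rw [filtration, pow_zero] at ha'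
    obtain ⟨c, rfl⟩ := Submodule.mem_one.1 ha'
    have : mono 0 (algebraMap k _ c) ha = algebraMap k (rees k L) c := rfl
    rw [this, AlgHom.commutes]
    exact Subalgebra.algebraMap_mem _ c
  | succ n ih =>
    intro a ha
    -- The membership proof is made part of the claim so that the induction over sums and products
    -- can carry it.
    suffices h : ∀ a ∈ filtration k L n * filtrationOne k L, ∃ ha : a ∈ filtration k L (n + 1),
        toTrunc k L 1 (mono (n + 1) a ha) ∈ (toGr b).range from (h a (by
          rwa [filtration, pow_succ] at ha)).2
    intro a ha
    induction ha using Submodule.mul_induction_on' with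
    | mem_mul_mem a₁ h₁ a₂ h₂ =>
      have h₂' : a₂ ∈ filtration k L 1 := by rwa [filtration, pow_one]
      refine ⟨mul_mem_filtration k L h₁ h₂', ?_⟩
      rw [mono_mul h₁ h₂', map_mul]
      refine Subalgebra.mul_mem _ (ih _ _) ?_
      obtain ⟨c, hc, _, ⟨x, rfl⟩, rfl⟩ := Submodule.mem_sup.1 h₂
      obtain ⟨c, rfl⟩ := Submodule.mem_one.1 hc
      have e : mono 1 _ h₂' = c • t k L + symbol k L x := by
        refine Subtype.ext ?_
        change Polynomial.monomial 1 _ = c • Polynomial.X + Polynomial.monomial 1 _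
        rw [map_add, Algebra.algebraMap_eq_smul_one, ← Polynomial.smul_monomial,
          Polynomial.monomial_one_one_eq_X]
        rfl
      rw [e, map_add, map_smul, toTrunc_t, smul_zero, zero_add]
      exact symbol_mem_range_toGr b x
    | add a₁ _ a₂ _ h₁ h₂ =>
      obtain ⟨h₁, h₁'⟩ := h₁
      obtain ⟨h₂, h₂'⟩ := h₂
      refine ⟨Submodule.add_mem _ h₁ h₂, ?_⟩
      rw [mono_add h₁ h₂, map_add]
      exact Subalgebra.add_mem _ h₁' h₂'

-- The easy half of Poincaré–Birkhoff–Witt: the graded ring is generated by the symbols of the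
-- basis.
omit [LinearOrder ι] in
theorem toGr_surjective (p : rees k L) : toTrunc k L 1 p ∈ (toGr b).range := by
  rw [eq_sum_mono p, map_sum]
  exact Subalgebra.sum_mem _ fun n _ => mono_mem_range_toGr b n _ _

theorem grMap_eq_zero_of_mem {p : rees k L} (hp : p ∈ tIdeal k L 1) : grMap b p = 0 := by
  rw [tIdeal, pow_one, Ideal.mem_span_singleton'] at hp
  obtain ⟨c, rfl⟩ := hp
  rw [map_mul, grMap_t, mul_zero]

/-- `grMap` on the associated graded ring. -/
def fromGr : Trunc k L 1 →ₐ[k] MvPolynomial ι k :=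
  Ideal.Quotient.liftₐ (tIdeal k L 1) (grMap b) fun _ hp => grMap_eq_zero_of_mem b hp

theorem fromGr_toTrunc (p : rees k L) : fromGr b (toTrunc k L 1 p) = grMap b p := rfl

/-- The hard half of Poincaré–Birkhoff–Witt, which rests on the action: the symbols of the basis
satisfy no relations in the graded ring. -/
theorem fromGr_toGr (f : MvPolynomial ι k) : fromGr b (toGr b f) = f := by
  have : (fromGr b).comp (toGr b) = AlgHom.id k _ := by
    refine MvPolynomial.algHom_ext fun i => ?_
    rw [AlgHom.comp_apply, toGr, aeval_X, fromGr_toTrunc]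
    exact (symbolₗ_monomial b 1 _).trans (sym_ι_basis b i)
  exact DFunLike.congr_fun this f

theorem grMap_eq_zero_iff {p : rees k L} : grMap b p = 0 ↔ ∃ q, p = t k L * q := by
  constructor
  · intro h
    obtain ⟨f, hf⟩ := toGr_surjective b p
    rw [← fromGr_toTrunc, ← hf] at h
    have h0 : f = 0 := (fromGr_toGr b f).symm.trans h
    rw [h0, map_zero] at hf
    have : p ∈ tIdeal k L 1 := Ideal.Quotient.eq_zero_iff_mem.1 hf.symm
    rw [tIdeal, pow_one, Ideal.mem_span_singleton'] at this
    obtain ⟨c, rfl⟩ := this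
    exact ⟨c, (t_central k L c).symm⟩
  · rintro ⟨q, rfl⟩
    rw [map_mul, grMap_t, zero_mul]

theorem t_mul_cancel {p q : rees k L} (h : t k L * p = t k L * q) : p = q := by
  refine Subtype.ext ?_
  have h' : Polynomial.X * p.1 = Polynomial.X * q.1 := congrArg Subtype.val h
  rw [Polynomial.X_mul, Polynomial.X_mul] at h'
  ext n
  have := congrArg (fun r => Polynomial.coeff r (n + 1)) h'
  simpa using this

theorem t_pow_central (n : ℕ) (p : rees k L) : t k L ^ n * p = p * t k L ^ n :=
  ((show Commute (t k L) p from t_central k L p).pow_left n).eq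

/-- The elements outside `(t)` are regular modulo `tⁿ`. -/
theorem dvd_of_dvd_mul {s a c : rees k L} (hs : grMap b s ≠ 0) (n : ℕ)
    (h : s * a = t k L ^ n * c) : ∃ d, a = t k L ^ n * d := by
  induction n generalizing a c with
  | zero => exact ⟨a, by simp⟩
  | succ n ih =>
    have h0 : grMap b s * grMap b a = 0 := by
      rw [← map_mul, h, map_mul, map_pow, grMap_t]; simp
    obtain ⟨a', rfl⟩ := (grMap_eq_zero_iff b).1 ((mul_eq_zero.1 h0).resolve_left hs)
    rw [← mul_assoc, ← t_central, mul_assoc, pow_succ', mul_assoc] at h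
    obtain ⟨d, rfl⟩ := ih (t_mul_cancel h)
    exact ⟨d, by rw [pow_succ', mul_assoc]⟩

/-- `grMap` has values in a domain, so the complement of its kernel `(t)` is multiplicatively closed
and taking the closure adds nothing. -/
theorem mem_denominators {p : rees k L} : p ∈ denominators k L ↔ grMap b p ≠ 0 := by
  constructor
  · intro hp
    induction hp using Submonoid.closure_induction with
    | mem x hx =>
      intro h
      apply hx
      obtain ⟨q, rfl⟩ := (grMap_eq_zero_iff b).1 h
      rw [tIdeal, pow_one, Ideal.mem_span_singleton']
      exact ⟨q, (t_central k L q).symm⟩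
    | one => rw [map_one]; exact one_ne_zero
    | mul x y _ _ hx hy => rw [map_mul]; exact mul_ne_zero hx hy
  · intro hp
    exact Submonoid.subset_closure fun h => hp (grMap_eq_zero_of_mem b h)

end Cohn

end

noncomputable section

open MvPolynomial

namespace Cohn

open PBW

open scoped OreLocalization

attribute [local instance] LieRing.ofAssociativeRing LieAlgebra.ofAssociativeAlgebra

/-! ### The localized quotients and their limit -/

section Localization

variable {k L : Type*} [Field k] [LieRing L] [LieAlgebra k L]

/-- The map from the Rees ring to the localized quotient by `tⁿ`. -/
def loc (n : ℕ) : rees k L →ₐ[k] LocTrunc k L n := (toLoc k L n).comp (toTrunc k L n)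

theorem toCompletion_apply (p : rees k L) (n : ℕ) : (toCompletion k L p).1 n = loc n p := rfl

theorem loc_t_pow (n : ℕ) : loc n (t k L ^ n) = 0 := by
  rw [loc, AlgHom.comp_apply, map_pow, toTrunc_t_pow, map_zero]

theorem loc_t_pow_mul (n : ℕ) (c : rees k L) : loc n (t k L ^ n * c) = 0 := by
  rw [map_mul, loc_t_pow, zero_mul]

theorem toTrunc_eq_zero {n : ℕ} {p : rees k L} (h : toTrunc k L n p = 0) :
    ∃ c, p = t k L ^ n * c := by
  have : p ∈ tIdeal k L n := Ideal.Quotient.eq_zero_iff_mem.1 h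
  rw [tIdeal, Ideal.mem_span_singleton'] at this
  obtain ⟨c, rfl⟩ := this
  exact ⟨c, (t_pow_central n c).symm⟩

theorem transition_loc (n : ℕ) (p : rees k L) : transition k L n (loc (n + 1) p) = loc n p :=
  transition_toLoc k L n _

theorem exists_completionToDivRing (y : DivRing k L) : ∃ (m : ℕ) (x : completion k L),
    reesToDivRing k L (t k L) ^ m * y = completionToDivRing k L x := by
  induction y using OreLocalization.ind with
  | _ r s =>
    obtain ⟨_, m, rfl⟩ := s
    have hm : toCompletion k L (t k L) ^ m ∈ tPowers k L := ⟨m, rfl⟩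
    refine ⟨m, r, ?_⟩
    have h : reesToDivRing k L (t k L) ^ m =
        completionToDivRing k L (toCompletion k L (t k L) ^ m) := by
      rw [map_pow]; rfl
    rw [h]
    exact OreLocalization.mul_cancel (s := ⟨_, hm⟩)

theorem isUnit_t : IsUnit (reesToDivRing k L (t k L)) :=
  ⟨⟨_, tInv k L, mul_tInv k L, tInv_mul k L⟩, rfl⟩

theorem reesToDivRing_t_central (y : DivRing k L) : Commute (reesToDivRing k L (t k L)) y := by
  obtain ⟨m, x, hx⟩ := exists_completionToDivRing y
  have h : Commute (reesToDivRing k L (t k L)) (completionToDivRing k L x) := by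
    have := congrArg (completionToDivRing k L) (toCompletion_t_central k L x)
    rwa [map_mul, map_mul] at this
  rw [← hx] at h
  have hu : IsUnit (reesToDivRing k L (t k L) ^ m) := isUnit_t.pow m
  refine hu.mul_left_cancel ?_
  rw [← mul_assoc, ← mul_assoc, ← pow_succ, pow_succ', mul_assoc, h.eq, mul_assoc]

/-- Transfers invertibility and weights from the Rees ring to the image of the enveloping algebra,
since `t` is a central unit. -/
theorem reesToDivRing_mono (n : ℕ) : ∀ (a : UniversalEnvelopingAlgebra k L)
    (ha : a ∈ filtration k L n), reesToDivRing k L (mono n a ha) =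
      reesToDivRing k L (t k L) ^ n * embedding k L a := by
  induction n with
  | zero =>
    intro a ha
    have ha' := ha
    rw [filtration, pow_zero] at ha'
    obtain ⟨c, rfl⟩ := Submodule.mem_one.1 ha'
    have : mono 0 (algebraMap k _ c) ha = algebraMap k (rees k L) c := rfl
    rw [this, AlgHom.commutes, AlgHom.commutes, pow_zero, one_mul]
  | succ n ih =>
    intro a ha
    suffices h : ∀ a ∈ filtration k L n * filtrationOne k L, ∃ ha : a ∈ filtration k L (n + 1),
        reesToDivRing k L (mono (n + 1) a ha) =
          reesToDivRing k L (t k L) ^ (n + 1) * embedding k L a from (h a (by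
          rwa [filtration, pow_succ] at ha)).2
    intro a ha
    induction ha using Submodule.mul_induction_on' with
    | mem_mul_mem a₁ h₁ a₂ h₂ =>
      have h₂' : a₂ ∈ filtration k L 1 := by rwa [filtration, pow_one]
      refine ⟨mul_mem_filtration k L h₁ h₂', ?_⟩
      have e2 : reesToDivRing k L (mono 1 a₂ h₂') =
          reesToDivRing k L (t k L) * embedding k L a₂ := by
        obtain ⟨c, hc, _, ⟨x, rfl⟩, rfl⟩ := Submodule.mem_sup.1 h₂
        obtain ⟨c, rfl⟩ := Submodule.mem_one.1 hc
        have e : mono 1 _ h₂' = c • t k L + symbol k L x := by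
          refine Subtype.ext ?_
          change Polynomial.monomial 1 _ = c • Polynomial.X + Polynomial.monomial 1 _
          rw [map_add, Algebra.algebraMap_eq_smul_one, ← Polynomial.smul_monomial,
            Polynomial.monomial_one_one_eq_X]
          rfl
        have e' : embedding k L (UniversalEnvelopingAlgebra.ι k x) =
            tInv k L * reesToDivRing k L (symbol k L x) :=
          UniversalEnvelopingAlgebra.lift_ι_apply k (lieMap k L) x
        rw [e, map_add, map_smul, map_add, AlgHom.commutes, mul_add]
        refine congrArg₂ _ ?_ ?_
        · rw [← Algebra.commutes, Algebra.smul_def]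
        · exact (by rw [e', ← mul_assoc, mul_tInv, one_mul] : _ = reesToDivRing k L (t k L) *
            embedding k L (UniversalEnvelopingAlgebra.ι k x))
      rw [mono_mul h₁ h₂', map_mul, ih _ h₁, e2, map_mul, pow_succ]
      simp only [mul_assoc]
      rw [← mul_assoc (embedding k L a₁), ← (reesToDivRing_t_central (embedding k L a₁)).eq,
        mul_assoc]
    | add a₁ _ a₂ _ h₁ h₂ =>
      obtain ⟨h₁, h₁'⟩ := h₁
      obtain ⟨h₂, h₂'⟩ := h₂
      refine ⟨Submodule.add_mem _ h₁ h₂, ?_⟩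
      rw [mono_add h₁ h₂, map_add, h₁', h₂', map_add, mul_add]

theorem embedding_mem (a : UniversalEnvelopingAlgebra k L) : embedding k L a ∈ divSubring k L := by
  rw [divSubring, divisionClosure, Algebra.mem_sInf]
  rintro S ⟨hS, -⟩
  exact hS ⟨a, rfl⟩

theorem inv_mem_divSubring (u : (DivRing k L)ˣ) (hu : (u : DivRing k L) ∈ divSubring k L) :
    (↑u⁻¹ : DivRing k L) ∈ divSubring k L := by
  rw [divSubring, divisionClosure, Algebra.mem_sInf] at hu ⊢
  intro S hS
  exact hS.2 _ (hu S hS) _ (Units.mul_inv u) (Units.inv_mul u)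

end Localization

variable {ι k L : Type*} [LinearOrder ι] [Field k] [LieRing L] [LieAlgebra k L]

theorem exists_of_mem_truncDenominators (b : Module.Basis ι k L) {n : ℕ} {s : Trunc k L n}
    (hs : s ∈ truncDenominators k L n) : ∃ p, grMap b p ≠ 0 ∧ toTrunc k L n p = s := by
  obtain ⟨p, hp, rfl⟩ := hs
  exact ⟨p, (mem_denominators b).1 hp, rfl⟩

theorem isUnit_loc (b : Module.Basis ι k L) {p : rees k L} (hp : grMap b p ≠ 0) (n : ℕ) : IsUnit
    (loc n p) :=
  isUnit_toLoc k L n ⟨_, p, (mem_denominators b).2 hp, rfl⟩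

/-- Denominators are regular modulo `tⁿ` by `dvd_of_dvd_mul`, so nothing is killed by localizing. -/
theorem toLoc_injective (b : Module.Basis ι k L) (n : ℕ) : Function.Injective (toLoc k L n) := by
  refine OreLocalization.numeratorHom_inj ?_
  intro s hs a h
  obtain ⟨p, hp, rfl⟩ := exists_of_mem_truncDenominators b hs
  obtain ⟨q, rfl⟩ := toTrunc_surjective k L n a
  rw [← map_mul] at h
  obtain ⟨c, hc⟩ := toTrunc_eq_zero h
  obtain ⟨d, rfl⟩ := dvd_of_dvd_mul b hp n hc
  rw [map_mul, map_pow, toTrunc_t_pow, zero_mul]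

theorem loc_eq_zero (b : Module.Basis ι k L) {n : ℕ} {p : rees k L} (h : loc n p = 0) : ∃ c, p =
    t k L ^ n * c := by
  refine toTrunc_eq_zero (toLoc_injective b n ?_)
  rw [map_zero]
  exact h

theorem exists_loc_mul_eq (b : Module.Basis ι k L) (n : ℕ) (x : LocTrunc k L n) :
    ∃ s a : rees k L, grMap b s ≠ 0 ∧ loc n s * x = loc n a := by
  induction x using OreLocalization.ind with
  | _ r s =>
    obtain ⟨s, hs⟩ := s
    obtain ⟨p, hp, rfl⟩ := exists_of_mem_truncDenominators b hs
    obtain ⟨a, rfl⟩ := toTrunc_surjective k L n r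
    exact ⟨p, a, hp, OreLocalization.mul_cancel (s := ⟨_, hs⟩)⟩

/-- Modulo `tⁿ⁺¹`, the vanishing of `t a` only makes `a` divisible by `tⁿ`. One level is lost, but
the component of `x` at level `n` is the image of the one at level `n + 1`. -/
theorem toCompletion_t_mul_eq_zero (b : Module.Basis ι k L) {x : completion k L}
    (h : toCompletion k L (t k L) * x = 0) :
    x = 0 := by
  refine Subtype.ext (funext fun n => ?_)
  change x.1 n = 0
  rw [← x.2 n]
  obtain ⟨s, a, hs, e⟩ := exists_loc_mul_eq b (n + 1) (x.1 (n + 1))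
  have h1 : loc (n + 1) (t k L) * x.1 (n + 1) = 0 := congrFun (congrArg Subtype.val h) (n + 1)
  have h2 : loc (n + 1) (t k L * a) = 0 := by
    rw [map_mul, ← e, ← mul_assoc, ← map_mul, t_central, map_mul, mul_assoc, h1, mul_zero]
  obtain ⟨c, hc⟩ := loc_eq_zero b h2
  rw [pow_succ', mul_assoc] at hc
  have e' := congrArg (transition k L n) e
  rw [map_mul, transition_loc, transition_loc, t_mul_cancel hc, loc_t_pow_mul] at e'
  exact ((isUnit_loc b hs n).mul_right_eq_zero).1 e'

theorem completionToDivRing_injective (b : Module.Basis ι k L) : Function.Injective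
    (completionToDivRing k L) := by
  refine OreLocalization.numeratorHom_inj ?_
  rintro _ ⟨m, rfl⟩ x h
  induction m with
  | zero => simpa using h
  | succ m ih =>
    apply ih
    apply toCompletion_t_mul_eq_zero b
    rw [← mul_assoc, ← pow_succ']
    exact h

/-- The inverses at the different levels are compatible because inverses are unique. -/
theorem isUnit_toCompletion (b : Module.Basis ι k L) {p : rees k L} (hp : grMap b p ≠ 0) : IsUnit
    (toCompletion k L p) := by
  choose u hu using isUnit_loc b hp
  have hmem : (fun n => (↑(u n)⁻¹ : LocTrunc k L n)) ∈ completion k L := by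
    intro n
    have h1 : transition k L n (loc (n + 1) p) * transition k L n ↑(u (n + 1))⁻¹ = 1 := by
      rw [← map_mul, ← hu, Units.mul_inv, map_one]
    rw [transition_loc, ← hu] at h1
    exact Units.eq_inv_of_mul_eq_one_left h1
  refine ⟨⟨toCompletion k L p, ⟨_, hmem⟩, ?_, ?_⟩, rfl⟩
  · refine Subtype.ext (funext fun n => ?_)
    change loc n p * ↑(u n)⁻¹ = 1
    rw [← hu, Units.mul_inv]
  · refine Subtype.ext (funext fun n => ?_)
    change ↑(u n)⁻¹ * loc n p = 1
    rw [← hu, Units.inv_mul]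

theorem isUnit_reesToDivRing (b : Module.Basis ι k L) {p : rees k L} (hp : grMap b p ≠ 0) :
    IsUnit (reesToDivRing k L p) :=
  (isUnit_toCompletion b hp).map (completionToDivRing k L)

/-- A nonzero symbol puts `a tⁿ` outside `(t)`, and the unit `tⁿ` can be divided out. -/
theorem isUnit_embedding (b : Module.Basis ι k L) {n : ℕ} {a : UniversalEnvelopingAlgebra k L}
    (ha : a ∈ filtration k L n)
    (h : sym b n a ≠ 0) : IsUnit (embedding k L a) := by
  have h1 : IsUnit (reesToDivRing k L (mono n a ha)) :=
    isUnit_reesToDivRing b (by rwa [grMap_mono])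
  rw [reesToDivRing_mono] at h1
  have hT : IsUnit (reesToDivRing k L (t k L) ^ n) := isUnit_t.pow n
  obtain ⟨u, hu⟩ := hT
  rw [← hu] at h1
  exact (Units.isUnit_units_mul u _).1 h1

end Cohn

end

noncomputable section

open MvPolynomial

/-! ### Leading forms for the weight filtration of a polynomial ring. -/

namespace PBW

variable {ι k : Type*} [Field k]

theorem weightedHomogeneousComponent_sub_mem {w : ι → ℤ} {i : ℤ} {f : MvPolynomial ι k}
    (hf : f ∈ wtLE k w i) : f - weightedHomogeneousComponent w i f ∈ wtLE k w (i - 1) := by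
  rw [mem_wtLE] at hf ⊢
  intro m hm
  rw [coeff_sub, coeff_weightedHomogeneousComponent] at hm
  split_ifs at hm with h
  · simp at hm
  · rw [sub_zero] at hm
    have := hf m hm
    omega

theorem wtLE_of_isWeightedHomogeneous {w : ι → ℤ} {i : ℤ} {f : MvPolynomial ι k}
    (hf : IsWeightedHomogeneous w f i) : f ∈ wtLE k w i :=
  mem_wtLE.2 fun _ hm => (hf hm).le

theorem eq_zero_of_isWeightedHomogeneous {w : ι → ℤ} {i : ℤ} {f : MvPolynomial ι k}
    (hf : IsWeightedHomogeneous w f i) (h : f ∈ wtLE k w (i - 1)) : f = 0 := by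
  rw [mem_wtLE] at h
  ext m
  by_contra hm
  have h1 := h m hm
  rw [hf hm] at h1
  omega

/-- The leading forms are nonzero and multiply in a domain. -/
theorem mul_notMem_wtLE {w : ι → ℤ} {i j : ℤ} {f g : MvPolynomial ι k}
    (hf : f ∈ wtLE k w i) (hg : g ∈ wtLE k w j) (hf' : f ∉ wtLE k w (i - 1))
    (hg' : g ∉ wtLE k w (j - 1)) : f * g ∉ wtLE k w (i + j - 1) := by
  intro h
  have hf1 := weightedHomogeneousComponent_sub_mem hf
  have hg1 := weightedHomogeneousComponent_sub_mem hg
  have hfh := weightedHomogeneousComponent_isWeightedHomogeneous (w := w) i f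
  have hgh := weightedHomogeneousComponent_isWeightedHomogeneous (w := w) j g
  set f₀ := weightedHomogeneousComponent w i f
  set g₀ := weightedHomogeneousComponent w j g
  have e : f₀ * g₀ = f * g - (f - f₀) * g - f₀ * (g - g₀) := by ring
  have h1 : f₀ * g₀ ∈ wtLE k w (i + j - 1) := by
    rw [e]
    refine Submodule.sub_mem _ (Submodule.sub_mem _ h ?_) ?_
    · exact wtLE_mono w (by omega) (mul_mem_wtLE hf1 hg)
    · exact wtLE_mono w (by omega) (mul_mem_wtLE (wtLE_of_isWeightedHomogeneous hfh) hg1)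
  rcases mul_eq_zero.1 (eq_zero_of_isWeightedHomogeneous (hfh.mul hgh) h1) with h2 | h2
  · rw [h2, sub_zero] at hf1; exact hf' hf1
  · rw [h2, sub_zero] at hg1; exact hg' hg1

theorem one_notMem_wtLE (w : ι → ℤ) : (1 : MvPolynomial ι k) ∉ wtLE k w (-1) := fun h =>
  one_ne_zero (eq_zero_of_isWeightedHomogeneous (isWeightedHomogeneous_one k w) (by simpa using h))

end PBW

namespace Cohn

open PBW

open scoped OreLocalization

attribute [local instance] LieRing.ofAssociativeRing LieAlgebra.ofAssociativeAlgebra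

/-! ### The filtrations given by weights of the basis elements -/

variable {ι k L : Type*} [LinearOrder ι] [Field k] [LieRing L] [LieAlgebra k L]
  (b : Module.Basis ι k L) (w : ι → ℤ)

/-- The elements of the enveloping algebra of weight at most `j`. -/
def wtFil (j : ℤ) : Submodule k (UniversalEnvelopingAlgebra k L) where
  carrier := {a | ∀ p : ℤ, ∀ f ∈ wtLE k w p, rep b a f ∈ wtLE k w (p + j)}
  add_mem' := by
    intro a c ha hc p f hf
    rw [map_add, LinearMap.add_apply]
    exact Submodule.add_mem _ (ha p f hf) (hc p f hf)
  zero_mem' := by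
    intro p f _
    rw [map_zero, LinearMap.zero_apply]
    exact Submodule.zero_mem _
  smul_mem' := by
    intro c a ha p f hf
    rw [map_smul, LinearMap.smul_apply]
    exact Submodule.smul_mem _ _ (ha p f hf)

variable {b w}

theorem wtFil_mono {i j : ℤ} (h : i ≤ j) : wtFil b w i ≤ wtFil b w j :=
  fun _ ha p f hf => wtLE_mono w (by omega) (ha p f hf)

theorem mul_mem_wtFil {i j : ℤ} {a c : UniversalEnvelopingAlgebra k L} (ha : a ∈ wtFil b w i)
    (hc : c ∈ wtFil b w j) : a * c ∈ wtFil b w (i + j) := by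
  intro p f hf
  rw [map_mul, Module.End.mul_apply]
  exact wtLE_mono w (by omega) (ha _ _ (hc p f hf))

theorem one_mem_wtFil : (1 : UniversalEnvelopingAlgebra k L) ∈ wtFil b w 0 := by
  intro p f hf
  have h : rep b 1 = 1 := map_one _
  rw [h, add_zero]
  exact hf

theorem pow_mem_wtFil {i : ℤ} {a : UniversalEnvelopingAlgebra k L} (ha : a ∈ wtFil b w i) (n : ℕ) :
    a ^ n ∈ wtFil b w (n * i) := by
  induction n with
  | zero => simpa using one_mem_wtFil
  | succ n ih =>
    rw [pow_succ, show ((n + 1 : ℕ) : ℤ) * i = n * i + i by push_cast; ring]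
    exact mul_mem_wtFil ih ha

theorem ι_mem_wtFil (hw : ∀ i j l, b.repr ⁅b i, b j⁆ l ≠ 0 → w l ≤ w i + w j) (i : ι) :
    UniversalEnvelopingAlgebra.ι k (b i) ∈ wtFil b w (w i) := by
  intro p f hf
  rw [rep_ι]
  exact act_mem_wtLE b w hw i hf

variable (b w) in
/-- The elements of the Rees ring of weight at most `j`. -/
def wtRees (j : ℤ) : Submodule k (rees k L) where
  carrier := {p | ∀ n, p.1.coeff n ∈ wtFil b w j}
  add_mem' := by
    intro p q hp hq n
    exact (Polynomial.coeff_add p.1 q.1 n).symm ▸ Submodule.add_mem _ (hp n) (hq n)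
  zero_mem' := by
    intro n
    exact (Polynomial.coeff_zero (R := UniversalEnvelopingAlgebra k L) n).symm ▸
      Submodule.zero_mem _
  smul_mem' := by
    intro c p hp n
    exact (Polynomial.coeff_smul c p.1 n).symm ▸ Submodule.smul_mem _ _ (hp n)

theorem wtRees_mono {i j : ℤ} (h : i ≤ j) : wtRees b w i ≤ wtRees b w j :=
  fun _ hp n => wtFil_mono h (hp n)

theorem mul_mem_wtRees {i j : ℤ} {p q : rees k L} (hp : p ∈ wtRees b w i)
    (hq : q ∈ wtRees b w j) : p * q ∈ wtRees b w (i + j) := by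
  intro n
  change (p.1 * q.1).coeff n ∈ _
  rw [Polynomial.coeff_mul]
  exact Submodule.sum_mem _ fun x _ => mul_mem_wtFil (hp _) (hq _)

theorem mono_mem_wtRees {n : ℕ} {a : UniversalEnvelopingAlgebra k L} (ha : a ∈ filtration k L n)
    {j : ℤ} (h : a ∈ wtFil b w j) : mono n a ha ∈ wtRees b w j := by
  intro m
  change (Polynomial.monomial n a).coeff m ∈ _
  rw [Polynomial.coeff_monomial]
  split_ifs
  · exact h
  · exact Submodule.zero_mem _

theorem t_mem_wtRees : t k L ∈ wtRees b w 0 := by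
  rw [t_eq_mono]
  exact mono_mem_wtRees _ one_mem_wtFil

theorem one_mem_wtRees : (1 : rees k L) ∈ wtRees b w 0 := by
  have : (1 : rees k L) = mono 0 1 (one_mem_filtration k L 0) :=
    Subtype.ext Polynomial.monomial_zero_one.symm
  rw [this]
  exact mono_mem_wtRees _ one_mem_wtFil

theorem pow_mem_wtRees {i : ℤ} {p : rees k L} (hp : p ∈ wtRees b w i) (n : ℕ) :
    p ^ n ∈ wtRees b w (n * i) := by
  induction n with
  | zero => simpa using one_mem_wtRees
  | succ n ih =>
    rw [pow_succ, show ((n + 1 : ℕ) : ℤ) * i = n * i + i by push_cast; ring]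
    exact mul_mem_wtRees ih hp

theorem t_pow_mem_wtRees (n : ℕ) : t k L ^ n ∈ wtRees b w 0 := by
  simpa using pow_mem_wtRees (b := b) (w := w) t_mem_wtRees n

/-- Multiplication by `t` only shifts coefficients, so division by `t` preserves weight bounds. -/
theorem mem_wtRees_of_t_mul {j : ℤ} {p : rees k L} (h : t k L * p ∈ wtRees b w j) :
    p ∈ wtRees b w j := by
  intro n
  have h1 := h (n + 1)
  change (Polynomial.X * p.1).coeff (n + 1) ∈ _ at h1
  rwa [Polynomial.coeff_X_mul] at h1

theorem mem_wtRees_of_t_pow_mul {j : ℤ} {n : ℕ} {p : rees k L}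
    (h : t k L ^ n * p ∈ wtRees b w j) : p ∈ wtRees b w j := by
  induction n with
  | zero => simpa using h
  | succ n ih =>
    rw [pow_succ', mul_assoc] at h
    exact ih (mem_wtRees_of_t_mul h)

theorem grMap_mem_wtLE {j : ℤ} {p : rees k L} (hp : p ∈ wtRees b w j) :
    grMap b p ∈ wtLE k w j := by
  rw [eq_sum_mono p, map_sum]
  refine Submodule.sum_mem _ fun n _ => ?_
  rw [grMap_mono, sym_apply]
  refine homogeneousComponent_mem_wtLE ?_ n
  have h1 : (1 : MvPolynomial ι k) ∈ wtLE k w 0 :=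
    wtLE_of_isWeightedHomogeneous (isWeightedHomogeneous_one k w)
  simpa using hp n 0 1 h1

variable (b w) in
/-- The elements of the Rees ring of weight exactly `i` modulo `t`. -/
def IsExact (i : ℤ) (s : rees k L) : Prop :=
  s ∈ wtRees b w i ∧ grMap b s ∉ wtLE k w (i - 1)

theorem IsExact.mul {i j : ℤ} {s s' : rees k L} (h : IsExact b w i s) (h' : IsExact b w j s') :
    IsExact b w (i + j) (s * s') := by
  refine ⟨mul_mem_wtRees h.1 h'.1, ?_⟩
  rw [map_mul]
  exact mul_notMem_wtLE (grMap_mem_wtLE h.1) (grMap_mem_wtLE h'.1) h.2 h'.2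

theorem isExact_one : IsExact b w 0 (1 : rees k L) :=
  ⟨one_mem_wtRees, by rw [map_one, zero_sub]; exact one_notMem_wtLE w⟩

theorem IsExact.pow {i : ℤ} {s : rees k L} (h : IsExact b w i s) (n : ℕ) :
    IsExact b w (n * i) (s ^ n) := by
  induction n with
  | zero => simpa using isExact_one
  | succ n ih =>
    rw [pow_succ, show ((n + 1 : ℕ) : ℤ) * i = n * i + i by push_cast; ring]
    exact ih.mul h

theorem IsExact.grMap_ne_zero {i : ℤ} {s : rees k L} (h : IsExact b w i s) : grMap b s ≠ 0 :=
  fun h0 => h.2 (h0 ▸ Submodule.zero_mem _)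

/-- The Ore condition modulo `tⁿ` with control of weights. Moving `s` past `c` costs a commutator `t
c'`, where `c'` has weight `p + q`, and each further factor `s` absorbs one more power of `t`. The
bound on `r` is the one for which `r s` has the weight of `sⁿ c`. -/
theorem exists_ore {p : ℤ} {s : rees k L} (hs : s ∈ wtRees b w p) (n : ℕ) :
    ∀ {q : ℤ} {c : rees k L}, c ∈ wtRees b w q →
      ∃ r ∈ wtRees b w ((n - 1) * p + q), ∃ d, s ^ n * c = r * s + t k L ^ n * d := by
  induction n with
  | zero =>
    intro q c _
    exact ⟨0, Submodule.zero_mem _, c, by simp⟩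
  | succ n ih =>
    intro q c hc
    obtain ⟨c', hc'⟩ := rees_commutator k L s c
    have hc'w : c' ∈ wtRees b w (p + q) := by
      refine mem_wtRees_of_t_mul ?_
      rw [← hc']
      refine Submodule.sub_mem _ (mul_mem_wtRees hs hc) ?_
      rw [add_comm]
      exact mul_mem_wtRees hc hs
    obtain ⟨r, hr, d, hd⟩ := ih hc'w
    refine ⟨s ^ n * c + t k L * r, Submodule.add_mem _ ?_ ?_, d, ?_⟩
    · refine wtRees_mono ?_ (mul_mem_wtRees (pow_mem_wtRees hs n) hc)
      push_cast; linarith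
    · refine wtRees_mono ?_ (mul_mem_wtRees t_mem_wtRees hr)
      push_cast; linarith
    · have e : s * c = c * s + t k L * c' := by rw [← hc']; abel
      rw [pow_succ, mul_assoc, e, mul_add, ← mul_assoc (s ^ n) (t k L), ← t_central,
        mul_assoc (t k L), hd, add_mul, mul_add, pow_succ' (t k L)]
      simp only [mul_assoc, add_assoc]

variable (b w) in
/-- The elements of weight at most `j` of the inverse limit, in a subring where the weight is
defined. -/
def WtCompletion (j : ℤ) (x : completion k L) : Prop :=
  ∀ n, ∃ (i : ℤ) (s a : rees k L), IsExact b w i s ∧ a ∈ wtRees b w (i + j) ∧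
    loc n s * x.1 n = loc n a

theorem wtCompletion_toCompletion {j : ℤ} {p : rees k L} (hp : p ∈ wtRees b w j) :
    WtCompletion b w j (toCompletion k L p) := fun n =>
  ⟨0, 1, p, isExact_one, by rwa [zero_add], by rw [map_one, one_mul, toCompletion_apply]⟩

theorem WtCompletion.smul {j : ℤ} {x : completion k L} (h : WtCompletion b w j x) (c : k) :
    WtCompletion b w j (c • x) := by
  intro n
  obtain ⟨i, s, a, hs, ha, e⟩ := h n
  refine ⟨i, s, c • a, hs, Submodule.smul_mem _ c ha, ?_⟩
  rw [map_smul, ← e]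
  exact mul_smul_comm c _ _

/-- At level `n`, `s'ⁿ a ≡ r s'` modulo `tⁿ` turns `(s⁻¹ a)(s'⁻¹ a')` into `(s'ⁿ s)⁻¹ (r a')`, and
the new denominator is exact as a product of exact elements. -/
theorem WtCompletion.mul {i j : ℤ} {x y : completion k L} (hx : WtCompletion b w i x)
    (hy : WtCompletion b w j y) : WtCompletion b w (i + j) (x * y) := by
  intro n
  obtain ⟨p, s, a, hs, ha, e⟩ := hx n
  obtain ⟨q, s', a', hs', ha', e'⟩ := hy n
  obtain ⟨r, hr, d, hd⟩ := exists_ore hs'.1 n ha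
  refine ⟨n * q + p, s' ^ n * s, r * a', (hs'.pow n).mul hs,
    wtRees_mono ?_ (mul_mem_wtRees hr ha'), ?_⟩
  · linarith
  · change loc n (s' ^ n * s) * (x.1 n * y.1 n) = _
    have h1 : loc n (s' ^ n * a) = loc n (r * s') := by
      rw [hd, map_add, loc_t_pow_mul, add_zero]
    rw [map_mul, mul_assoc, ← mul_assoc (loc n s), e, ← mul_assoc, ← map_mul, h1, map_mul,
      mul_assoc, e', ← map_mul]

/-- The common denominator is `s'ⁿ s ≡ r s'` modulo `tⁿ`. -/
theorem WtCompletion.add {j : ℤ} {x y : completion k L} (hx : WtCompletion b w j x)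
    (hy : WtCompletion b w j y) : WtCompletion b w j (x + y) := by
  intro n
  obtain ⟨p, s, a, hs, ha, e⟩ := hx n
  obtain ⟨q, s', a', hs', ha', e'⟩ := hy n
  obtain ⟨r, hr, d, hd⟩ := exists_ore hs'.1 n hs.1
  refine ⟨n * q + p, s' ^ n * s, s' ^ n * a + r * a', (hs'.pow n).mul hs,
    Submodule.add_mem _ (wtRees_mono ?_ (mul_mem_wtRees (pow_mem_wtRees hs'.1 n) ha))
      (wtRees_mono ?_ (mul_mem_wtRees hr ha')), ?_⟩
  · linarith
  · linarith
  · change loc n (s' ^ n * s) * (x.1 n + y.1 n) = _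
    have h1 : loc n (s' ^ n * s) = loc n (r * s') := by
      rw [hd, map_add, loc_t_pow_mul, add_zero]
    rw [mul_add, map_add]
    congr 1
    · rw [map_mul, mul_assoc, e, ← map_mul]
    · rw [h1, map_mul, mul_assoc, e', ← map_mul]

variable (b w) in
/-- The elements of weight at most `j` of Cohn's division ring, in a subring where the weight is
defined. -/
def WtDiv (j : ℤ) (y : DivRing k L) : Prop :=
  ∃ (m : ℕ) (x : completion k L), WtCompletion b w j x ∧
    reesToDivRing k L (t k L) ^ m * y = completionToDivRing k L x

theorem t_pow_mul_completionToDivRing (m : ℕ) (x : completion k L) :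
    reesToDivRing k L (t k L) ^ m * completionToDivRing k L x =
      completionToDivRing k L (toCompletion k L (t k L ^ m) * x) := by
  rw [map_mul, map_pow, map_pow]; rfl

theorem WtDiv.add {j : ℤ} {y z : DivRing k L} (hy : WtDiv b w j y) (hz : WtDiv b w j z) :
    WtDiv b w j (y + z) := by
  obtain ⟨m, x, hx, e⟩ := hy
  obtain ⟨n, x', hx', e'⟩ := hz
  have ht : ∀ m, WtCompletion b w 0 (toCompletion k L (t k L ^ m)) := fun m =>
    wtCompletion_toCompletion (t_pow_mem_wtRees m)
  refine ⟨n + m, toCompletion k L (t k L ^ n) * x + toCompletion k L (t k L ^ m) * x', ?_, ?_⟩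
  · have h1 := (ht n).mul hx
    have h2 := (ht m).mul hx'
    rw [zero_add] at h1 h2
    exact h1.add h2
  · rw [map_add, ← t_pow_mul_completionToDivRing, ← t_pow_mul_completionToDivRing, ← e, ← e',
      mul_add, ← mul_assoc, ← mul_assoc, ← pow_add, ← pow_add, add_comm m n]

theorem WtDiv.mul {i j : ℤ} {y z : DivRing k L} (hy : WtDiv b w i y) (hz : WtDiv b w j z) :
    WtDiv b w (i + j) (y * z) := by
  obtain ⟨m, x, hx, e⟩ := hy
  obtain ⟨n, x', hx', e'⟩ := hz
  refine ⟨m + n, x * x', hx.mul hx', ?_⟩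
  rw [map_mul, ← e, ← e', pow_add, mul_assoc, mul_assoc, ← mul_assoc _ y,
    ((reesToDivRing_t_central y).pow_left n).eq, mul_assoc]

theorem WtDiv.smul {j : ℤ} {y : DivRing k L} (hy : WtDiv b w j y) (c : k) :
    WtDiv b w j (c • y) := by
  obtain ⟨m, x, hx, e⟩ := hy
  exact ⟨m, c • x, hx.smul c, by rw [map_smul, ← e, mul_smul_comm]⟩

theorem wtDiv_embedding {n : ℕ} {a : UniversalEnvelopingAlgebra k L} (ha : a ∈ filtration k L n)
    {j : ℤ} (h : a ∈ wtFil b w j) : WtDiv b w j (embedding k L a) :=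
  ⟨n, toCompletion k L (mono n a ha), wtCompletion_toCompletion (mono_mem_wtRees ha h), by
    rw [← reesToDivRing_mono]; rfl⟩

theorem wtDiv_zero (j : ℤ) : WtDiv b w j (0 : DivRing k L) := by
  have h := wtDiv_embedding (b := b) (w := w) (Submodule.zero_mem (filtration k L 0))
    (Submodule.zero_mem (wtFil b w j))
  rwa [map_zero] at h

theorem wtDiv_one : WtDiv b w 0 (1 : DivRing k L) := by
  have h := wtDiv_embedding (one_mem_filtration k L 0) (one_mem_wtFil (b := b) (w := w))
  rwa [map_one] at h

/-- The inverse of an element of exact weight `j`. -/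
theorem wtDiv_inv {n : ℕ} {a : UniversalEnvelopingAlgebra k L} (ha : a ∈ filtration k L n)
    {j : ℤ} (h : a ∈ wtFil b w j) (h' : sym b n a ∉ wtLE k w (j - 1)) {y : DivRing k L}
    (hy : embedding k L a * y = 1) : WtDiv b w (-j) y := by
  have hs : IsExact b w j (mono n a ha) := ⟨mono_mem_wtRees ha h, by rwa [grMap_mono]⟩
  obtain ⟨v, hv⟩ := isUnit_toCompletion b hs.grMap_ne_zero
  have e1 : completionToDivRing k L (v : completion k L) =
      reesToDivRing k L (t k L) ^ n * embedding k L a := by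
    rw [hv, ← reesToDivRing_mono]; rfl
  have hc : ∀ x : completion k L, Commute (toCompletion k L (t k L ^ n)) x := fun x => by
    rw [map_pow]
    exact (show Commute _ x from toCompletion_t_central k L x).pow_left n
  -- The inverse of `a` is `tⁿ (a tⁿ)⁻¹`. At every level it has the denominator `a tⁿ` of exact
  -- weight `j` and the numerator `tⁿ` of weight `0`.
  refine ⟨0, toCompletion k L (t k L ^ n) * ↑v⁻¹, fun m => ?_, ?_⟩
  · refine ⟨j, mono n a ha, t k L ^ n, hs, ?_, ?_⟩
    · rw [add_neg_cancel]; exact t_pow_mem_wtRees n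
    · have : toCompletion k L (mono n a ha) * (toCompletion k L (t k L ^ n) * ↑v⁻¹) =
          toCompletion k L (t k L ^ n) := by
        rw [← mul_assoc, ← (hc _).eq, ← hv, mul_assoc, Units.mul_inv, mul_one]
      exact congrFun (congrArg Subtype.val this) m
  · rw [pow_zero, one_mul, (hc _).eq, map_mul]
    have h2 : completionToDivRing k L (toCompletion k L (t k L ^ n)) =
        completionToDivRing k L (v : completion k L) * y := by
      rw [e1, mul_assoc, hy, mul_one, ← map_pow]; rfl
    rw [h2, ← mul_assoc, ← map_mul, Units.inv_mul, map_one, one_mul]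

/-- If `1` had negative weight, some `tᵐ` would equal `s⁻¹ a` with `a` of smaller weight than `s`.
Cancelling `tᵐ` shows that `s` is congruent modulo `t` to an element of smaller weight, against the
exactness of `s`. -/
theorem not_wtDiv_one : ¬ WtDiv b w (-1) (1 : DivRing k L) := by
  rintro ⟨m, x, hx, e⟩
  have e1 : completionToDivRing k L (toCompletion k L (t k L ^ m)) = completionToDivRing k L x := by
    rw [← e, mul_one, ← map_pow]; rfl
  have e2 := completionToDivRing_injective b e1
  -- At level `m + 1`, cancelling `tᵐ` leaves a congruence modulo `t`.
  obtain ⟨i, s, a, hs, ha, h⟩ := hx (m + 1)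
  rw [← e2, toCompletion_apply, ← map_mul, ← sub_eq_zero, ← map_sub] at h
  obtain ⟨c, hc⟩ := loc_eq_zero b h
  have h1 : t k L ^ m * (s - t k L * c) = a := by
    rw [mul_sub, ← mul_assoc, ← pow_succ, ← hc, t_pow_central]; abel
  have h2 : s - t k L * c ∈ wtRees b w (i - 1) :=
    mem_wtRees_of_t_pow_mul (n := m) (by rw [h1]; exact ha)
  have h3 := grMap_mem_wtLE h2
  rw [map_sub, map_mul, grMap_t, zero_mul, sub_zero] at h3
  exact hs.2 h3

/-! ### The degree zero part of the graded ring given by the weights -/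

variable (b w) in
/-- The subalgebra of the elements of weight at most zero. -/
def wtZero : Subalgebra k (DivRing k L) where
  carrier := {y | WtDiv b w 0 y}
  mul_mem' := by
    intro x y hx hy
    have h : WtDiv b w (0 + 0) (x * y) := WtDiv.mul hx hy
    rwa [add_zero] at h
  add_mem' := fun hx hy => hx.add hy
  algebraMap_mem' := by
    intro c
    rw [Algebra.algebraMap_eq_smul_one]
    exact wtDiv_one.smul c

variable (b w) in
/-- The ideal of the elements of negative weight. -/
def wtNeg : Ideal (wtZero b w) where
  carrier := {y | WtDiv b w (-1) y.1}
  add_mem' := fun hx hy => hx.add hy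
  zero_mem' := wtDiv_zero _
  smul_mem' := by
    intro c x hx
    have h : WtDiv b w (0 + -1) (c.1 * x.1) := WtDiv.mul c.2 hx
    rwa [zero_add] at h

instance : (wtNeg b w).IsTwoSided where
  mul_mem_of_left c hx := by
    have h : WtDiv b w (-1 + 0) (_ * c.1) := WtDiv.mul hx c.2
    rwa [add_zero] at h

variable (b w) in
/-- The quotient of the elements of weight at most zero by those of negative weight. -/
def WtGr : Type _ := wtZero b w ⧸ wtNeg b w

instance : Ring (WtGr b w) := inferInstanceAs (Ring (wtZero b w ⧸ wtNeg b w))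

instance : Algebra k (WtGr b w) := inferInstanceAs (Algebra k (wtZero b w ⧸ wtNeg b w))

variable (b w) in
/-- The quotient map. -/
def toWtGr : wtZero b w →ₐ[k] WtGr b w := Ideal.Quotient.mkₐ k (wtNeg b w)

theorem toWtGr_eq_iff {x y : wtZero b w} :
    toWtGr b w x = toWtGr b w y ↔ WtDiv b w (-1) (x.1 - y.1) := by
  rw [← sub_eq_zero, ← map_sub]
  exact Ideal.Quotient.eq_zero_iff_mem

instance : Nontrivial (WtGr b w) :=
  ⟨⟨toWtGr b w 1, toWtGr b w 0, fun h => not_wtDiv_one (by simpa using toWtGr_eq_iff.1 h)⟩⟩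

end Cohn

end

noncomputable section

open Polynomial

/-! ### The shift of the field of rational functions -/

namespace Shift

variable {k : Type*} [Field k]

/-- The automorphism `X ↦ X - 1` of the field of rational functions. -/
def shift (k : Type*) [Field k] : FractionRing k[X] →+* FractionRing k[X] :=
  IsFractionRing.lift (A := k[X])
    (g := (algebraMap k[X] (FractionRing k[X])).comp (taylorAlgHom (-1 : k)).toRingHom)
    ((IsFractionRing.injective k[X] (FractionRing k[X])).comp (taylor_injective (-1 : k)))

theorem shift_algebraMap (p : k[X]) :
    shift k (algebraMap k[X] _ p) = algebraMap k[X] _ (taylor (-1) p) :=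
  IsFractionRing.lift_algebraMap _ p

theorem shift_C (c : k) : shift k (algebraMap k _ c) = algebraMap k _ c := by
  rw [IsScalarTower.algebraMap_apply k k[X] (FractionRing k[X]), shift_algebraMap,
    Polynomial.algebraMap_eq, taylor_C]

/-- The rational function `f` is regular at `a` with value `c`. -/
def HasVal (a : k) (f : FractionRing k[X]) (c : k) : Prop :=
  ∃ p q : k[X], q.eval a ≠ 0 ∧ f * algebraMap k[X] _ q = algebraMap k[X] _ p ∧
    p.eval a = c * q.eval a

theorem HasVal.unique {a : k} {f : FractionRing k[X]} {c d : k} (h : HasVal a f c)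
    (h' : HasVal a f d) : c = d := by
  obtain ⟨p, q, hq, e, hp⟩ := h
  obtain ⟨p', q', hq', e', hp'⟩ := h'
  have h1 : algebraMap k[X] (FractionRing k[X]) (p * q') = algebraMap k[X] _ (p' * q) := by
    rw [map_mul, map_mul, ← e, ← e']; ring
  have h2 := congrArg (eval a) (IsFractionRing.injective k[X] (FractionRing k[X]) h1)
  rw [eval_mul, eval_mul, hp, hp'] at h2
  have h3 : (c - d) * (q.eval a * q'.eval a) = 0 := by linear_combination h2
  rcases mul_eq_zero.1 h3 with h4 | h4
  · exact sub_eq_zero.1 h4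
  · exact absurd h4 (mul_ne_zero hq hq')

theorem HasVal.add {a : k} {f g : FractionRing k[X]} {c d : k} (h : HasVal a f c)
    (h' : HasVal a g d) : HasVal a (f + g) (c + d) := by
  obtain ⟨p, q, hq, e, hp⟩ := h
  obtain ⟨p', q', hq', e', hp'⟩ := h'
  refine ⟨p * q' + p' * q, q * q', by rw [eval_mul]; exact mul_ne_zero hq hq', ?_, ?_⟩
  · rw [map_add, map_mul, map_mul, map_mul, ← e, ← e']; ring
  · rw [eval_add, eval_mul, eval_mul, eval_mul, hp, hp']; ring

theorem HasVal.mul {a : k} {f g : FractionRing k[X]} {c d : k} (h : HasVal a f c)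
    (h' : HasVal a g d) : HasVal a (f * g) (c * d) := by
  obtain ⟨p, q, hq, e, hp⟩ := h
  obtain ⟨p', q', hq', e', hp'⟩ := h'
  refine ⟨p * p', q * q', by rw [eval_mul]; exact mul_ne_zero hq hq', ?_, ?_⟩
  · rw [map_mul, map_mul, ← e, ← e']; ring
  · rw [eval_mul, eval_mul, hp, hp']; ring

theorem hasVal_polynomial (a : k) (p : k[X]) : HasVal a (algebraMap k[X] _ p) (p.eval a) :=
  ⟨p, 1, by simp, by simp, by simp⟩

theorem hasVal_C (a c : k) : HasVal a (algebraMap k (FractionRing k[X]) c) c := by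
  rw [IsScalarTower.algebraMap_apply k k[X] (FractionRing k[X])]
  simpa using hasVal_polynomial a (C c)

theorem hasVal_zero (a : k) : HasVal a 0 0 := by simpa using hasVal_C a 0

theorem hasVal_one (a : k) : HasVal a 1 1 := by simpa using hasVal_C a 1

theorem HasVal.neg {a : k} {f : FractionRing k[X]} {c : k} (h : HasVal a f c) :
    HasVal a (-f) (-c) := by
  simpa using (hasVal_C a (-1)).mul h

theorem HasVal.sub {a : k} {f g : FractionRing k[X]} {c d : k} (h : HasVal a f c)
    (h' : HasVal a g d) : HasVal a (f - g) (c - d) := by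
  rw [sub_eq_add_neg, sub_eq_add_neg]
  exact h.add h'.neg

theorem HasVal.pow {a : k} {f : FractionRing k[X]} {c : k} (h : HasVal a f c) (n : ℕ) :
    HasVal a (f ^ n) (c ^ n) := by
  induction n with
  | zero => simpa using hasVal_one a
  | succ n ih => rw [pow_succ, pow_succ]; exact ih.mul h

theorem HasVal.inv {a : k} {f : FractionRing k[X]} {c : k} (h : HasVal a f c) (hc : c ≠ 0) :
    HasVal a f⁻¹ c⁻¹ := by
  obtain ⟨p, q, hq, e, hp⟩ := h
  have hp0 : p.eval a ≠ 0 := by rw [hp]; exact mul_ne_zero hc hq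
  refine ⟨q, p, hp0, ?_, ?_⟩
  · have hf : f ≠ 0 := by
      rintro rfl
      rw [zero_mul] at e
      have : p = 0 := IsFractionRing.injective k[X] (FractionRing k[X]) (by rw [← e, map_zero])
      rw [this, eval_zero] at hp0
      exact hp0 rfl
    rw [← e, inv_mul_cancel_left₀ hf]
  · rw [hp, inv_mul_cancel_left₀ hc]

theorem HasVal.zpow {a : k} {f : FractionRing k[X]} {c : k} (h : HasVal a f c) (hc : c ≠ 0)
    (n : ℤ) : HasVal a (f ^ n) (c ^ n) := by
  cases n with
  | ofNat n => simpa using h.pow n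
  | negSucc n =>
    rw [zpow_negSucc, zpow_negSucc]
    exact (h.pow _).inv (pow_ne_zero _ hc)

theorem hasVal_sum {ι : Type*} {a : k} (s : Finset ι) {f : ι → FractionRing k[X]} {c : ι → k}
    (h : ∀ i ∈ s, HasVal a (f i) (c i)) : HasVal a (∑ i ∈ s, f i) (∑ i ∈ s, c i) := by
  classical
  induction s using Finset.induction_on with
  | empty => simpa using hasVal_zero a
  | insert i s hi ih =>
    rw [Finset.sum_insert hi, Finset.sum_insert hi]
    exact (h i (Finset.mem_insert_self i s)).add
      (ih fun j hj => h j (Finset.mem_insert_of_mem hj))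

theorem taylor_neg_one_eval (p : k[X]) (a : k) : (taylor (-1) p).eval (a + 1) = p.eval a := by
  rw [taylor_eval]; congr 1; ring

theorem HasVal.shift {a : k} {f : FractionRing k[X]} {c : k} (h : HasVal a f c) :
    HasVal (a + 1) (shift k f) c := by
  obtain ⟨p, q, hq, e, hp⟩ := h
  refine ⟨taylor (-1) p, taylor (-1) q, by rwa [taylor_neg_one_eval], ?_, ?_⟩
  · rw [← shift_algebraMap, ← shift_algebraMap, ← e, map_mul]
  · rw [taylor_neg_one_eval, taylor_neg_one_eval, hp]

theorem shift_inv_of_fraction (f : FractionRing k[X]) : ∃ p q : k[X], q ≠ 0 ∧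
    f * algebraMap k[X] _ q = algebraMap k[X] _ p := by
  obtain ⟨p, q, hq, rfl⟩ := IsFractionRing.div_surjective (A := k[X]) f
  have hq0 : q ≠ 0 := nonZeroDivisors.ne_zero hq
  exact ⟨p, q, hq0, div_mul_cancel₀ _
    (by rwa [Ne, IsFractionRing.to_map_eq_zero_iff])⟩

theorem HasVal.of_shift {a : k} {f : FractionRing k[X]} {c : k}
    (h : HasVal (a + 1) (Shift.shift k f) c) : HasVal a f c := by
  obtain ⟨p, q, hq, e, hp⟩ := h
  have hT : ∀ p : k[X], taylor (-1 : k) (taylor 1 p) = p := fun p => by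
    rw [taylor_taylor]; simp
  refine ⟨taylor 1 p, taylor 1 q, by rwa [taylor_eval], ?_, by rw [taylor_eval, taylor_eval, hp]⟩
  refine (Shift.shift k).injective ?_
  rw [map_mul, shift_algebraMap, shift_algebraMap, hT, hT, e]

theorem exists_hasVal_of_eval_ne_zero {f : FractionRing k[X]} {p q : k[X]}
    (e : f * algebraMap k[X] _ q = algebraMap k[X] _ p) {a : k} (ha : q.eval a ≠ 0) :
    HasVal a f (p.eval a / q.eval a) :=
  ⟨p, q, ha, e, (div_mul_cancel₀ _ ha).symm⟩

variable [CharZero k]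

theorem finite_poles (f : FractionRing k[X]) (a : k) :
    {j : ℤ | ¬ ∃ c, HasVal (a + j) f c}.Finite := by
  classical
  obtain ⟨p, q, hq, e⟩ := shift_inv_of_fraction f
  have hinj : Function.Injective fun j : ℤ => a + (j : k) := fun i j h => by simpa using h
  refine ((q.roots.toFinset.finite_toSet).preimage hinj.injOn).subset fun j hj => ?_
  simp only [Set.mem_preimage, Finset.mem_coe, Multiset.mem_toFinset, mem_roots hq, IsRoot]
  by_contra h
  exact hj ⟨_, exists_hasVal_of_eval_ne_zero e h⟩

/-- A rational function of the form `g + shift g` does not have exactly one pole in an orbit of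
the shift. -/
theorem exists_hasVal_of_eq_add_shift {g h : FractionRing k[X]} (hg : g + shift k g = h) (a : k)
    (hreg : ∀ j : ℤ, j ≠ 0 → ∃ c, HasVal (a + j) h c) : ∃ c, HasVal a h c := by
  have hfin := finite_poles g a
  have hshift : ∀ j : ℤ, (∃ c, HasVal (a + (j : k)) g c) ↔
      ∃ c, HasVal (a + ((j + 1 : ℤ) : k)) (shift k g) c := by
    intro j
    have : a + ((j + 1 : ℤ) : k) = a + j + 1 := by push_cast; ring
    rw [this]
    exact ⟨fun ⟨c, hc⟩ => ⟨c, hc.shift⟩, fun ⟨c, hc⟩ => ⟨c, hc.of_shift⟩⟩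
  by_cases hne : hfin.toFinset.Nonempty
  · exfalso
    have hmem : ∀ j, j ∈ hfin.toFinset ↔ ¬ ∃ c, HasVal (a + (j : k)) g c := by simp
    have hmin := Finset.min'_mem _ hne
    have hmax := Finset.max'_mem _ hne
    set m := hfin.toFinset.min' hne
    set M := hfin.toFinset.max' hne
    have hmM : m ≤ M := Finset.min'_le _ _ hmax
    have h1 : ∃ c, HasVal (a + ((m - 1 : ℤ) : k)) g c := by
      by_contra hc
      have := Finset.min'_le _ _ ((hmem _).2 hc)
      change m ≤ m - 1 at this
      omega
    have h2 : ∃ c, HasVal (a + ((M + 1 : ℤ) : k)) g c := by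
      by_contra hc
      have := Finset.le_max' _ _ ((hmem _).2 hc)
      change M + 1 ≤ M at this
      omega
    -- At the first pole `a + m` of `g` in the orbit, `shift g` is regular, because its value there
    -- comes from `a + m - 1`. So `h` has a pole there.
    have hm0 : m = 0 := by
      by_contra hm
      obtain ⟨c, hc⟩ := hreg m hm
      obtain ⟨d, hd⟩ := (hshift _).1 h1
      rw [sub_add_cancel] at hd
      refine (hmem m).1 hmin ⟨c - d, ?_⟩
      have := hc.sub hd
      rwa [← hg, add_sub_cancel_right] at this
    -- One step after the last pole of `g`, only `shift g` has a pole. This gives `M = -1 < 0 = m`,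
    -- a contradiction.
    have hM0 : M + 1 = 0 := by
      by_contra hm
      obtain ⟨c, hc⟩ := hreg _ hm
      obtain ⟨d, hd⟩ := h2
      refine (hmem M).1 hmax ((hshift _).2 ⟨c - d, ?_⟩)
      have := hc.sub hd
      rwa [← hg, add_sub_cancel_left] at this
    omega
  · have hall : ∀ j : ℤ, ∃ c, HasVal (a + (j : k)) g c := by
      intro j
      by_contra hc
      exact hne ⟨j, by simpa using hc⟩
    obtain ⟨c, hc⟩ := hall 0
    obtain ⟨d, hd⟩ := (hshift (-1)).1 (hall (-1))
    refine ⟨c + d, ?_⟩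
    have := hc.add (by simpa using hd : HasVal (a + ((0 : ℤ) : k)) _ d)
    simpa [hg] using this

omit [CharZero k] in
/-- A Laurent polynomial in a function with a zero at `a` that is regular at `a` has no terms of
negative exponent. -/
theorem coeff_eq_zero_of_hasVal {a : k} {v : FractionRing k[X]} (hv : HasVal a v 0) (hv0 : v ≠ 0)
    (s : Finset ℤ) (c : ℤ → k) {d : k}
    (h : HasVal a (∑ n ∈ s, algebraMap k _ (c n) * v ^ n) d) :
    ∀ n ∈ s, n < 0 → c n = 0 := by
  classical
  intro n hn hneg
  by_contra hcn
  have hne : (s.filter fun n => c n ≠ 0).Nonempty := ⟨n, Finset.mem_filter.2 ⟨hn, hcn⟩⟩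
  have hmem := Finset.min'_mem _ hne
  have hle : ∀ m ∈ s, c m ≠ 0 → (s.filter fun n => c n ≠ 0).min' hne ≤ m := fun m hm hcm =>
    Finset.min'_le _ _ (Finset.mem_filter.2 ⟨hm, hcm⟩)
  set N := (s.filter fun n => c n ≠ 0).min' hne
  have hN : N < 0 := (hle n hn hcn).trans_lt hneg
  obtain ⟨r, hr⟩ : ∃ r : ℕ, N = -(r + 1 : ℕ) := ⟨(-N - 1).toNat, by omega⟩
  -- Multiplying by `v ^ (-N)`, with `N` the lowest exponent present, gives value `0` at `a` because
  -- the sum is regular there. Computed term by term, the value is `c N`.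
  have h1 := (hv.pow (r + 1)).mul h
  rw [Finset.mul_sum, zero_pow (Nat.succ_ne_zero r), zero_mul] at h1
  have h2 : HasVal a (∑ n ∈ s, v ^ (r + 1) * (algebraMap k _ (c n) * v ^ n))
      (∑ n ∈ s, if n = N then c n else 0) := by
    refine hasVal_sum s fun m hm => ?_
    by_cases hcm : c m = 0
    · rw [hcm]
      simpa using hasVal_zero a
    · obtain ⟨i, hi⟩ : ∃ i : ℕ, m = N + i := ⟨(m - N).toNat, by have := hle m hm hcm; omega⟩
      have e : v ^ (r + 1) * (algebraMap k _ (c m) * v ^ m) = algebraMap k _ (c m) * v ^ i := by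
        have : v ^ m = (v ^ (r + 1))⁻¹ * v ^ i := by
          rw [hi, zpow_add₀ hv0, hr, zpow_neg, zpow_natCast, zpow_natCast]
        rw [this]
        field_simp
      rw [e]
      have := (hasVal_C a (c m)).mul (hv.pow i)
      split_ifs with hmN
      · have hi0 : i = 0 := by omega
        subst hi0
        simpa using this
      · have hi0 : i ≠ 0 := by omega
        simpa [hi0] using this
  have h3 := h1.unique h2
  rw [Finset.sum_ite_eq' s N c, if_pos (Finset.mem_filter.1 hmem).1] at h3
  exact (Finset.mem_filter.1 hmem).2 h3.symm

/-- The rational function `X / (X - 1/2)`. -/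
def ratio (k : Type*) [Field k] : FractionRing k[X] :=
  algebraMap k[X] _ X * (algebraMap k[X] _ (X - C (1 / 2)))⁻¹

omit [CharZero k] in
theorem hasVal_ratio {a : k} (ha : a ≠ 1 / 2) : HasVal a (ratio k) (a * (a - 1 / 2)⁻¹) := by
  have h := (hasVal_polynomial a (X : k[X])).mul
    ((hasVal_polynomial a (X - C (1 / 2))).inv (by simpa [sub_eq_zero] using ha))
  rw [ratio]
  simpa using h

theorem hasVal_ratio_inv : HasVal (1 / 2 : k) (ratio k)⁻¹ 0 := by
  have h := (hasVal_polynomial (1 / 2 : k) (X - C (1 / 2))).mul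
    ((hasVal_polynomial (1 / 2 : k) X).inv (by simp))
  rw [ratio, mul_inv, inv_inv, mul_comm]
  simpa using h

omit [CharZero k] in
theorem ratio_ne_zero : ratio k ≠ 0 := by
  have h1 : (X - C (1 / 2) : k[X]) ≠ 0 := X_sub_C_ne_zero _
  refine mul_ne_zero ?_ (inv_ne_zero ?_)
  · rw [Ne, IsFractionRing.to_map_eq_zero_iff]; exact X_ne_zero
  · rwa [Ne, IsFractionRing.to_map_eq_zero_iff]

omit [CharZero k] in
theorem exists_hasVal_sum_ratio {a : k} (h0 : a ≠ 0) (h1 : a ≠ 1 / 2) (s : Finset ℤ) (c : ℤ → k) :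
    ∃ d, HasVal a (∑ n ∈ s, algebraMap k _ (c n) * ratio k ^ n) d :=
  ⟨_, hasVal_sum s fun n _ => (hasVal_C a (c n)).mul ((hasVal_ratio h1).zpow
    (mul_ne_zero h0 (inv_ne_zero (sub_ne_zero.2 h1))) n)⟩

/-- Negative powers of `ratio` have a pole at its zero `0`, positive powers at its pole `1/2`. -/
theorem coeff_eq_zero_of_regular (s : Finset ℤ) (c : ℤ → k)
    (h0 : ∃ d, HasVal 0 (∑ n ∈ s, algebraMap k _ (c n) * ratio k ^ n) d)
    (h1 : ∃ d, HasVal (1 / 2) (∑ n ∈ s, algebraMap k _ (c n) * ratio k ^ n) d) :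
    ∀ n ∈ s, n ≠ 0 → c n = 0 := by
  classical
  intro n hn hn0
  rcases lt_or_gt_of_ne hn0 with hneg | hpos
  · obtain ⟨d, hd⟩ := h0
    have hv : HasVal (0 : k) (ratio k) 0 := by
      simpa using hasVal_ratio (a := (0 : k)) (by norm_num)
    exact coeff_eq_zero_of_hasVal hv ratio_ne_zero s c hd n hn hneg
  · obtain ⟨d, hd⟩ := h1
    have e : ∑ n ∈ s, algebraMap k (FractionRing k[X]) (c n) * ratio k ^ n =
        ∑ n ∈ s.image Neg.neg, algebraMap k _ (c (-n)) * (ratio k)⁻¹ ^ n := by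
      rw [Finset.sum_image (fun _ _ _ _ h => neg_injective h)]
      refine Finset.sum_congr rfl fun n _ => ?_
      rw [neg_neg, inv_zpow', neg_neg]
    rw [e] at hd
    have := coeff_eq_zero_of_hasVal hasVal_ratio_inv (inv_ne_zero ratio_ne_zero) _
      (fun n => c (-n)) hd (-n) (Finset.mem_image_of_mem _ hn) (by omega)
    simpa using this

/-- The points `0` and `1/2` lie in different orbits of the shift, since `1/2` is not an integer in
characteristic zero. A pole of the sum at either would be the only one in its orbit, which
`exists_hasVal_of_eq_add_shift` excludes. -/
theorem coeff_eq_zero_of_eq_add_shift (s : Finset ℤ) (c : ℤ → k) {g : FractionRing k[X]}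
    (hg : g + shift k g = ∑ n ∈ s, algebraMap k _ (c n) * ratio k ^ n) :
    ∀ n ∈ s, n ≠ 0 → c n = 0 := by
  have key : ∀ j : ℤ, (j : k) ≠ 1 / 2 := by
    intro j h
    have h2 : ((2 * j : ℤ) : k) = (1 : ℤ) := by push_cast; rw [h]; norm_num
    have := Int.cast_injective h2
    omega
  refine coeff_eq_zero_of_regular s c ?_ ?_
  · refine exists_hasVal_of_eq_add_shift hg 0 fun j hj => ?_
    rw [zero_add]
    exact exists_hasVal_sum_ratio (by exact_mod_cast hj) (key j) s c
  · refine exists_hasVal_of_eq_add_shift hg (1 / 2) fun j hj =>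
      exists_hasVal_sum_ratio (fun h => key (-j) ?_) (fun h => hj ?_) s c
    · push_cast; linear_combination -h
    · simpa using h

theorem coeff_eq_zero_of_sum_eq_zero (s : Finset ℤ) (c : ℤ → k)
    (h : ∑ n ∈ s, algebraMap k (FractionRing k[X]) (c n) * ratio k ^ n = 0) :
    ∀ n ∈ s, c n = 0 := by
  have h1 := coeff_eq_zero_of_regular s c ⟨0, h ▸ hasVal_zero _⟩ ⟨0, h ▸ hasVal_zero _⟩
  intro n hn
  by_cases hn0 : n = 0
  · subst hn0
    rw [Finset.sum_eq_single_of_mem 0 hn fun m hm hm0 => by rw [h1 m hm hm0]; simp] at h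
    simpa using h
  · exact h1 n hn hn0

/-- The values of `f` at large integers satisfy `f (a + 1) = ε f a`, hence have period two. So `f`
takes one value at infinitely many points and is constant. -/
theorem exists_eq_algebraMap_of_shift {f : FractionRing k[X]} {ε : k} (hε : ε * ε = 1)
    (h : shift k f = algebraMap k _ ε * f) : ∃ c, f = algebraMap k _ c ∧ c = ε * c := by
  obtain ⟨p, q, hq, e⟩ := shift_inv_of_fraction f
  obtain ⟨N, hN⟩ : ∃ N : ℕ, ∀ j : ℕ, q.eval ((N + j : ℕ) : k) ≠ 0 := by
    classical
    have hfin : {j : ℕ | q.eval (j : k) = 0}.Finite := by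
      refine ((q.roots.toFinset.finite_toSet).preimage
        (Nat.cast_injective (R := k)).injOn).subset fun j hj => ?_
      simpa [mem_roots hq, IsRoot] using hj
    obtain ⟨N, hN⟩ := hfin.bddAbove
    refine ⟨N + 1, fun j hj => ?_⟩
    have := hN (show N + 1 + j ∈ _ from hj)
    omega
  have hval := fun j => exists_hasVal_of_eval_ne_zero e (hN j)
  set v : ℕ → k := fun j => p.eval ((N + j : ℕ) : k) / q.eval ((N + j : ℕ) : k)
  have hv : ∀ j, v (j + 1) = ε * v j := by
    intro j
    have h1 := (hval j).shift
    have e1 : ((N + j : ℕ) : k) + 1 = ((N + (j + 1) : ℕ) : k) := by push_cast; ring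
    rw [e1, h] at h1
    have h2 := ((hasVal_C _ ε).mul (hval (j + 1))).unique h1
    calc v (j + 1) = ε * ε * v (j + 1) := by rw [hε, one_mul]
      _ = ε * (ε * v (j + 1)) := by ring
      _ = ε * v j := by rw [h2]
  have hv2 : ∀ j, v (2 * j) = v 0 := by
    intro j
    induction j with
    | zero => rfl
    | succ j ih =>
      rw [show 2 * (j + 1) = 2 * j + 1 + 1 by ring, hv, hv, ih, ← mul_assoc, hε, one_mul]
  have hpq : p - C (v 0) * q = 0 := by
    refine Polynomial.eq_zero_of_infinite_isRoot _ (Set.infinite_of_injective_forall_mem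
      (f := fun j : ℕ => ((N + 2 * j : ℕ) : k)) (fun i j hij => ?_) fun j => ?_)
    · have := Nat.cast_injective hij
      omega
    · simp only [Set.mem_ofPred_eq, IsRoot, eval_sub, eval_mul, eval_C]
      rw [← hv2 j]
      simp only [v]
      rw [div_mul_cancel₀ _ (hN _), sub_self]
  have hf : f = algebraMap k _ (v 0) := by
    have hq' : algebraMap k[X] (FractionRing k[X]) q ≠ 0 := by
      rwa [Ne, IsFractionRing.to_map_eq_zero_iff]
    refine mul_right_cancel₀ hq' ?_
    rw [e, sub_eq_zero.1 hpq, map_mul, IsScalarTower.algebraMap_apply k k[X] (FractionRing k[X]),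
      Polynomial.algebraMap_eq]
  refine ⟨v 0, hf, ?_⟩
  rw [hf, shift_C, ← map_mul] at h
  exact (algebraMap k (FractionRing k[X])).injective h

omit [CharZero k] in
theorem shift_X : shift k (algebraMap k[X] _ X) = algebraMap k[X] _ X - 1 := by
  rw [shift_algebraMap, taylor_X, map_add, map_neg, map_neg, ← sub_eq_add_neg]; simp

end Shift

end

noncomputable section

open Polynomial

namespace Shift

/-! ### Eigenvectors of a semilinear map -/

/-- Let `T` be a semilinear map that preserves a submodule `N`. For eigenvectors of `T` modulo `N`
with eigenvalues `±1`, linear independence modulo `N` can be tested on relations that have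
coefficients in the fixed field and involve one eigenvalue only. -/
theorem eq_zero_of_eigenvectors {K M W : Type*} [Field K] [AddCommGroup M] [Module K M]
    {σ : K →+* K} (F : Set K) (hF : ∀ f, σ f = f → f ∈ F) (hneg : ∀ f, σ f = -f → f = 0)
    (T : M →+ M) (hT : ∀ (f : K) (x : M), T (f • x) = σ f • T x) (N : Submodule K M)
    (hTN : ∀ x ∈ N, T x ∈ N) (ε : Bool → K) (hε : ∀ δ, ε δ * ε δ = 1)
    (hε' : ∀ δ δ', δ ≠ δ' → ε δ = -ε δ')
    (e : Bool → W → M) (he : ∀ δ w, T (e δ w) - ε δ • e δ w ∈ N)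
    (h : ∀ δ (s : Finset W) (f : W → K), (∀ w ∈ s, f w ∈ F) → ∑ w ∈ s, f w • e δ w ∈ N →
      ∀ w ∈ s, f w = 0)
    (s : Finset (Bool × W)) (f : Bool × W → K) (hs : ∑ i ∈ s, f i • e i.1 i.2 ∈ N) :
    ∀ i ∈ s, f i = 0 := by
  classical
  induction s using Finset.strongInduction generalizing f with
  | H s ih =>
    by_contra! hcon
    obtain ⟨i₀, hi₀, hf₀⟩ := hcon
    -- The coefficient at `i₀` is normalized to `1`, which every ring endomorphism fixes.
    set f₁ : Bool × W → K := fun i => (f i₀)⁻¹ * f i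
    have h₁ : ∑ i ∈ s, f₁ i • e i.1 i.2 ∈ N := by
      have := Submodule.smul_mem N (f i₀)⁻¹ hs
      rw [Finset.smul_sum] at this
      simpa only [smul_smul] using this
    have h₁₀ : f₁ i₀ = 1 := inv_mul_cancel₀ hf₀
    -- Applying `T - ε i₀` gives a relation modulo `N` without the term `i₀`, so all its
    -- coefficients vanish by induction.
    set g : Bool × W → K := fun i => σ (f₁ i) * ε i.1 - ε i₀.1 * f₁ i
    have hg : ∑ i ∈ s, g i • e i.1 i.2 ∈ N := by
      have e1 : ∑ i ∈ s, g i • e i.1 i.2 = T (∑ i ∈ s, f₁ i • e i.1 i.2) -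
          ε i₀.1 • ∑ i ∈ s, f₁ i • e i.1 i.2 -
          ∑ i ∈ s, σ (f₁ i) • (T (e i.1 i.2) - ε i.1 • e i.1 i.2) := by
        rw [map_sum, Finset.smul_sum, ← Finset.sum_sub_distrib, ← Finset.sum_sub_distrib]
        refine Finset.sum_congr rfl fun i _ => ?_
        rw [hT, smul_sub, smul_smul, smul_smul, sub_smul]
        abel
      rw [e1]
      refine Submodule.sub_mem _ (Submodule.sub_mem _ (hTN _ h₁) (Submodule.smul_mem _ _ h₁)) ?_
      exact Submodule.sum_mem _ fun i _ => Submodule.smul_mem _ _ (he i.1 i.2)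
    have hg₀ : g i₀ = 0 := by simp only [g, h₁₀, map_one]; ring
    rw [← Finset.sum_erase s (by rw [hg₀, zero_smul] : g i₀ • e i₀.1 i₀.2 = 0)] at hg
    have hgs := ih _ (Finset.erase_ssubset hi₀) g hg
    have hgz : ∀ i ∈ s, σ (f₁ i) * ε i.1 = ε i₀.1 * f₁ i := by
      intro i hi
      by_cases hii : i = i₀
      · rw [hii]; exact sub_eq_zero.1 hg₀
      · exact sub_eq_zero.1 (hgs i (Finset.mem_erase.2 ⟨hii, hi⟩))
    -- Terms with the opposite eigenvalue satisfy `σ f = -f` and drop out; the remaining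
    -- coefficients are fixed by `σ`.
    have hzero : ∀ i ∈ s, i.1 ≠ i₀.1 → f₁ i = 0 := by
      intro i hi hne
      apply hneg
      have h2 := hgz i hi
      rw [hε' _ _ (Ne.symm hne)] at h2
      have h3 : ε i.1 * (σ (f₁ i) + f₁ i) = 0 := by linear_combination h2
      have h4 : ε i.1 ≠ 0 := left_ne_zero_of_mul (by rw [hε]; exact one_ne_zero)
      exact eq_neg_of_add_eq_zero_left ((mul_eq_zero.1 h3).resolve_left h4)
    have hfix : ∀ i ∈ s, i.1 = i₀.1 → f₁ i ∈ F := by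
      intro i hi heq
      apply hF
      have h2 := hgz i hi
      rw [heq] at h2
      have h4 : ε i₀.1 ≠ 0 := left_ne_zero_of_mul (by rw [hε]; exact one_ne_zero)
      exact mul_left_cancel₀ h4 (by rw [← h2, mul_comm])
    have hsum : ∑ i ∈ s, f₁ i • e i.1 i.2 =
        ∑ w ∈ (s.filter fun i => i.1 = i₀.1).image Prod.snd, f₁ (i₀.1, w) • e i₀.1 w := by
      rw [Finset.sum_image, ← Finset.sum_filter_add_sum_filter_not s (fun i => i.1 = i₀.1),
        Finset.sum_eq_zero (s := s.filter fun i => ¬ i.1 = i₀.1), add_zero]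
      · refine Finset.sum_congr rfl fun i hi => ?_
        rw [← (Finset.mem_filter.1 hi).2]
      · intro i hi
        rw [hzero i (Finset.mem_filter.1 hi).1 (Finset.mem_filter.1 hi).2, zero_smul]
      · intro i hi j hj hij
        refine Prod.ext ?_ hij
        rw [(Finset.mem_filter.1 (Finset.mem_coe.1 hi)).2,
          (Finset.mem_filter.1 (Finset.mem_coe.1 hj)).2]
    rw [hsum] at h₁
    have h5 := h i₀.1 _ (fun w => f₁ (i₀.1, w)) (by
      intro w hw
      obtain ⟨i, hi, rfl⟩ := Finset.mem_image.1 hw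
      obtain ⟨hi, hi'⟩ := Finset.mem_filter.1 hi
      have : (i₀.1, i.2) = i := Prod.ext hi'.symm rfl
      simp only [this]
      exact hfix i hi hi') h₁ i₀.2 (Finset.mem_image.2
        ⟨i₀, Finset.mem_filter.2 ⟨hi₀, rfl⟩, rfl⟩)
    exact one_ne_zero (h₁₀.symm.trans h5)

/-! ### Words in a rational function and a Cayley transform of the shift -/

/-- Words of `m + 1` nonzero exponents, except that the last one may vanish; the letters are
listed from right to left. -/
def Exps : ℕ → Type
  | 0 => ℤ
  | m + 1 => Exps m × {n : ℤ // n ≠ 0}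

section Words

variable {k E : Type*} [Field k] [Ring E] [Module (FractionRing k[X]) E]

/-- The product `η δ * u ^ n₁ * η (!δ) * u ^ n₂ * ⋯`, where `u` is `X / (X - 1/2)`. -/
def wordVal (η : Bool → E) : ∀ m, Bool → Exps m → E
  | 0, δ, n => η δ * (ratio k ^ (show ℤ from n) • 1)
  | m + 1, δ, v => η δ * (ratio k ^ v.2.1 • wordVal η m (!δ) v.1)

variable (k) in
/-- The span of the powers of `P` and of the words with at most `m` letters. -/
def wordSpan (P : E) (η : Bool → E) : ℕ → Submodule (FractionRing k[X]) E
  | 0 => Submodule.span _ (Set.range fun i : ℕ => P ^ i)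
  | m + 1 => wordSpan P η m ⊔
      Submodule.span _ (Set.range fun i : Bool × Exps m => wordVal (k := k) η m i.1 i.2)

variable (k) in
/-- The eigenvalues `±1`. -/
def sgn (δ : Bool) : FractionRing k[X] := if δ then -1 else 1

theorem sgn_mul_self (δ : Bool) : sgn k δ * sgn k δ = 1 := by cases δ <;> simp [sgn]

theorem sgn_not (δ : Bool) : sgn k (!δ) = -sgn k δ := by cases δ <;> simp [sgn]

theorem wordVal_mem {P : E} {η : Bool → E} {m : ℕ} (δ : Bool) (w : Exps m) :
    wordVal (k := k) η m δ w ∈ wordSpan k P η (m + 1) :=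
  Submodule.mem_sup_right (Submodule.subset_span ⟨(δ, w), rfl⟩)

theorem wordSpan_mono (P : E) (η : Bool → E) : Monotone (wordSpan k P η) :=
  monotone_nat_of_le_succ fun _ => le_sup_left

theorem one_mem_wordSpan (P : E) (η : Bool → E) (m : ℕ) : (1 : E) ∈ wordSpan k P η m :=
  wordSpan_mono P η (Nat.zero_le m) (Submodule.subset_span ⟨0, pow_zero P⟩)

variable [IsScalarTower (FractionRing k[X]) E E] {P : E} {η : Bool → E}

/-- Left multiplication by `1 - sgn δ • P` clears a leading Cayley factor `η δ`; this is how
relations between words become relations between shorter words. -/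
theorem sub_sgn_smul_mul (hη : ∀ δ, η δ - sgn k δ • (P * η δ) = 1 + sgn k δ • P) (δ : Bool)
    (y : E) : η δ * y - sgn k δ • (P * (η δ * y)) = y + sgn k δ • (P * y) := by
  have h := congrArg (· * y) (hη δ)
  simpa only [sub_mul, add_mul, smul_mul_assoc, one_mul, mul_assoc] using h

variable (hP : ∀ (f : FractionRing k[X]) (x : E), P * (f • x) = shift k f • (P * x))
  (hη : ∀ δ, η δ - sgn k δ • (P * η δ) = 1 + sgn k δ • P)

include hP hη

/-- With `ε = sgn δ`, the Cayley relation gives `P η_δ y - ε η_δ y = -(ε y + P y)`, which stays in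
any `P`-stable subspace containing `y`. So a word is an eigenvector modulo words with fewer letters.
Stability and this property feed each other in the induction. -/
theorem mul_mem_and_eigen (m : ℕ) : (∀ x ∈ wordSpan k P η m, P * x ∈ wordSpan k P η m) ∧
    ∀ δ (w : Exps m), P * wordVal (k := k) η m δ w - sgn k δ • wordVal (k := k) η m δ w ∈
      wordSpan k P η m := by
  have aux : ∀ (m : ℕ), (∀ x ∈ wordSpan k P η m, P * x ∈ wordSpan k P η m) →
      ∀ (δ : Bool) (y : E), y ∈ wordSpan k P η m →
      P * (η δ * y) - sgn k δ • (η δ * y) ∈ wordSpan k P η m := by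
    intro m hm δ y hy
    have h1 := sub_sgn_smul_mul hη δ y
    have h2 : P * (η δ * y) - sgn k δ • (η δ * y) = -(sgn k δ • (y + sgn k δ • (P * y))) := by
      rw [← h1, smul_sub, smul_smul, sgn_mul_self, one_smul, neg_sub]
    rw [h2]
    exact Submodule.neg_mem _ (Submodule.smul_mem _ _
      (Submodule.add_mem _ hy (Submodule.smul_mem _ _ (hm y hy))))
  have stable : ∀ {S : Set E} {N : Submodule (FractionRing k[X]) E}, (∀ x ∈ S, P * x ∈ N) →
      ∀ x ∈ Submodule.span (FractionRing k[X]) S, P * x ∈ N := by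
    intro S N h x hx
    induction hx using Submodule.span_induction with
    | mem x hx => exact h x hx
    | zero => rw [mul_zero]; exact Submodule.zero_mem _
    | add x y _ _ hx hy => rw [mul_add]; exact Submodule.add_mem _ hx hy
    | smul c x _ hx => rw [hP]; exact Submodule.smul_mem _ _ hx
  induction m with
  | zero =>
    have h0 : ∀ x ∈ wordSpan k P η 0, P * x ∈ wordSpan k P η 0 := by
      refine stable ?_
      rintro _ ⟨i, rfl⟩
      exact Submodule.subset_span ⟨i + 1, pow_succ' P i⟩
    exact ⟨h0, fun δ w => aux 0 h0 δ _ (Submodule.smul_mem _ _ (one_mem_wordSpan P η 0))⟩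
  | succ m ih =>
    have h0 : ∀ x ∈ wordSpan k P η (m + 1), P * x ∈ wordSpan k P η (m + 1) := by
      intro x hx
      obtain ⟨y, hy, z, hz, rfl⟩ := Submodule.mem_sup.1 hx
      rw [mul_add]
      refine Submodule.add_mem _ (Submodule.mem_sup_left (ih.1 y hy)) (stable ?_ z hz)
      rintro _ ⟨⟨δ, w⟩, rfl⟩
      have h1 := wordSpan_mono P η (Nat.le_succ m) (ih.2 δ w)
      have h2 := Submodule.add_mem _ h1
        (Submodule.smul_mem _ (sgn k δ) (wordVal_mem (P := P) δ w))
      rwa [sub_add_cancel] at h2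
    exact ⟨h0, fun δ w => aux _ h0 δ _ (Submodule.smul_mem _ _ (wordVal_mem _ _))⟩

omit hη [IsScalarTower (FractionRing k[X]) E E] in
theorem pow_mul_smul_one (i : ℕ) : P ^ i * ((algebraMap k[X] (FractionRing k[X]) X) • (1 : E)) =
    (algebraMap k[X] (FractionRing k[X]) X - i) • P ^ i := by
  induction i with
  | zero => simp
  | succ i ih =>
    rw [pow_succ', mul_assoc, ih, hP, map_sub, shift_X, map_natCast]
    push_cast
    congr 1
    ring

omit hη in
/-- The powers of `P` are linearly independent. -/
theorem coeff_eq_zero_of_sum_pow [CharZero k] [Nontrivial E] (hPu : IsUnit P) (n : ℕ) :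
    ∀ f : ℕ → FractionRing k[X], ∑ i ∈ Finset.range n, f i • P ^ i = 0 → ∀ i < n, f i = 0 := by
  have : CharZero (FractionRing k[X]) :=
    charZero_of_injective_algebraMap (algebraMap k (FractionRing k[X])).injective
  induction n with
  | zero => intro f _ i hi; omega
  | succ n ih =>
    intro f hf
    -- Since `P^i X = (X - i) P^i`, the commutator with `X` multiplies the `i`-th term by `i`.
    -- Subtracting `n` times the relation removes its top term.
    have h1 : ∑ i ∈ Finset.range (n + 1), (f i * ((i : FractionRing k[X]) - n)) • P ^ i = 0 := by
      have e : ∑ i ∈ Finset.range (n + 1), (f i * ((i : FractionRing k[X]) - n)) • P ^ i =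
          (algebraMap k[X] (FractionRing k[X]) X) • ∑ i ∈ Finset.range (n + 1), f i • P ^ i -
          (∑ i ∈ Finset.range (n + 1), f i • P ^ i) *
            ((algebraMap k[X] (FractionRing k[X]) X) • (1 : E)) -
          (n : FractionRing k[X]) • ∑ i ∈ Finset.range (n + 1), f i • P ^ i := by
        rw [Finset.smul_sum, Finset.smul_sum, Finset.sum_mul, ← Finset.sum_sub_distrib,
          ← Finset.sum_sub_distrib]
        refine Finset.sum_congr rfl fun i _ => ?_
        rw [smul_mul_assoc, pow_mul_smul_one hP, smul_smul, smul_smul, smul_smul, ← sub_smul,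
          ← sub_smul]
        congr 1
        ring
      rw [e, hf]
      simp
    rw [Finset.sum_range_succ, sub_self, mul_zero, zero_smul, add_zero] at h1
    have h2 : ∀ i < n, f i = 0 := by
      intro i hi
      have h3 := ih _ h1 i hi
      refine (mul_eq_zero.1 h3).resolve_right (sub_ne_zero.2 ?_)
      exact_mod_cast hi.ne
    rw [Finset.sum_range_succ, Finset.sum_eq_zero, zero_add] at hf
    · intro i hi
      rcases Nat.lt_succ_iff_lt_or_eq.1 hi with hi | rfl
      · exact h2 i hi
      · by_contra h0
        have h4 := congrArg ((f i)⁻¹ • ·) hf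
        simp only [smul_smul, inv_mul_cancel₀ h0, one_smul, smul_zero] at h4
        exact (hPu.pow i).ne_zero h4
    · intro i hi
      rw [h2 i (Finset.mem_range.1 hi), zero_smul]

end Words

end Shift

end

noncomputable section

open Polynomial

/-! ### Linear independence of the alternating words. -/

namespace Shift

section Independence

variable {k E : Type*} [Field k] [CharZero k] [Ring E] [Nontrivial E] [Algebra k E]
  [Module (FractionRing k[X]) E] [IsScalarTower k (FractionRing k[X]) E]
  [IsScalarTower (FractionRing k[X]) E E] {P : E} {η : Bool → E}
  (hP : ∀ (f : FractionRing k[X]) (x : E), P * (f • x) = shift k f • (P * x))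
  (hη : ∀ δ, η δ - sgn k δ • (P * η δ) = 1 + sgn k δ • P) (hPu : IsUnit P)

theorem charZero_fractionRing : CharZero (FractionRing k[X]) :=
  charZero_of_injective_algebraMap (algebraMap k (FractionRing k[X])).injective

theorem sgn_ne_zero (δ : Bool) : sgn k δ ≠ 0 :=
  left_ne_zero_of_mul (by rw [sgn_mul_self]; exact one_ne_zero)

omit [CharZero k] [Nontrivial E] [IsScalarTower (FractionRing k[X]) E E] in
theorem mul_algebraMap_smul (c : k) (x y : E) :
    x * (algebraMap k (FractionRing k[X]) c • y) = algebraMap k (FractionRing k[X]) c • (x * y) :=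
        by
  rw [algebraMap_smul, algebraMap_smul, mul_smul_comm]

include hP hη hPu

-- If `η F = ∑ c_i P^i`, clearing `η` gives `(1 - ε P) ∑ c_i P^i = (1 + ε P) F`. Comparing powers of
-- `P` from the top kills `c_i` for `i ≥ 1`. The two lowest coefficients then give `c_0 = F` and `2
-- σ F = 0`.
omit [Algebra k E] [IsScalarTower k (FractionRing k[X]) E] in
theorem coeff_eq_zero_of_mul_mem_wordSpan_zero (δ : Bool) (F : FractionRing k[X])
    (h : η δ * (F • (1 : E)) ∈ wordSpan k P η 0) : F = 0 := by
  have := charZero_fractionRing (k := k)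
  obtain ⟨c, hc⟩ := Finsupp.mem_span_range_iff_exists_finsupp.1 h
  obtain ⟨N, hN⟩ : ∃ N, ∀ i, N ≤ i → c i = 0 := by
    refine ⟨c.support.sup id + 1, fun i hi => ?_⟩
    by_contra h0
    have := Finset.le_sup (f := id) (Finsupp.mem_support_iff.2 h0)
    simp only [id] at this
    omega
  have hsum : ∀ M, N ≤ M → ∑ i ∈ Finset.range M, c i • P ^ i = η δ * (F • (1 : E)) := by
    intro M hM
    rw [← hc, Finsupp.sum]
    refine (Finset.sum_subset (fun i hi => ?_) fun i _ hi => ?_).symm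
    · rw [Finset.mem_range]
      by_contra h0
      exact Finsupp.mem_support_iff.1 hi (hN i (by omega))
    · rw [Finsupp.notMem_support_iff.1 hi, zero_smul]
  -- `r i` is the coefficient of `P^i` in `(1 - ε P) ∑ c_i P^i - (1 + ε P) F`.
  obtain ⟨r, hrz, hrs⟩ : ∃ r : ℕ → FractionRing k[X], r 0 = c 0 - F ∧ ∀ i, r (i + 1) =
      c (i + 1) - sgn k δ * shift k (c i) - if i = 0 then sgn k δ * shift k F else 0 :=
    ⟨fun i => Nat.casesOn i (c 0 - F) fun i => c (i + 1) - sgn k δ * shift k (c i) -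
      if i = 0 then sgn k δ * shift k F else 0, rfl, fun _ => rfl⟩
  have hrel : ∑ i ∈ Finset.range (N + 2), r i • P ^ i = 0 := by
    have h1 := sub_sgn_smul_mul hη δ (F • (1 : E))
    rw [hP, mul_one] at h1
    have h2 : ∑ i ∈ Finset.range (N + 1), (sgn k δ * shift k (c i)) • P ^ (i + 1) =
        sgn k δ • (P * (η δ * (F • (1 : E)))) := by
      rw [← hsum (N + 1) (by omega), Finset.mul_sum, Finset.smul_sum]
      refine Finset.sum_congr rfl fun i _ => ?_
      rw [hP, smul_smul, pow_succ']
    have h3 := hsum (N + 2) (by omega)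
    rw [Finset.sum_range_succ'] at h3
    rw [Finset.sum_range_succ']
    simp only [hrz, hrs, sub_smul, Finset.sum_sub_distrib, ite_smul, zero_smul]
    rw [h2, Finset.sum_ite_eq' (Finset.range (N + 1)) 0, if_pos (by simp)]
    rw [← h3] at h1 ⊢
    rw [zero_add, pow_one, mul_smul, pow_zero]
    rw [pow_zero] at h1
    rw [← sub_eq_zero] at h1
    rw [← h1]
    abel
  have hr0 := coeff_eq_zero_of_sum_pow hP hPu (N + 2) r hrel
  have hdown : ∀ j i, i + j = N → c (i + 1) = 0 := by
    intro j
    induction j with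
    | zero => intro i hi; exact hN _ (by omega)
    | succ j ih =>
      intro i hi
      have h1 := hr0 (i + 2) (by omega)
      rw [hrs, if_neg (by omega), ih (i + 1) (by omega), zero_sub, sub_zero, neg_eq_zero] at h1
      exact (map_eq_zero _).1 ((mul_eq_zero.1 h1).resolve_left (sgn_ne_zero δ))
  have h0 := hr0 0 (by omega)
  have h1 := hr0 1 (by omega)
  rw [hrz] at h0
  rw [hrs, if_pos rfl, hdown N 0 (by omega), sub_eq_zero.1 h0] at h1
  have h2 : sgn k δ * (2 * shift k F) = 0 := by linear_combination -h1
  exact (map_eq_zero _).1 ((mul_eq_zero.1 ((mul_eq_zero.1 h2).resolve_left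
    (sgn_ne_zero δ))).resolve_left two_ne_zero)

/-- Induction on the length. Once coefficients are constant and the first letter `η_δ` is fixed, the
combination is `η_δ Y` with `Y` a combination of words one letter shorter. Clearing `η_δ` and
comparing coefficients of these words presents each coefficient of `Y`, a Laurent polynomial in
`ratio k`, as `q + shift q`; then `coeff_eq_zero_of_eq_add_shift` applies. -/
theorem coeff_eq_zero_of_sum_wordVal_mem (m : ℕ) :
    ∀ (s : Finset (Bool × Exps m)) (f : Bool × Exps m → FractionRing k[X]),
      ∑ i ∈ s, f i • wordVal (k := k) η m i.1 i.2 ∈ wordSpan k P η m → ∀ i ∈ s, f i = 0 := by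
  classical
  have := charZero_fractionRing (k := k)
  -- Words are eigenvectors of `P` modulo shorter ones, and the shift fixes only constants and
  -- negates only `0`.
  have reduce : ∀ m, (∀ (δ : Bool) (s : Finset (Exps m)) (c : Exps m → k),
      ∑ w ∈ s, algebraMap k (FractionRing k[X]) (c w) • wordVal (k := k) η m δ w ∈
          wordSpan k P η m →
      ∀ w ∈ s, c w = 0) →
      ∀ (s : Finset (Bool × Exps m)) (f : Bool × Exps m → FractionRing k[X]),
      ∑ i ∈ s, f i • wordVal (k := k) η m i.1 i.2 ∈ wordSpan k P η m → ∀ i ∈ s, f i = 0 := by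
    intro m hm
    refine eq_zero_of_eigenvectors (σ := shift k) (Set.range (algebraMap k (FractionRing k[X])))
      ?_ ?_ (AddMonoidHom.mulLeft P) hP (wordSpan k P η m) (mul_mem_and_eigen hP hη m).1
      (sgn k) sgn_mul_self ?_ (wordVal (k := k) η m) (mul_mem_and_eigen hP hη m).2 ?_
    · intro f hf
      obtain ⟨c, rfl, _⟩ := exists_eq_algebraMap_of_shift (f := f) (ε := (1 : k)) (one_mul 1)
        (by rw [map_one, one_mul]; exact hf)
      exact ⟨c, rfl⟩
    · intro f hf
      obtain ⟨c, rfl, hc⟩ := exists_eq_algebraMap_of_shift (f := f) (ε := (-1 : k)) (by norm_num)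
        (by rw [map_neg, map_one, neg_one_mul]; exact hf)
      have : (2 : k) * c = 0 := by linear_combination hc
      rw [(mul_eq_zero.1 this).resolve_left two_ne_zero, map_zero]
    · intro δ δ' h
      cases δ <;> cases δ' <;> simp_all [sgn]
    · intro δ s f hf hs
      choose! c hc using hf
      have h1 : ∀ w ∈ s, c w = 0 := by
        refine hm δ s c ?_
        rwa [Finset.sum_congr rfl fun w hw => by rw [hc w hw]]
      intro w hw
      rw [← hc w hw, h1 w hw, map_zero]
  induction m with
  | zero =>
    refine reduce 0 fun δ (s : Finset ℤ) (c : ℤ → k) hs => ?_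
    replace hs : ∑ n ∈ s, algebraMap k (FractionRing k[X]) (c n) • (η δ * (ratio k ^ n • (1 : E))) ∈
      wordSpan k P η 0 := hs
    refine coeff_eq_zero_of_sum_eq_zero (k := k) s c ?_
    refine coeff_eq_zero_of_mul_mem_wordSpan_zero hP hη hPu δ _ ?_
    rw [Finset.sum_smul, Finset.mul_sum]
    simpa only [mul_smul, mul_algebraMap_smul] using hs
  | succ m ih =>
    refine reduce (m + 1) fun δ (t : Finset (Exps m × {n : ℤ // n ≠ 0})) c ht => ?_
    replace ht : ∑ v ∈ t, algebraMap k (FractionRing k[X]) (c v) •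
      (η δ * (ratio k ^ v.2.1 • wordVal (k := k) η m (!δ) v.1)) ∈ wordSpan k P η (m + 1) := ht
    set A : Finset (Exps m) := t.image Prod.fst
    -- The words are grouped by what follows their first power of `ratio k`. The constants commute
    -- with `η δ`, so each group contributes one Laurent polynomial without constant term.
    set F : Exps m → FractionRing k[X] := fun a => ∑ v ∈ t.filter (fun v => v.1 = a),
      algebraMap k (FractionRing k[X]) (c v) * ratio k ^ v.2.1 with hF
    set Y : E := ∑ a ∈ A, F a • wordVal (k := k) η m (!δ) a
    have hY : ∑ v ∈ t, algebraMap k (FractionRing k[X]) (c v) •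
        (η δ * (ratio k ^ v.2.1 • wordVal (k := k) η m (!δ) v.1)) = η δ * Y := by
      rw [Finset.mul_sum, ← Finset.sum_fiberwise_of_maps_to (g := Prod.fst) (t := A)
        fun v hv => Finset.mem_image_of_mem _ hv]
      refine Finset.sum_congr rfl fun a _ => ?_
      rw [hF, Finset.sum_smul, Finset.mul_sum]
      refine Finset.sum_congr rfl fun v hv => ?_
      rw [mul_smul, mul_algebraMap_smul, ← (Finset.mem_filter.1 hv).2]
    rw [hY] at ht
    obtain ⟨x', hx', z, hz, hxz⟩ := Submodule.mem_sup.1 ht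
    obtain ⟨g, rfl⟩ := Finsupp.mem_span_range_iff_exists_finsupp.1 hz
    set S : Finset (Bool × Exps m) := g.support ∪ A.image fun a => (!δ, a)
    set F' : Bool × Exps m → FractionRing k[X] := fun i => if i.1 = !δ then F i.2 else 0 with hF'
    have hgS : (g.sum fun i a => a • wordVal (k := k) η m i.1 i.2) =
        ∑ i ∈ S, g i • wordVal (k := k) η m i.1 i.2 := by
      refine Finset.sum_subset Finset.subset_union_left fun i _ hi => ?_
      beta_reduce
      rw [Finsupp.notMem_support_iff.1 hi, zero_smul]
    have hYS : Y = ∑ i ∈ S, F' i • wordVal (k := k) η m i.1 i.2 := by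
      rw [← Finset.sum_subset (Finset.subset_union_right (s₁ := g.support)), Finset.sum_image]
      · refine Finset.sum_congr rfl fun a _ => ?_
        simp only [hF', if_true]
      · intro a _ b _ hab
        exact (Prod.ext_iff.1 hab).2
      · rintro ⟨δ', a⟩ _ ha
        simp only [hF']
        split_ifs with h1
        · have h2 : F a = 0 := by
            refine Finset.sum_eq_zero fun v hv => absurd ?_ ha
            obtain ⟨hv, hva⟩ := Finset.mem_filter.1 hv
            rw [Finset.mem_image]
            exact ⟨a, Finset.mem_image.2 ⟨v, hv, hva⟩, by rw [← h1]⟩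
          rw [h2, zero_smul]
        · rw [zero_smul]
    have hmod : ∀ G : Bool × Exps m → FractionRing k[X],
        ∑ i ∈ S, (sgn k δ * (shift k (G i) * sgn k i.1)) • wordVal (k := k) η m i.1 i.2 -
          sgn k δ • (P * ∑ i ∈ S, G i • wordVal (k := k) η m i.1 i.2) ∈ wordSpan k P η m := by
      intro G
      rw [Finset.mul_sum, Finset.smul_sum, ← Finset.sum_sub_distrib]
      refine Submodule.sum_mem _ fun i _ => ?_
      rw [hP, mul_smul, mul_smul, ← smul_sub, ← smul_sub]
      refine Submodule.smul_mem _ _ (Submodule.smul_mem _ _ ?_)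
      rw [← neg_sub]
      exact Submodule.neg_mem _ ((mul_mem_and_eigen hP hη m).2 i.1 i.2)
    have hrel := sub_sgn_smul_mul hη δ Y
    rw [← hxz, hgS, mul_add, smul_add] at hrel
    -- These are the coefficients, modulo shorter words, of `(1 - ε P)(η_δ Y) - (1 + ε P) Y`, where
    -- `g` holds the coefficients of `η_δ Y`.
    set r : Bool × Exps m → FractionRing k[X] := fun i =>
      g i - sgn k δ * (shift k (g i) * sgn k i.1) - F' i -
        sgn k δ * (shift k (F' i) * sgn k i.1) with hr
    have hrS : ∑ i ∈ S, r i • wordVal (k := k) η m i.1 i.2 ∈ wordSpan k P η m := by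
      have h1 := hmod g
      have h2 := hmod F'
      rw [← hYS] at h2
      have h3 : x' - sgn k δ • (P * x') ∈ wordSpan k P η m := Submodule.sub_mem _ hx'
        (Submodule.smul_mem _ _ ((mul_mem_and_eigen hP hη m).1 x' hx'))
      have h4 := Submodule.neg_mem _ (Submodule.add_mem _ (Submodule.add_mem _ h3 h1) h2)
      have e : ∑ i ∈ S, r i • wordVal (k := k) η m i.1 i.2 = ∑ i ∈ S, g i • wordVal
          (k := k) η m i.1 i.2 -
          ∑ i ∈ S, (sgn k δ * (shift k (g i) * sgn k i.1)) • wordVal (k := k) η m i.1 i.2 - Y -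
          ∑ i ∈ S, (sgn k δ * (shift k (F' i) * sgn k i.1)) • wordVal (k := k) η m i.1 i.2 := by
        rw [hYS]
        simp only [hr, sub_smul, Finset.sum_sub_distrib]
      rw [e]
      refine (congrArg (· ∈ wordSpan k P η m) ?_).mp h4
      rw [← sub_eq_zero] at hrel
      rw [← sub_eq_zero, ← neg_eq_zero, ← hrel]
      abel
    have hr0 := ih S r hrS
    have hA : ∀ a ∈ A, ∃ q : FractionRing k[X], q + shift k q = F a := by
      intro a ha
      have h1 := hr0 (!δ, a) (Finset.mem_union_right _ (Finset.mem_image_of_mem _ ha))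
      simp only [hr, hF', if_true, sgn_not] at h1
      -- At the opposite letter the relation reads `g + σ g = F - σ F`, so `(g + F) / 2` and its
      -- shift add up to `F`.
      refine ⟨(g (!δ, a) + F a) / 2, ?_⟩
      rw [map_div₀, map_add, map_ofNat]
      have h2 := sgn_mul_self (k := k) δ
      field_simp
      linear_combination h1 - (shift k (g (!δ, a)) + shift k (F a)) * h2
    intro v hv
    obtain ⟨q, hq⟩ := hA v.1 (Finset.mem_image_of_mem _ hv)
    have h1 := coeff_eq_zero_of_eq_add_shift (k := k) (g := q)
      ((t.filter fun w => w.1 = v.1).image fun w => w.2.1)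
      (fun n => if h : n ≠ 0 then c (v.1, ⟨n, h⟩) else 0) (by
        rw [hq, Finset.sum_image]
        · refine Finset.sum_congr rfl fun w hw => ?_
          rw [dif_pos w.2.2, ← (Finset.mem_filter.1 hw).2]
        · intro w hw w' hw' h
          exact Prod.ext ((Finset.mem_filter.1 (Finset.mem_coe.1 hw)).2.trans
            (Finset.mem_filter.1 (Finset.mem_coe.1 hw')).2.symm) (Subtype.ext h)) v.2.1
      (Finset.mem_image.2 ⟨v, Finset.mem_filter.2 ⟨hv, rfl⟩, rfl⟩) v.2.2
    rwa [dif_pos v.2.2] at h1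

/-- The longest words are removed first: all others lie in the span modulo which these are
independent. -/
theorem coeff_eq_zero_of_sum_sum_wordVal_mem (δ : Bool) (n : ℕ) (t : ∀ m, Finset (Exps m))
    (F : ∀ m, Exps m → FractionRing k[X])
    (h : ∑ m ∈ Finset.range n, ∑ w ∈ t m, F m w • wordVal (k := k) η m δ w ∈ wordSpan k P η 0) :
    ∀ m < n, ∀ w ∈ t m, F m w = 0 := by
  classical
  induction n with
  | zero => intro m hm; omega
  | succ n ih =>
    have h1 : ∀ w ∈ t n, F n w = 0 := by
      have h2 := coeff_eq_zero_of_sum_wordVal_mem hP hη hPu n ((t n).image fun w => (δ, w))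
        (fun i => F n i.2) (by
          rw [Finset.sum_image fun a _ b _ hab => (Prod.ext_iff.1 hab).2]
          rw [Finset.sum_range_succ] at h
          refine (Submodule.add_mem_iff_right _ (Submodule.sum_mem _ fun m hm =>
            Submodule.sum_mem _ fun w _ => Submodule.smul_mem _ _ ?_)).1
            (wordSpan_mono P η (Nat.zero_le n) h)
          exact wordSpan_mono P η (Finset.mem_range.1 hm) (wordVal_mem δ w))
      exact fun w hw => h2 (δ, w) (Finset.mem_image_of_mem _ hw)
    rw [Finset.sum_range_succ, Finset.sum_eq_zero (s := t n) fun w hw => by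
      rw [h1 w hw, zero_smul], add_zero] at h
    intro m hm
    rcases Nat.lt_succ_iff_lt_or_eq.1 hm with hm | rfl
    · exact ih h m hm
    · exact h1

end Independence

end Shift

end

noncomputable section

open Polynomial

namespace Shift

/-! ### Normal forms in the free group of rank two -/

/-- The parity of a natural number; it tells the generator that a word begins with. -/
def parity : ℕ → Bool
  | 0 => false
  | m + 1 => !parity m

/-- The generators of the free group of rank two. -/
def letter (δ : Bool) : FreeGroup (Fin 2) := if δ then .of 1 else .of 0

/-- The word with given exponents that ends with the first generator. -/
def word : ∀ m, Exps m → FreeGroup (Fin 2)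
  | 0, n => letter false ^ (show ℤ from n)
  | m + 1, v => letter (parity (m + 1)) ^ v.2.1 * word m v.1

theorem exists_word_eq_letter_zpow_mul (δ : Bool) (j : ℤ) (m : ℕ) (w : Exps m) :
    ∃ m' w', word m' w' = letter δ ^ j * word m w := by
  by_cases hδ : δ = parity m
  · subst hδ
    cases m with
    | zero =>
      refine ⟨0, (show ℤ from j + (show ℤ from w)), ?_⟩
      exact zpow_add _ _ _
    | succ m =>
      obtain ⟨v, n, hn⟩ := w
      by_cases h0 : j + n = 0
      · refine ⟨m, v, ?_⟩
        change _ = _ * (letter _ ^ n * _)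
        rw [← mul_assoc, ← zpow_add, h0, zpow_zero, one_mul]
      · refine ⟨m + 1, (v, ⟨j + n, h0⟩), ?_⟩
        change letter _ ^ (j + n) * _ = _ * (letter _ ^ n * _)
        rw [← mul_assoc, ← zpow_add]
  · by_cases hj : j = 0
    · exact ⟨m, w, by rw [hj, zpow_zero, one_mul]⟩
    · refine ⟨m + 1, (w, ⟨j, hj⟩), ?_⟩
      have : parity (m + 1) = δ := by
        rw [parity]
        revert hδ
        cases δ <;> cases parity m <;> simp
      change letter (parity (m + 1)) ^ j * _ = _
      rw [this]

theorem exists_word_eq (g : FreeGroup (Fin 2)) : ∃ m w, word m w = g := by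
  suffices h : ∀ g' : FreeGroup (Fin 2), (∃ m w, word m w = g') → ∃ m w, word m w = g * g' by
    simpa using h 1 ⟨0, (0 : ℤ), zpow_zero _⟩
  have hl : ∀ i : Fin 2, ∃ δ, letter δ = .of i := by
    intro i
    fin_cases i
    · exact ⟨false, rfl⟩
    · exact ⟨true, rfl⟩
  induction g using FreeGroup.induction_on with
  | C1 => intro g' h; rwa [one_mul]
  | of i =>
    rintro _ ⟨m, w, rfl⟩
    obtain ⟨δ, hδ⟩ := hl i
    simpa [hδ] using exists_word_eq_letter_zpow_mul δ 1 m w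
  | inv_of i _ =>
    rintro _ ⟨m, w, rfl⟩
    obtain ⟨δ, hδ⟩ := hl i
    simpa [hδ] using exists_word_eq_letter_zpow_mul δ (-1) m w
  | mul g h hg hh =>
    intro g' h'
    rw [mul_assoc]
    exact hg _ (hh _ h')

/-- The words in the second component of the normal form, which begin with the second generator. -/
def tail : Option (Σ m, Exps m) → FreeGroup (Fin 2)
  | none => 1
  | some v => word v.1 v.2

/-- The leading power of the first generator is split off because its image is a scalar of the field
of rational functions, so it can be absorbed in a coefficient. -/
theorem exists_normal_form (g : FreeGroup (Fin 2)) : ∃ (n : ℤ) (o : Option (Σ m, Exps m)),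
    g = letter false ^ n * tail o ∧ ∀ v ∈ o, parity v.1 = true := by
  obtain ⟨m, w, rfl⟩ := exists_word_eq g
  by_cases hm : parity m = true
  · refine ⟨0, some ⟨m, w⟩, by rw [zpow_zero, one_mul]; rfl, ?_⟩
    intro v hv
    rwa [← Option.some.inj hv]
  · cases m with
    | zero => exact ⟨w, none, by rw [tail, mul_one]; rfl, by simp⟩
    | succ m =>
      refine ⟨w.2.1, some ⟨m, w.1⟩, ?_, ?_⟩
      · rw [Bool.not_eq_true] at hm
        rw [← hm]
        rfl
      · intro v hv
        rw [← Option.some.inj hv]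
        simpa [parity] using hm

section Independence

variable {k E : Type*} [Field k] [CharZero k] [Ring E] [Nontrivial E] [Algebra k E]
  [Module (FractionRing k[X]) E] [IsScalarTower k (FractionRing k[X]) E]
  [IsScalarTower (FractionRing k[X]) E E]

omit [CharZero k] [Nontrivial E] [Algebra k E] [IsScalarTower k (FractionRing k[X]) E] in
theorem zpow_mul_eq_smul {f : FractionRing k[X]} (hf : f ≠ 0) (u : Eˣ)
    (hu : (u : E) = f • (1 : E)) (n : ℤ) (x : E) : ((u ^ n : Eˣ) : E) * x = f ^ n • x := by
  let φ : FractionRing k[X] →* E :=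
    { toFun := fun f => f • (1 : E)
      map_one' := one_smul _ _
      map_mul' := fun f g => by rw [smul_mul_assoc, one_mul, smul_smul] }
  have h1 : u = Units.map φ (Units.mk0 f hf) := Units.ext hu
  rw [h1, ← map_zpow]
  change ((((Units.mk0 f hf) ^ n : (FractionRing k[X])ˣ) : FractionRing k[X]) • (1 : E)) * x = _
  rw [smul_mul_assoc, one_mul, Units.val_zpow_eq_zpow_val]
  rfl

/-- The values of the tails of normal forms. -/
def tailVal (k : Type*) {E : Type*} [Field k] [Ring E] [Module (FractionRing k[X]) E]
    (η : Bool → E) : Option (Σ m, Exps m) → E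
  | none => 1
  | some v => wordVal (k := k) η v.1 true v.2

variable {P : E} (u η : Eˣ) (hu : (u : E) = ratio k • (1 : E))

/-- The evaluation of the free group at a unit and a conjugate of it. -/
def evalHom {E : Type*} [Monoid E] (u η : Eˣ) : FreeGroup (Fin 2) →* Eˣ :=
  FreeGroup.lift ![u, η * u * η⁻¹]

theorem evalHom_letter_false {E : Type*} [Monoid E] (u η : Eˣ) :
    evalHom u η (letter false) = u := by
  simp [evalHom, letter]

theorem evalHom_letter_true {E : Type*} [Monoid E] (u η : Eˣ) :
    evalHom u η (letter true) = η * u * η⁻¹ := by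
  simp [evalHom, letter]

include hu

-- Powers of `η u η⁻¹` separated by powers of `u` spell out alternating `η` and `η⁻¹`. A word
-- beginning with the first generator has no initial `η⁻¹`, whence the compensating factor `η`.
omit [CharZero k] [Nontrivial E] [Algebra k E] [IsScalarTower k (FractionRing k[X]) E] in
theorem evalHom_word (m : ℕ) (w : Exps m) : (evalHom u η (word m w) : E) =
    (if parity m then 1 else (η : E)) *
      wordVal (k := k) (fun δ => if δ then (η : E) else (η⁻¹ : Eˣ)) m (parity m) w := by
  induction m with
  | zero =>
    change ((evalHom u η (letter false ^ (show ℤ from w)) : Eˣ) : E) =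
      (η : E) * ((η⁻¹ : Eˣ) * (ratio k ^ (show ℤ from w) • (1 : E)))
    rw [Units.mul_inv_cancel_left, map_zpow, evalHom_letter_false,
      ← zpow_mul_eq_smul (ratio_ne_zero (k := k)) u hu, mul_one]
  | succ m ih =>
    obtain ⟨v, n⟩ := w
    have e : (evalHom u η (word (m + 1) (v, n)) : E) =
        ((evalHom u η (letter (parity (m + 1))) ^ n.1 : Eˣ) : E) * evalHom u η (word m v) := by
      rw [← map_zpow, ← Units.val_mul, ← map_mul]
      rfl
    have e' : ∀ (η' : Bool → E) (δ : Bool), wordVal (k := k) η' (m + 1) δ (v, n) =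
        η' δ * (ratio k ^ n.1 • wordVal η' m (!δ) v) := fun _ _ => rfl
    rw [e, ih, e', parity]
    cases hm : parity m
    · simp only [Bool.not_false, evalHom_letter_true, if_true, Bool.false_eq_true, if_false,
        Bool.not_true, one_mul, conj_zpow, ← zpow_mul_eq_smul (ratio_ne_zero (k := k)) u hu]
      simp only [Units.val_mul, mul_assoc, Units.inv_mul_cancel_left]
    · simp only [Bool.not_false, evalHom_letter_false, if_true, Bool.false_eq_true, if_false,
        Bool.not_true, one_mul, ← zpow_mul_eq_smul (ratio_ne_zero (k := k)) u hu,
        Units.mul_inv_cancel_left]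

omit [CharZero k] [Nontrivial E] [Algebra k E] [IsScalarTower k (FractionRing k[X]) E] in
theorem evalHom_tail (n : ℤ) (o : Option (Σ m, Exps m)) (ho : ∀ v ∈ o, parity v.1 = true) :
    (evalHom u η (letter false ^ n * tail o) : E) =
      ratio k ^ n • tailVal k (fun δ => if δ then (η : E) else (η⁻¹ : Eˣ)) o := by
  rw [map_mul, map_zpow, evalHom_letter_false, Units.val_mul,
    zpow_mul_eq_smul (ratio_ne_zero (k := k)) u hu]
  congr 1
  cases o with
  | none => rw [tail, map_one, Units.val_one, tailVal]
  | some v =>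
    have h := ho v rfl
    rw [tail, tailVal, evalHom_word u η hu, h, if_pos rfl, one_mul]

variable (hP : ∀ (f : FractionRing k[X]) (x : E), P * (f • x) = shift k f • (P * x))
  (hη : (1 + P) * η = 1 - P) (hPu : IsUnit P)

include hP hη hPu

/-- Collecting group elements with the same tail gives a relation between tails over the rational
functions. The tails are independent, the trivial one `1` being in `wordSpan 0`, so each collected
coefficient vanishes. -/
theorem coeff_eq_zero_of_sum_evalHom (s : Finset (FreeGroup (Fin 2)))
    (c : FreeGroup (Fin 2) → k) (h : ∑ g ∈ s, c g • (evalHom u η g : E) = 0) :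
    ∀ g ∈ s, c g = 0 := by
  classical
  set η₂ : Bool → E := fun δ => if δ then (η : E) else (η⁻¹ : Eˣ) with hη₂
  have hη₂' : ∀ δ, η₂ δ - sgn k δ • (P * η₂ δ) = 1 + sgn k δ • P := by
    intro δ
    cases δ
    · have h1 : (1 - P) * ((η⁻¹ : Eˣ) : E) = 1 + P := by
        rw [← hη, mul_assoc, Units.mul_inv, mul_one]
      simp only [hη₂, sgn, Bool.false_eq_true, if_false, one_smul]
      rw [← h1]; noncomm_ring
    · simp only [hη₂, sgn, if_true, neg_smul, one_smul]
      rw [sub_neg_eq_add, ← sub_eq_add_neg, ← hη]; noncomm_ring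
  choose n o hno ho using exists_normal_form
  set F : Option (Σ m, Exps m) → FractionRing k[X] := fun x => ∑ g ∈ s.filter (fun g => o g = x),
    algebraMap k (FractionRing k[X]) (c g) * ratio k ^ n g with hF
  have h1 : ∑ x ∈ s.image o, F x • tailVal k η₂ x = 0 := by
    rw [← h, ← Finset.sum_fiberwise_of_maps_to (g := o) (t := s.image o)
      fun g hg => Finset.mem_image_of_mem _ hg]
    refine Finset.sum_congr rfl fun x _ => ?_
    rw [hF, Finset.sum_smul]
    refine Finset.sum_congr rfl fun g hg => ?_
    have h2 := evalHom_tail u η hu (n g) _ (ho g)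
    rw [← hno g, (Finset.mem_filter.1 hg).2] at h2
    rw [h2, mul_smul, algebraMap_smul]
  set S : Finset (Σ m, Exps m) := Finset.eraseNone (s.image o)
  have h2 : ∑ x ∈ S, F (some x) • tailVal k η₂ (some x) + F none • (1 : E) = 0 := by
    by_cases hn : none ∈ s.image o
    · rw [← Finset.sum_erase_add _ _ hn, ← Finset.map_some_eraseNone, Finset.sum_map] at h1
      exact h1
    · rw [← Finset.erase_eq_of_notMem hn, ← Finset.map_some_eraseNone, Finset.sum_map] at h1
      have : F none = 0 := by
        refine Finset.sum_eq_zero fun g hg => absurd ?_ hn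
        exact Finset.mem_image.2 ⟨g, (Finset.mem_filter.1 hg)⟩
      rw [this, zero_smul, add_zero]
      exact h1
  obtain ⟨N, hN⟩ : ∃ N, ∀ x ∈ S, x.1 < N :=
    ⟨S.sup Sigma.fst + 1, fun x hx => Nat.lt_succ_of_le (Finset.le_sup (f := Sigma.fst) hx)⟩
  set t : ∀ m, Finset (Exps m) := fun m => S.preimage (Sigma.mk m) sigma_mk_injective.injOn
  have hSt : S = (Finset.range N).sigma t := by
    ext x
    simp only [t, Finset.mem_sigma, Finset.mem_range, Finset.mem_preimage]
    exact ⟨fun hx => ⟨hN x hx, hx⟩, fun hx => hx.2⟩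
  have h3 : ∀ x ∈ S, F (some x) = 0 := by
    intro x hx
    refine coeff_eq_zero_of_sum_sum_wordVal_mem hP hη₂' hPu true N t
      (fun m w => F (some ⟨m, w⟩)) ?_ x.1 (hN x hx) x.2 (Finset.mem_preimage.2 hx)
    rw [Finset.sum_sigma', ← hSt]
    have h4 := eq_neg_of_add_eq_zero_left h2
    change ∑ x ∈ S, F (some x) • tailVal k η₂ (some x) ∈ _
    rw [h4]
    exact Submodule.neg_mem _ (Submodule.smul_mem _ _ (one_mem_wordSpan P η₂ 0))
  have h4 : F none = 0 := by
    rw [Finset.sum_eq_zero fun x hx => by rw [h3 x hx, zero_smul], zero_add] at h2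
    by_contra h0
    have := congrArg ((F none)⁻¹ • ·) h2
    simp only [smul_smul, inv_mul_cancel₀ h0, one_smul, smul_zero] at this
    exact one_ne_zero this
  have h5 : ∀ g ∈ s, F (o g) = 0 := by
    intro g hg
    cases hog : o g with
    | none => exact h4
    | some x => exact h3 x (Finset.mem_eraseNone.2 (hog ▸ Finset.mem_image_of_mem o hg))
  intro g hg
  -- For a fixed tail, the collected coefficient is a Laurent polynomial in `ratio k` with the
  -- original constants as coefficients.
  have h6 := coeff_eq_zero_of_sum_eq_zero (k := k) ((s.filter fun g' => o g' = o g).image n)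
    (fun m => c (letter false ^ m * tail (o g))) (by
      rw [Finset.sum_image]
      · rw [← h5 g hg]
        refine Finset.sum_congr rfl fun g' hg' => ?_
        rw [← (Finset.mem_filter.1 hg').2, ← hno g']
      · intro g₁ h₁ g₂ h₂ h₁₂
        rw [hno g₁, hno g₂, h₁₂, (Finset.mem_filter.1 (Finset.mem_coe.1 h₁)).2,
          (Finset.mem_filter.1 (Finset.mem_coe.1 h₂)).2]) (n g)
      (Finset.mem_image_of_mem n (Finset.mem_filter.2 ⟨hg, rfl⟩))
  rwa [← hno g] at h6

theorem lift_evalHom_injective : Function.Injective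
    (MonoidAlgebra.lift k E (FreeGroup (Fin 2)) ((Units.coeHom E).comp (evalHom u η))) := by
  rw [injective_iff_map_eq_zero]
  intro r hr
  rw [MonoidAlgebra.lift_apply] at hr
  have h := coeff_eq_zero_of_sum_evalHom (k := k) u η hu hP hη hPu r.coeff.support r.coeff hr
  ext g
  by_contra h0
  exact h0 (h g (Finsupp.mem_support_iff.2 h0))

end Independence

end Shift

end

noncomputable section

open Polynomial

namespace Shift

/-! ### Free group algebras from solutions of `s P - P s = P` -/

section Fractions

variable {k E : Type*} [Field k] [Ring E] [Algebra k E]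

/-- The extension of the evaluation of polynomials to rational functions, at an element of a
not necessarily commutative ring. -/
def fractionEval (s : E) (hs : ∀ f : k[X], f ≠ 0 → IsUnit (aeval s f)) :
    FractionRing k[X] →+* E :=
  OreLocalization.universalHom (S := nonZeroDivisors k[X]) (aeval s : k[X] →ₐ[k] E).toRingHom
    (IsUnit.liftRight (((aeval s : k[X] →ₐ[k] E) : k[X] →* E).comp (nonZeroDivisors k[X]).subtype)
      fun f => hs f.1 (nonZeroDivisors.ne_zero f.2))
    fun _ => rfl

variable (s : E) (hs : ∀ f : k[X], f ≠ 0 → IsUnit (aeval s f))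

theorem fractionEval_algebraMap (f : k[X]) :
    fractionEval s hs (algebraMap k[X] _ f) = aeval s f :=
  OreLocalization.universalHom_commutes _ _ _

theorem fractionEval_C (c : k) : fractionEval s hs (algebraMap k _ c) = algebraMap k E c := by
  rw [IsScalarTower.algebraMap_apply k k[X] (FractionRing k[X]), fractionEval_algebraMap,
    Polynomial.algebraMap_eq, aeval_C]

variable {P : E} (hP : s * P - P * s = P)

include hP

theorem mul_aeval (f : k[X]) : P * aeval s f = aeval s (taylor (-1) f) * P := by
  induction f using Polynomial.induction_on' with
  | add p q hp hq => rw [map_add, map_add, map_add, mul_add, add_mul, hp, hq]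
  | monomial n c =>
    have h : ∀ n : ℕ, P * s ^ n = (s - 1) ^ n * P := by
      intro n
      induction n with
      | zero => simp
      | succ n ih =>
        have h1 : P * s = (s - 1) * P := by rw [sub_mul, one_mul, eq_sub_iff_add_eq,
          ← eq_sub_iff_add_eq', hP]
        rw [pow_succ, ← mul_assoc, ih, mul_assoc, h1, pow_succ, mul_assoc]
    rw [taylor_monomial, aeval_monomial, map_mul, aeval_C, map_pow, map_add, aeval_X, aeval_C,
      map_neg, map_one, ← sub_eq_add_neg, ← mul_assoc, ← Algebra.commutes, mul_assoc, h, mul_assoc]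

theorem mul_fractionEval (f : FractionRing k[X]) :
    P * fractionEval s hs f = fractionEval s hs (shift k f) * P := by
  obtain ⟨p, q, hq, rfl⟩ := IsFractionRing.div_surjective (A := k[X]) f
  have hq0 := nonZeroDivisors.ne_zero hq
  have hq1 : algebraMap k[X] (FractionRing k[X]) q ≠ 0 := by
    rwa [Ne, IsFractionRing.to_map_eq_zero_iff]
  set f := algebraMap k[X] (FractionRing k[X]) p / algebraMap k[X] (FractionRing k[X]) q
  have e : f * algebraMap k[X] _ q = algebraMap k[X] _ p := div_mul_cancel₀ _ hq1
  have hu := hs q hq0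
  rw [← fractionEval_algebraMap s hs] at hu
  refine hu.mul_right_cancel ?_
  rw [mul_assoc, ← map_mul, e, mul_assoc, fractionEval_algebraMap, fractionEval_algebraMap,
    mul_aeval s hP, mul_aeval s hP, ← mul_assoc, ← fractionEval_algebraMap s hs,
    ← fractionEval_algebraMap s hs, ← map_mul, ← shift_algebraMap, ← shift_algebraMap,
    ← map_mul, e]

end Fractions

/-- If `s P - P s = P` and the nonzero polynomials in `s` are invertible, then `s / (s - 1/2)` and
its conjugate by `(1 - P) / (1 + P)` generate a free group algebra. -/
theorem lift_evalHom_injective_of_commutator {k E A : Type*} [Field k] [CharZero k] [Ring E]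
    [Nontrivial E] [Algebra k E] [Ring A] [Algebra k A] (ψ : A →ₐ[k] E) (s P : E)
    (hs : ∀ f : k[X], f ≠ 0 → IsUnit (aeval s f)) (hsP : s * P - P * s = P) (hPu : IsUnit P)
    (u η : Aˣ) (hu : ψ u * (s - algebraMap k E (1 / 2)) = s) (hη : (1 + P) * ψ η = 1 - P) :
    Function.Injective
      (MonoidAlgebra.lift k A (FreeGroup (Fin 2)) ((Units.coeHom A).comp (evalHom u η))) := by
  let φ := fractionEval s hs
  -- Rational functions act by left multiplication with their value at `s`; `P` is then semilinear
  -- for the shift.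
  let _ : Module (FractionRing k[X]) E := Module.compHom E φ
  have smul_def : ∀ (f : FractionRing k[X]) (x : E), f • x = φ f * x := fun _ _ => rfl
  have : IsScalarTower (FractionRing k[X]) E E := ⟨fun f x y => mul_assoc (φ f) x y⟩
  have : IsScalarTower k (FractionRing k[X]) E := ⟨fun c f x => by
    rw [smul_def, smul_def, Algebra.smul_def, Algebra.smul_def, map_mul, mul_assoc]
    exact congrArg (· * _) (fractionEval_C s hs c)⟩
  have hP : ∀ (f : FractionRing k[X]) (x : E), P * (f • x) = shift k f • (P * x) := by
    intro f x
    rw [smul_def, smul_def, ← mul_assoc, ← mul_assoc, mul_fractionEval s hs hsP]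
  have hu' : ψ u = ratio k • (1 : E) := by
    have h1 := hs (X - C (1 / 2)) (X_sub_C_ne_zero _)
    rw [map_sub, aeval_X, aeval_C] at h1
    refine h1.mul_right_cancel ?_
    have h2 : (algebraMap k[X] (FractionRing k[X]) (X - C (1 / 2))) ≠ 0 := by
      rw [Ne, IsFractionRing.to_map_eq_zero_iff]; exact X_sub_C_ne_zero _
    have h3 : fractionEval s hs (algebraMap k[X] (FractionRing k[X]) (X - C (1 / 2))) =
        s - algebraMap k E (1 / 2) := by
      rw [fractionEval_algebraMap, map_sub, aeval_X, aeval_C]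
    have h4 : fractionEval s hs (algebraMap k[X] (FractionRing k[X]) X) = s := by
      rw [fractionEval_algebraMap, aeval_X]
    rw [hu, smul_def, mul_one, ← h3, ← map_mul, ratio, inv_mul_cancel_right₀ h2, h4]
  have hinj := lift_evalHom_injective (k := k) (Units.map (ψ : A →* E) u)
    (Units.map (ψ : A →* E) η) hu' hP hη hPu
  -- Only the images under `ψ` satisfy the relation with `s` and `P`, but injectivity after `ψ`
  -- gives injectivity before it.
  have hcomp : ψ.comp (MonoidAlgebra.lift k A (FreeGroup (Fin 2))
      ((Units.coeHom A).comp (evalHom u η))) = MonoidAlgebra.lift k E (FreeGroup (Fin 2))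
      ((Units.coeHom E).comp (evalHom (Units.map (ψ : A →* E) u) (Units.map (ψ : A →* E) η))) := by
    have h1 : evalHom (Units.map (ψ : A →* E) u) (Units.map (ψ : A →* E) η) =
        (Units.map (ψ : A →* E)).comp (evalHom u η) := by
      refine FreeGroup.ext_hom _ _ fun i => ?_
      fin_cases i <;> simp [evalHom]
    refine (MonoidAlgebra.lift k E (FreeGroup (Fin 2))).symm.injective (MonoidHom.ext fun g => ?_)
    rw [MonoidAlgebra.lift_symm_apply, Equiv.symm_apply_apply, AlgHom.comp_apply,
      MonoidAlgebra.lift_single, one_smul, h1]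
    rfl
  rw [← hcomp] at hinj
  exact Function.Injective.of_comp hinj

end Shift

end

noncomputable section

open MvPolynomial

namespace Cohn

open PBW

attribute [local instance] LieRing.ofAssociativeRing LieAlgebra.ofAssociativeAlgebra

/-! ### Free group algebras in the division ring of a Lie algebra -/

/-- A unit of an algebra that lies in a subalgebra together with its inverse. -/
def unitOfMem {k D : Type*} [CommRing k] [Ring D] [Algebra k D] (S : Subalgebra k D) (v : Dˣ)
    (h : (v : D) ∈ S) (h' : ((v⁻¹ : Dˣ) : D) ∈ S) : Sˣ :=
  ⟨⟨v, h⟩, ⟨(v⁻¹ : Dˣ), h'⟩, Subtype.ext (Units.mul_inv v), Subtype.ext (Units.inv_mul v)⟩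

variable {ι k L : Type*} [LinearOrder ι] [Field k] [LieRing L] [LieAlgebra k L]
  {b : Module.Basis ι k L} {w : ι → ℤ}

theorem WtDiv.sub {j : ℤ} {y z : DivRing k L} (hy : WtDiv b w j y) (hz : WtDiv b w j z) :
    WtDiv b w j (y - z) := by
  have h := hy.add (hz.smul (-1))
  rwa [neg_smul, one_smul, ← sub_eq_add_neg] at h

theorem WtDiv.pow {j : ℤ} {y : DivRing k L} (hy : WtDiv b w j y) (n : ℕ) :
    WtDiv b w (n * j) (y ^ n) := by
  induction n with
  | zero => simpa using wtDiv_one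
  | succ n ih =>
    rw [pow_succ, show ((n + 1 : ℕ) : ℤ) * j = n * j + j by push_cast; ring]
    exact ih.mul hy

theorem WtDiv.of_eq {i j : ℤ} {y : DivRing k L} (hy : WtDiv b w i y) (h : i = j) :
    WtDiv b w j y := h ▸ hy

/-- The homogenization of a polynomial, evaluated at elements of the enveloping algebra. -/
def homogEval (f : Polynomial k) (a z : UniversalEnvelopingAlgebra k L) :
    UniversalEnvelopingAlgebra k L :=
  ∑ i ∈ Finset.range (f.natDegree + 1), f.coeff i • (a ^ i * z ^ (f.natDegree - i))

variable {m : ℕ} {e : ℤ} {a z : UniversalEnvelopingAlgebra k L}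

theorem pow_mul_pow_mem_filtration (b : Module.Basis ι k L) (ha : a ∈ filtration k L (m + 1))
    (hz : z ∈ filtration k L m) {i d : ℕ} (h : i ≤ d) :
    a ^ i * z ^ (d - i) ∈ filtration k L (d * m + i) := by
  have h1 := mul_mem_filtration k L (sym_pow b ha i).1 (sym_pow b hz (d - i)).1
  obtain ⟨j, rfl⟩ := Nat.exists_eq_add_of_le h
  rw [Nat.add_sub_cancel_left] at h1 ⊢
  rwa [show i * (m + 1) + j * m = (i + j) * m + i by ring] at h1

theorem homogEval_mem_filtration (b : Module.Basis ι k L) (ha : a ∈ filtration k L (m + 1))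
    (hz : z ∈ filtration k L m) (f : Polynomial k) :
    homogEval f a z ∈ filtration k L (f.natDegree * m + f.natDegree) := by
  refine Submodule.sum_mem _ fun i hi => Submodule.smul_mem _ _ ?_
  have hi' := Nat.lt_succ_iff.1 (Finset.mem_range.1 hi)
  exact filtration_mono k L (by omega) (pow_mul_pow_mem_filtration b ha hz hi')

/-- `a` is allowed one filtration degree more than `z`, so only the top power of `a` reaches the
symbol. -/
theorem sym_homogEval (b : Module.Basis ι k L) (ha : a ∈ filtration k L (m + 1))
    (hz : z ∈ filtration k L m) (f : Polynomial k) :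
    sym b (f.natDegree * m + f.natDegree) (homogEval f a z) =
      f.leadingCoeff • sym b (m + 1) a ^ f.natDegree := by
  rw [homogEval, map_sum, Finset.sum_range_succ, Finset.sum_eq_zero, zero_add, map_smul,
    Nat.sub_self, pow_zero, mul_one, ← (sym_pow b ha _).2, mul_add, mul_one]
  · rfl
  · intro i hi
    have hi' := Finset.mem_range.1 hi
    obtain ⟨N, hN⟩ : ∃ N, f.natDegree * m + f.natDegree = N + 1 :=
      ⟨f.natDegree * m + f.natDegree - 1, by omega⟩
    rw [map_smul, hN, sym_succ_of_mem b, smul_zero]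
    exact filtration_mono k L (by omega) (pow_mul_pow_mem_filtration b ha hz hi'.le)

theorem homogEval_mem_wtFil (ha : a ∈ wtFil b w e) (hz : z ∈ wtFil b w e) (f : Polynomial k) :
    homogEval f a z ∈ wtFil b w (f.natDegree * e) := by
  refine Submodule.sum_mem _ fun i hi => Submodule.smul_mem _ _ ?_
  have hi' := Nat.lt_succ_iff.1 (Finset.mem_range.1 hi)
  obtain ⟨j, hj⟩ := Nat.exists_eq_add_of_le hi'
  have h := mul_mem_wtFil (pow_mem_wtFil ha i) (pow_mem_wtFil hz (f.natDegree - i))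
  rw [hj, Nat.add_sub_cancel_left] at h ⊢
  rwa [show ((i + j : ℕ) : ℤ) * e = i * e + j * e by push_cast; ring]

theorem sym_pow_notMem (ha : a ∈ filtration k L (m + 1)) (haw : a ∈ wtFil b w e)
    (ha' : sym b (m + 1) a ∉ wtLE k w (e - 1)) (d : ℕ) :
    sym b (m + 1) a ^ d ∉ wtLE k w (d * e - 1) := by
  have hs : IsExact b w e (mono (m + 1) a ha) := ⟨mono_mem_wtRees ha haw, by rwa [grMap_mono]⟩
  have h := (hs.pow d).2
  rwa [map_pow, grMap_mono] at h

/-- Elements of exact weight give units of weight zero. -/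
theorem exists_unit_of_exact (hz : z ∈ filtration k L m) (hzw : z ∈ wtFil b w e)
    (hz' : sym b m z ∉ wtLE k w (e - 1)) (Z : (DivRing k L)ˣ)
    (hZ : (Z : DivRing k L) = embedding k L z) {n d : ℕ} {c : UniversalEnvelopingAlgebra k L}
    (hc : c ∈ filtration k L n) (hcw : c ∈ wtFil b w (d * e))
    (hc' : sym b n c ∉ wtLE k w (d * e - 1)) :
    ∃ v : (divSubring k L ⊓ wtZero b w : Subalgebra k (DivRing k L))ˣ,
      ((v : (divSubring k L ⊓ wtZero b w : Subalgebra k (DivRing k L))) : DivRing k L) =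
        embedding k L c * ((Z⁻¹ : (DivRing k L)ˣ) : DivRing k L) ^ d := by
  obtain ⟨C, hC⟩ := isUnit_embedding b hc fun h0 => hc' (h0 ▸ Submodule.zero_mem _)
  have hZm : (Z : DivRing k L) ∈ divSubring k L := hZ ▸ embedding_mem z
  have hCm : (C : DivRing k L) ∈ divSubring k L := hC ▸ embedding_mem c
  have hZi := wtDiv_inv hz hzw hz' (y := ((Z⁻¹ : (DivRing k L)ˣ) : DivRing k L))
    (by rw [← hZ, Units.mul_inv])
  have hCi := wtDiv_inv hc hcw hc' (y := ((C⁻¹ : (DivRing k L)ˣ) : DivRing k L))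
    (by rw [← hC, Units.mul_inv])
  have hval : ((C * Z⁻¹ ^ d : (DivRing k L)ˣ) : DivRing k L) =
      embedding k L c * ((Z⁻¹ : (DivRing k L)ˣ) : DivRing k L) ^ d := by
    rw [Units.val_mul, Units.val_pow_eq_pow_val, hC]
  have hinv : (((C * Z⁻¹ ^ d)⁻¹ : (DivRing k L)ˣ) : DivRing k L) =
      embedding k L z ^ d * ((C⁻¹ : (DivRing k L)ˣ) : DivRing k L) := by
    rw [mul_inv_rev, inv_pow, inv_inv, Units.val_mul, Units.val_pow_eq_pow_val, hZ]
  refine ⟨unitOfMem _ (C * Z⁻¹ ^ d) ⟨?_, ?_⟩ ⟨?_, ?_⟩, hval⟩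
  · rw [hval]
    exact mul_mem (embedding_mem c) (pow_mem (inv_mem_divSubring Z hZm) d)
  · have h1 := (wtDiv_embedding hc hcw).mul (hZi.pow d)
    change WtDiv b w 0 _
    rw [hval]
    exact h1.of_eq (by ring)
  · rw [hinv]
    exact mul_mem (pow_mem (embedding_mem z) d) (inv_mem_divSubring C hCm)
  · have h1 := ((wtDiv_embedding hz hzw).pow d).mul hCi
    change WtDiv b w 0 _
    rw [hinv]
    exact h1.of_eq (by ring)

/-- The pair is `s = a z⁻¹`, `P = p z⁻¹` in the quotient by negative weights. The bound `2 e - 1` is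
one below the weight of a product, so the last three hypotheses say that there `z` commutes with `a`
and `p`, and `a p - p a = p z`. Because `z` has smaller filtration degree than `a` and `p`, adding
multiples of `z` does not change their symbols, so `1 ± P`, `s - 1/2` and the polynomials in `s` are
units. -/
theorem exists_injective_of_commutator [CharZero k] {p : UniversalEnvelopingAlgebra k L}
    (ha : a ∈ filtration k L (m + 1)) (hp : p ∈ filtration k L (m + 1))
    (hz : z ∈ filtration k L m) (haw : a ∈ wtFil b w e) (hpw : p ∈ wtFil b w e)
    (hzw : z ∈ wtFil b w e) (ha' : sym b (m + 1) a ∉ wtLE k w (e - 1))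
    (hp' : sym b (m + 1) p ∉ wtLE k w (e - 1)) (hz' : sym b m z ∉ wtLE k w (e - 1))
    (hza : z * a - a * z ∈ wtFil b w (2 * e - 1)) (hzp : z * p - p * z ∈ wtFil b w (2 * e - 1))
    (hap : a * p - p * a - p * z ∈ wtFil b w (2 * e - 1)) :
    ∃ f : MonoidAlgebra k (FreeGroup (Fin 2)) →ₐ[k] divSubring k L, Function.Injective f := by
  obtain ⟨Z, hZ⟩ := isUnit_embedding b hz fun h0 => hz' (h0 ▸ Submodule.zero_mem _)
  set S : Subalgebra k (DivRing k L) := divSubring k L ⊓ wtZero b w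
  have hunit := fun {n d : ℕ} {c : UniversalEnvelopingAlgebra k L} hc hcw hc' =>
    exists_unit_of_exact hz hzw hz' Z hZ (n := n) (d := d) (c := c) hc hcw hc'
  set zi : DivRing k L := ((Z⁻¹ : (DivRing k L)ˣ) : DivRing k L) with hzi
  have hZzi : embedding k L z * zi = 1 := by rw [← hZ, hzi, Units.mul_inv]
  have hziZ : zi * embedding k L z = 1 := by rw [← hZ, hzi, Units.inv_mul]
  have hziw : WtDiv b w (-e) zi := wtDiv_inv hz hzw hz' hZzi
  have hz1 : z ∈ filtration k L (m + 1) := filtration_mono k L (Nat.le_succ m) hz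
  have hsz : sym b (m + 1) z = 0 := sym_succ_of_mem b hz
  have hwt : ∀ {c : UniversalEnvelopingAlgebra k L}, c ∈ filtration k L (m + 1 + (m + 1)) →
      c ∈ wtFil b w (2 * e - 1) → WtDiv b w (2 * e - 1) (embedding k L c) :=
    fun hc hcw => wtDiv_embedding hc hcw
  have hcomm : ∀ {c : UniversalEnvelopingAlgebra k L}, c ∈ filtration k L (m + 1) →
      z * c - c * z ∈ wtFil b w (2 * e - 1) →
      WtDiv b w (-1) (zi * embedding k L c - embedding k L c * zi) := by
    intro c hc hzc
    have h1 := hwt (Submodule.sub_mem _ (mul_mem_filtration k L hz1 hc)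
      (mul_mem_filtration k L hc hz1)) hzc
    -- Conjugating a commutator with `z` by `z⁻¹` on both sides gives minus the commutator with
    -- `z⁻¹`.
    have h2 : zi * embedding k L (z * c - c * z) * zi =
        embedding k L c * zi - zi * embedding k L c := by
      rw [map_sub, map_mul, map_mul, mul_sub, sub_mul, ← mul_assoc, hziZ, one_mul, mul_assoc,
        mul_assoc, hZzi, mul_one]
    have h3 := (((hziw.mul h1).mul hziw).smul (-1)).of_eq (j := -1) (by ring)
    rwa [h2, neg_smul, one_smul, neg_sub] at h3
  have haD := wtDiv_embedding ha haw
  have hpD := wtDiv_embedding hp hpw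
  have hac := hcomm ha hza
  have hpc := hcomm hp hzp
  have hpm : sym b (m + 1) (z + p) ∉ wtLE k w (e - 1) := by rwa [map_add, hsz, zero_add]
  have hpm' : sym b (m + 1) (z - p) ∉ wtLE k w (e - 1) := by
    rw [map_sub, hsz, zero_sub]
    exact fun h => hp' ((Submodule.neg_mem_iff _).1 h)
  have ham : sym b (m + 1) (a - (1 / 2 : k) • z) ∉ wtLE k w (e - 1) := by
    rwa [map_sub, map_smul, hsz, smul_zero, sub_zero]
  have hone : ((1 : ℕ) : ℤ) * e = e := by rw [Nat.cast_one, one_mul]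
  obtain ⟨s, hs⟩ := hunit (d := 1) ha (by rwa [hone]) (by rwa [hone])
  obtain ⟨P, hP⟩ := hunit (d := 1) hp (by rwa [hone]) (by rwa [hone])
  obtain ⟨s', hs'⟩ := hunit (d := 1) (Submodule.sub_mem _ ha (Submodule.smul_mem _ (1 / 2) hz1))
    (by rw [hone]; exact Submodule.sub_mem _ haw (Submodule.smul_mem _ _ hzw)) (by rwa [hone])
  obtain ⟨P₁, hP₁⟩ := hunit (d := 1) (Submodule.add_mem _ hz1 hp)
    (by rw [hone]; exact Submodule.add_mem _ hzw hpw) (by rwa [hone])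
  obtain ⟨P₂, hP₂⟩ := hunit (d := 1) (Submodule.sub_mem _ hz1 hp)
    (by rw [hone]; exact Submodule.sub_mem _ hzw hpw) (by rwa [hone])
  rw [pow_one] at hs hP hs' hP₁ hP₂
  have es' : (s' : S) = s - algebraMap k S (1 / 2) := by
    refine Subtype.ext (hs'.trans ?_)
    rw [map_sub, map_smul, sub_mul, smul_mul_assoc, hZzi, ← hs, ← Algebra.algebraMap_eq_smul_one]
    rfl
  have eP₁ : (P₁ : S) = 1 + P := by
    refine Subtype.ext (hP₁.trans ?_)
    rw [map_add, add_mul, hZzi, ← hP]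
    rfl
  have eP₂ : (P₂ : S) = 1 - P := by
    refine Subtype.ext (hP₂.trans ?_)
    rw [map_sub, sub_mul, hZzi, ← hP]
    rfl
  let ψ : S →ₐ[k] WtGr b w := (toWtGr b w).comp (Subalgebra.inclusion inf_le_right)
  have hψ : ∀ x y : S, WtDiv b w (-1) ((x : DivRing k L) - y) → ψ x = ψ y :=
    fun x y h => toWtGr_eq_iff.2 h
  -- `(a z⁻¹)^i` and `a^i z^{-i}` agree up to negative weight, since moving `z⁻¹` past `a` costs one
  -- unit of weight.
  have hpow : ∀ i : ℕ, WtDiv b w (-1)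
      ((s : S) ^ i - embedding k L a ^ i * zi ^ i : DivRing k L) := by
    have h1 : ∀ i : ℕ, WtDiv b w (-(i * e) + e - 1)
        (zi ^ i * embedding k L a - embedding k L a * zi ^ i) := by
      intro i
      induction i with
      | zero => simpa using wtDiv_zero _
      | succ i ih =>
        have h2 := (((hziw.pow i).mul hac).of_eq (j := -((i + 1 : ℕ) * e) + e - 1)
          (by push_cast; ring)).add ((ih.mul hziw).of_eq (by push_cast; ring))
        refine (congrArg (WtDiv b w _) ?_).mp h2
        rw [pow_succ]
        noncomm_ring
    intro i
    induction i with
    | zero => simpa using wtDiv_zero _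
    | succ i ih =>
      have hs0 : WtDiv b w 0 ((s : S) : DivRing k L) := (s : S).2.2
      have h2 := ((ih.mul hs0).of_eq (j := -1) (by ring)).add
        ((((haD.pow i).mul (h1 i)).mul hziw).of_eq (by ring))
      refine (congrArg (WtDiv b w _) ?_).mp h2
      rw [hs, pow_succ, pow_succ, pow_succ]
      noncomm_ring
  -- Modulo negative weight, `f(s)` is the homogenization of `f` at `a, z` times `z^{-d}` with `d =
  -- deg f`. The homogenization has exact weight, its symbol being the leading coefficient times a
  -- power of the symbol of `a`.
  have hunits : ∀ f : Polynomial k, f ≠ 0 → IsUnit (Polynomial.aeval (ψ s) f) := by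
    intro f hf
    obtain ⟨v, hv⟩ := hunit (d := f.natDegree) (homogEval_mem_filtration b ha hz f)
      (homogEval_mem_wtFil haw hzw f) (by
        rw [sym_homogEval b ha hz]
        intro h
        refine sym_pow_notMem ha haw ha' f.natDegree ?_
        have h1 := Submodule.smul_mem _ (f.leadingCoeff)⁻¹ h
        rwa [smul_smul, inv_mul_cancel₀ (Polynomial.leadingCoeff_ne_zero.2 hf), one_smul] at h1)
    have h1 : ψ (Polynomial.aeval (s : S) f) = ψ v := by
      refine hψ _ _ ?_
      have e1 : ((Polynomial.aeval (s : S) f : S) : DivRing k L) - (v : S) =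
          ∑ i ∈ Finset.range (f.natDegree + 1), f.coeff i •
            (((s : S) : DivRing k L) ^ i - embedding k L a ^ i * zi ^ i) := by
        rw [hv, Polynomial.aeval_eq_sum_range, homogEval, map_sum, Finset.sum_mul,
          AddSubmonoidClass.coe_finsetSum, ← Finset.sum_sub_distrib]
        refine Finset.sum_congr rfl fun i hi => ?_
        have hi' := Nat.lt_succ_iff.1 (Finset.mem_range.1 hi)
        have hcanc : embedding k L z ^ (f.natDegree - i) * zi ^ f.natDegree = zi ^ i := by
          have h3 : ∀ j : ℕ, embedding k L z ^ j * zi ^ j = 1 := fun j => by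
            rw [← (show Commute (embedding k L z) zi from hZzi.trans hziZ.symm).mul_pow, hZzi,
              one_pow]
          obtain ⟨j, hj⟩ := Nat.exists_eq_add_of_le' hi'
          rw [hj, Nat.add_sub_cancel, pow_add, ← mul_assoc, h3, one_mul]
        rw [smul_sub, map_smul, map_mul, map_pow, map_pow, smul_mul_assoc, mul_assoc, hcanc]
        rfl
      rw [e1]
      refine Finset.sum_induction _ (WtDiv b w (-1)) (fun _ _ => WtDiv.add) (wtDiv_zero _) ?_
      exact fun i _ => (hpow i).smul _
    rw [← Polynomial.aeval_algHom_apply] at h1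
    rw [h1]
    exact v.isUnit.map ψ
  have hsP : ψ s * ψ P - ψ P * ψ s = ψ P := by
    rw [← map_mul, ← map_mul, ← map_sub]
    refine hψ _ _ ?_
    have h1 := hwt (Submodule.sub_mem _ (Submodule.sub_mem _ (mul_mem_filtration k L ha hp)
      (mul_mem_filtration k L hp ha)) (mul_mem_filtration k L hp hz1)) hap
    -- `s P - P s - P` is `(a p - p a - p z) z⁻²` corrected by the commutators of `z⁻¹` with `p` and
    -- with `a`.
    have h2 := ((((h1.mul hziw).mul hziw).of_eq (j := -1) (by ring)).add
      (((haD.mul hpc).mul hziw).of_eq (by ring))).sub (((hpD.mul hac).mul hziw).of_eq (by ring))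
    refine (congrArg (WtDiv b w _) ?_).mp h2
    change _ = ((s : S) : DivRing k L) * (P : S) - (P : S) * (s : S) - (P : S)
    have h3 : embedding k L p * embedding k L z * zi = embedding k L p := by
      rw [mul_assoc, hZzi, mul_one]
    rw [hs, hP, map_sub, map_sub, map_mul, map_mul, map_mul, sub_mul _ _ zi, h3]
    noncomm_ring
  -- The two generators are formed in the subring itself, from the lifted units `s - 1/2`, `1 + P`
  -- and `1 - P`.
  refine ⟨(Subalgebra.inclusion (inf_le_left : S ≤ divSubring k L)).comp
    (MonoidAlgebra.lift k S (FreeGroup (Fin 2)) ((Units.coeHom S).comp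
      (Shift.evalHom (s * s'⁻¹) (P₁⁻¹ * P₂)))), ?_⟩
  refine (Subalgebra.inclusion_injective (inf_le_left : S ≤ divSubring k L)).comp ?_
  refine Shift.lift_evalHom_injective_of_commutator ψ (ψ s) (ψ P) hunits hsP (P.isUnit.map ψ) _ _
    ?_ ?_
  · rw [← AlgHom.commutes ψ, ← map_sub, ← es', ← map_mul, Units.val_mul, Units.inv_mul_cancel_right]
  · rw [← map_one ψ, ← map_add, ← map_sub, ← eP₁, ← eP₂, ← map_mul, Units.val_mul,
      Units.mul_inv_cancel_left]

end Cohn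

end

noncomputable section

open MvPolynomial

namespace Cohn

open PBW

attribute [local instance] LieRing.ofAssociativeRing LieAlgebra.ofAssociativeAlgebra

/-! ### The choice of weights and elements. -/

section Weights

variable {ι k L : Type*} [LinearOrder ι] [Field k] [LieRing L] [LieAlgebra k L]
  {b : Module.Basis ι k L} {w : ι → ℤ}

theorem ι_mem_wtFil_of_repr (hw : ∀ i j l, b.repr ⁅b i, b j⁆ l ≠ 0 → w l ≤ w i + w j) {x : L}
    {j : ℤ} (h : ∀ i, b.repr x i ≠ 0 → w i ≤ j) :
    UniversalEnvelopingAlgebra.ι k x ∈ wtFil b w j := by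
  rw [← b.linearCombination_repr x, Finsupp.linearCombination_apply, Finsupp.sum, map_sum]
  refine Submodule.sum_mem _ fun i hi => ?_
  rw [map_smul]
  exact Submodule.smul_mem _ _ (wtFil_mono (h i (Finsupp.mem_support_iff.1 hi)) (ι_mem_wtFil hw i))

omit [LinearOrder ι] in
theorem X_mem_wtLE (i : ι) : (X i : MvPolynomial ι k) ∈ wtLE k w (w i) :=
  wtLE_of_isWeightedHomogeneous (isWeightedHomogeneous_X k w i)

omit [LinearOrder ι] in
theorem X_notMem_wtLE (i : ι) : (X i : MvPolynomial ι k) ∉ wtLE k w (w i - 1) := fun h =>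
  X_ne_zero i (eq_zero_of_isWeightedHomogeneous (isWeightedHomogeneous_X k w i) h)

omit [LinearOrder ι] in
theorem notMem_wtLE_zero {f : MvPolynomial ι k} (hf : f ≠ 0) : f ∉ wtLE k (0 : ι → ℤ) (0 - 1) := by
  rw [mem_wtLE]
  intro h
  obtain ⟨m, hm⟩ := ne_zero_iff.1 hf
  have h1 := h m hm
  have h2 : Finsupp.weight (0 : ι → ℤ) m = 0 := by simp [Finsupp.weight_apply]
  omega

theorem ι_mem_filtration_one (x : L) : UniversalEnvelopingAlgebra.ι k x ∈ filtration k L 1 := by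
  rw [filtration, pow_one]
  exact ι_mem_filtrationOne k L x

theorem ι_mul_sub (x y : L) : UniversalEnvelopingAlgebra.ι k x * UniversalEnvelopingAlgebra.ι k y -
    UniversalEnvelopingAlgebra.ι k y * UniversalEnvelopingAlgebra.ι k x =
      UniversalEnvelopingAlgebra.ι k ⁅x, y⁆ := by
  rw [LieHom.map_lie, LieRing.of_associative_ring_bracket]

end Weights

variable {k L : Type*} [Field k] [CharZero k] [LieRing L] [LieAlgebra k L]

/-- The case of a Lie algebra that contains the nonabelian Lie algebra of dimension two. -/
theorem exists_injective_of_lie_eq_self {x y : L} (hy : y ≠ 0) (hxy : ⁅x, y⁆ = y) :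
    ∃ f : MonoidAlgebra k (FreeGroup (Fin 2)) →ₐ[k] divSubring k L, Function.Injective f := by
  classical
  let b := Module.Basis.ofVectorSpace k L
  let _ : LinearOrder (Module.Basis.ofVectorSpaceIndex k L) :=
    IsWellOrder.linearOrder WellOrderingRel
  have hx : x ≠ 0 := by
    rintro rfl
    rw [zero_lie] at hxy
    exact hy hxy.symm
  have hι : ∀ x : L, UniversalEnvelopingAlgebra.ι k x ∈ wtFil b 0 0 := fun x =>
    ι_mem_wtFil_of_repr (fun _ _ _ _ => le_refl (0 : ℤ)) fun _ _ => le_refl (0 : ℤ)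
  refine exists_injective_of_commutator (b := b) (w := 0) (m := 0) (e := 0)
    (a := UniversalEnvelopingAlgebra.ι k x) (p := UniversalEnvelopingAlgebra.ι k y) (z := 1)
    (ι_mem_filtration_one x) (ι_mem_filtration_one y) (one_mem_filtration k L 0) (hι x) (hι y)
    one_mem_wtFil (notMem_wtLE_zero (sym_ι_ne_zero b hx)) (notMem_wtLE_zero (sym_ι_ne_zero b hy))
    ?_ ?_ ?_ ?_
  · rw [sym_zero_one]
    exact notMem_wtLE_zero one_ne_zero
  · rw [one_mul, mul_one, sub_self]
    exact Submodule.zero_mem _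
  · rw [one_mul, mul_one, sub_self]
    exact Submodule.zero_mem _
  · rw [mul_one, ι_mul_sub, hxy, sub_self]
    exact Submodule.zero_mem _

/-- If `Z = ⁅Y, X⁆` then `Y X / 2` and `X ^ 2` generate, modulo terms with `⁅Z, X⁆`, the
nonabelian Lie algebra of dimension two with an additional central factor `Z`. -/
theorem half_mul_commutator {A : Type*} [Ring A] [Algebra k A] (X Y Z : A)
    (hZ : Y * X - X * Y = Z) :
    (1 / 2 : k) • (Y * X) * (X * X) - X * X * ((1 / 2 : k) • (Y * X)) - X * X * Z =
      X * (Z * X - X * Z) + (1 / 2 : k) • ((Z * X - X * Z) * X) := by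
  have h : ∀ C D : A, (2 : k) • C = (2 : k) • D → C = D := by
    intro C D hCD
    have := congrArg ((2 : k)⁻¹ • ·) hCD
    simpa [smul_smul] using this
  apply h
  simp only [smul_add, smul_sub, smul_smul, smul_mul_assoc, mul_smul_comm,
    mul_one_div_cancel (two_ne_zero : (2 : k) ≠ 0), one_smul, two_smul]
  rw [← hZ]
  noncomm_ring

/-- With weight `1` on `b i`, `b j` and `2` elsewhere, brackets never raise weight, and the
quadratic elements `b j * b i`, `b i * b i` share weight `2` with their linear partner `b l` while
having larger filtration degree. -/
theorem exists_injective_of_basis {ι : Type*} [LinearOrder ι] (b : Module.Basis ι k L)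
    {i j l : ι} (hli : l ≠ i) (hlj : l ≠ j) (hl : b l = ⁅b j, b i⁆) :
    ∃ f : MonoidAlgebra k (FreeGroup (Fin 2)) →ₐ[k] divSubring k L, Function.Injective f := by
  let w : ι → ℤ := fun i' => if i' = i ∨ i' = j then 1 else 2
  have hw2 : ∀ i', w i' ≤ 2 := by
    intro i'
    simp only [w]
    split_ifs <;> omega
  have hw1 : ∀ i', 1 ≤ w i' := by
    intro i'
    simp only [w]
    split_ifs <;> omega
  have hwx : w i = 1 := if_pos (Or.inl rfl)
  have hwy : w j = 1 := if_pos (Or.inr rfl)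
  have hwz : w l = 2 := if_neg (not_or.2 ⟨hli, hlj⟩)
  have hw : ∀ i j l, b.repr ⁅b i, b j⁆ l ≠ 0 → w l ≤ w i + w j := by
    intro i j l _
    have := hw1 i
    have := hw1 j
    have := hw2 l
    omega
  clear_value w
  have hι : ∀ x : L, UniversalEnvelopingAlgebra.ι k x ∈ wtFil b w 2 := fun x =>
    ι_mem_wtFil_of_repr hw fun i _ => hw2 i
  have hιl := hι (b l)
  have hXw : UniversalEnvelopingAlgebra.ι k (b i) ∈ wtFil b w 1 := hwx ▸ ι_mem_wtFil hw i
  have hYw : UniversalEnvelopingAlgebra.ι k (b j) ∈ wtFil b w 1 := hwy ▸ ι_mem_wtFil hw j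
  have hX1 := ι_mem_filtration_one (k := k) (b i)
  have hY1 := ι_mem_filtration_one (k := k) (b j)
  have hXX : ∀ j, w j = 1 → (X j * X i : MvPolynomial ι k) ∉ wtLE k w (2 - 1) := by
    intro j hj
    have := mul_notMem_wtLE (X_mem_wtLE (k := k) (w := w) j) (X_mem_wtLE i)
      (X_notMem_wtLE _) (X_notMem_wtLE _)
    rwa [hj, hwx] at this
  -- Any element of `L` has weight at most `2`, so its product with `b i` or `b j` has weight at
  -- most `3`, below the `4` of a product of two of the chosen elements. Commutators with `b l` are
  -- sums of such products.
  have h12 : (1 : ℤ) + 2 ≤ 2 * 2 - 1 := by norm_num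
  have h21 : (2 : ℤ) + 1 ≤ 2 * 2 - 1 := by norm_num
  have hYXw := mul_mem_wtFil hYw hXw
  have hXXw := mul_mem_wtFil hXw hXw
  rw [one_add_one_eq_two] at hYXw hXXw
  have hYX2 := mul_mem_filtration k L hY1 hX1
  have hXX2 := mul_mem_filtration k L hX1 hX1
  have hc : ∀ u u' : L, UniversalEnvelopingAlgebra.ι k u ∈ wtFil b w 1 →
      UniversalEnvelopingAlgebra.ι k u' ∈ wtFil b w 1 →
      UniversalEnvelopingAlgebra.ι k (b l) * (UniversalEnvelopingAlgebra.ι k u *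
        UniversalEnvelopingAlgebra.ι k u') - UniversalEnvelopingAlgebra.ι k u *
        UniversalEnvelopingAlgebra.ι k u' * UniversalEnvelopingAlgebra.ι k (b l) ∈
          wtFil b w (2 * 2 - 1) := by
    intro u u' hu hu'
    have h1 := Submodule.add_mem _ (wtFil_mono h21 (mul_mem_wtFil (hι ⁅b l, u⁆) hu'))
      (wtFil_mono h12 (mul_mem_wtFil hu (hι ⁅b l, u'⁆)))
    rw [← ι_mul_sub, ← ι_mul_sub] at h1
    refine (congrArg (· ∈ wtFil b w _) ?_).mp h1
    noncomm_ring
  have hcomm : UniversalEnvelopingAlgebra.ι k (b j) * UniversalEnvelopingAlgebra.ι k (b i) -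
      UniversalEnvelopingAlgebra.ι k (b i) * UniversalEnvelopingAlgebra.ι k (b j) =
      UniversalEnvelopingAlgebra.ι k (b l) := by rw [ι_mul_sub, hl]
  refine exists_injective_of_commutator (b := b) (w := w) (m := 1) (e := 2)
    (a := (1 / 2 : k) • (UniversalEnvelopingAlgebra.ι k (b j) *
      UniversalEnvelopingAlgebra.ι k (b i)))
    (p := UniversalEnvelopingAlgebra.ι k (b i) * UniversalEnvelopingAlgebra.ι k (b i))
    (z := UniversalEnvelopingAlgebra.ι k (b l))
    (Submodule.smul_mem _ _ hYX2) hXX2 (ι_mem_filtration_one _) (Submodule.smul_mem _ _ hYXw)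
    hXXw hιl ?_ ?_ ?_ ?_ (hc _ _ hXw hXw) ?_
  · rw [map_smul, sym_mul b hY1 hX1, sym_ι_basis, sym_ι_basis]
    intro h1
    refine hXX j hwy ?_
    have h2 := Submodule.smul_mem _ (2 : k) h1
    rwa [smul_smul, mul_one_div_cancel two_ne_zero, one_smul] at h2
  · rw [sym_mul b hX1 hX1, sym_ι_basis]
    exact hXX i hwx
  · rw [sym_ι_basis, ← hwz]
    exact X_notMem_wtLE _
  · rw [mul_smul_comm, smul_mul_assoc, ← smul_sub]
    exact Submodule.smul_mem _ _ (hc _ _ hYw hXw)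
  · rw [half_mul_commutator (k := k) _ _ _ hcomm, ι_mul_sub]
    exact Submodule.add_mem _ (wtFil_mono h12 (mul_mem_wtFil hXw (hι _)))
      (Submodule.smul_mem _ _ (wtFil_mono h21 (mul_mem_wtFil (hι _) hXw)))

/-- The case of two elements that are linearly independent of their commutator. -/
theorem exists_injective_of_linearIndependent {x y : L}
    (h : LinearIndependent k ![x, y, ⁅y, x⁆]) :
    ∃ f : MonoidAlgebra k (FreeGroup (Fin 2)) →ₐ[k] divSubring k L, Function.Injective f := by
  let b := Module.Basis.extend h.linearIndepOn_id
  let _ : LinearOrder (h.linearIndepOn_id.extend (Set.subset_univ _)) :=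
    IsWellOrder.linearOrder WellOrderingRel
  let v : Fin 3 → h.linearIndepOn_id.extend (Set.subset_univ _) := fun j =>
    ⟨_, Module.Basis.subset_extend _ (Set.mem_range_self j)⟩
  have hv : Function.Injective v := fun i j hij => h.injective (congrArg Subtype.val hij)
  have hb : ∀ j, b (v j) = ![x, y, ⁅y, x⁆] j := fun j => Module.Basis.extend_apply_self _ _
  refine exists_injective_of_basis b (i := v 0) (j := v 1) (l := v 2) (hv.ne (by decide))
    (hv.ne (by decide)) ?_
  rw [hb, hb, hb]
  rfl

end Cohn

end

/-! ### The main theorem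

The argument applies to every nonabelian Lie algebra; the hypothesis `h` is not used. -/

theorem theorem1p1 (k : Type*) (L : Type*) [Field k] [CharZero k] [LieRing L] [LieAlgebra k L]
    (hL : ¬ IsLieAbelian L)
    (h : IsResiduallyNilpotent k L ∨ IsOreDomain (UniversalEnvelopingAlgebra k L)) :
    ∃ f : MonoidAlgebra k (FreeGroup (Fin 2)) →ₐ[k] Cohn.divSubring k L,
      Function.Injective f := by
  obtain ⟨y, x, hyx⟩ : ∃ y x : L, ⁅y, x⁆ ≠ 0 := by
    by_contra! hcon
    exact hL ⟨hcon⟩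
  by_cases hli : LinearIndependent k ![x, y, ⁅y, x⁆]
  · exact Cohn.exists_injective_of_linearIndependent hli
  rw [Fintype.not_linearIndependent_iff] at hli
  obtain ⟨c, hc, j, hj⟩ := hli
  rw [Fin.sum_univ_three] at hc
  change c 0 • x + c 1 • y + c 2 • ⁅y, x⁆ = 0 at hc
  -- Bracketing the relation with `y`, and below with `x`, shows that `⁅y, x⁆` is a common
  -- eigenvector of both up to the factor `c 2`.
  have h1 : c 0 • ⁅y, x⁆ = -(c 2 • ⁅y, ⁅y, x⁆⁆) := by
    have := congrArg (⁅y, ·⁆) hc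
    simp only [lie_add, lie_smul, lie_self, lie_zero, smul_zero, add_zero] at this
    exact eq_neg_of_add_eq_zero_left this
  have h2 : c 1 • ⁅y, x⁆ = c 2 • ⁅x, ⁅y, x⁆⁆ := by
    have := congrArg (⁅x, ·⁆) hc
    simp only [lie_add, lie_smul, lie_self, lie_zero, smul_zero, zero_add] at this
    rw [← lie_skew, smul_neg] at this
    exact (neg_add_eq_zero.1 this)
  have hc2 : c 2 ≠ 0 := by
    intro h0
    rw [h0, zero_smul, neg_zero] at h1
    rw [h0, zero_smul] at h2
    have h3 := (smul_eq_zero.1 h1).resolve_right hyx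
    have h4 := (smul_eq_zero.1 h2).resolve_right hyx
    fin_cases j
    · exact hj h3
    · exact hj h4
    · exact hj h0
  -- As `c 2 ≠ 0` and `⁅y, x⁆ ≠ 0`, one of `c 0`, `c 1` is nonzero. Then a multiple of `y` or of `x`
  -- acts on `⁅y, x⁆` as the identity.
  by_cases hc0 : c 0 = 0
  · have hc1 : c 1 ≠ 0 := by
      intro h0
      rw [hc0, h0, zero_smul, zero_smul, zero_add, zero_add] at hc
      exact hyx ((smul_eq_zero.1 hc).resolve_left hc2)
    refine Cohn.exists_injective_of_lie_eq_self (x := ((c 1)⁻¹ * c 2) • x) hyx ?_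
    rw [smul_lie, mul_smul, ← h2, smul_smul, inv_mul_cancel₀ hc1, one_smul]
  · refine Cohn.exists_injective_of_lie_eq_self (x := -(((c 0)⁻¹ * c 2) • y)) hyx ?_
    rw [neg_lie, smul_lie, mul_smul, ← smul_neg, ← h1, smul_smul, inv_mul_cancel₀ hc0, one_smul]
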